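/- Notation. Let $\mathbb S=\{q\in\mathbb H: q^2=-1\}$, $\mathbb C_I=\mathbb R+I\mathbb R$ for $I\in\mathbb S$, and $\mathbb S_q=x+\mathbb S y$ for $q=x+Iy$. A basic product domain is a nonempty connected open axially symmetric set $\Omega\subset\mathbb H\setminus\mathbb R$ such that for every $I\in\mathbb S$ the connected components of $\Omega\cap\mathbb C_I$ are simply connected. $\mathcal{SR}(\Omega)$ is the set of slice regular functions on $\Omega$ (slice functions induced by holomorphic stem functions), $\mathcal{SR}_{\mathbb R}(\Omega)$ the subset of slice preserving ones. Write $f=f_0+f_1i+f_2j+f_3k=f_0+f_v$ with $f_0,\dots,f_3\in\mathcal{SR}_{\mathbb R}(\Omega)$, and $f^s=f_0^2+f_1^2+f_2^2+f_3^2$; $f$ is called vectorial if $f=f_v$. Let $\exp_*f=\sum_n f^{*n}/n!$; a $*$-logarithm of $g$ on $\Omega$ is an $f\in\mathcal{SR}(\Omega)$ with $\exp_*f=g$. Let $\mu(q)=\sum_{n\ge0}(-1)^nq^n/(2n)!$, $\nu(q)=\sum_{n\ge0}(-1)^nq^n/(2n+1)!$, and let $\mathcal I(x+Iy)=I$ for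 $y>0$. Two vectorial functions defined near $\mathbb S_p$ are equivalent at $p$ if on some axially symmetric domain $V\ni p$ they satisfy $af+bg=0$ with $a,b\in\mathcal{SR}_{\mathbb R}(V)$ not both identically zero (zero being equivalent to zero only). A vectorial class $\omega$ on $\Omega$ assigns to each $p\in\Omega$ an equivalence class at $p$, compatibly: if vectorial functions $u,v$ on axially symmetric domains $U,V\subset\Omega$ represent $\omega$ at some point of $U$, respectively at some point of $V$, then $u,v$ are equivalent at each point of $U\cap V$. $\mathcal{SR}_\omega(\Omega)$ is the set of all $g\in\mathcal{SR}(\Omega)$ such that at each $p\in\Omega$ the vectorial part $g_v$ vanishes near $p$ or represents $\omega(p)$. A representative of $\omega$ on an axially symmetric domain $U\subset\Omega$ is minimal if it vanishes identically on no sphere $\mathbb S_q\subset U$ (and at no real point); $Z(\omega)$ is the union of the zero sets of all minimal representatives of $\omega$ on such domains. Theorem. Let $\Omega$ be a basic product domain, $\omega$ a vectorial class on $\Omega$ with $Z(\omega)=\{z_0\}$, and let $g\in\mathcal{SR}_\omega(\Omega)$ be nonvanishing. Then there is a square root $\sqrt{g^s}\in\mathcal{SR}_{\mathbb R}(\Omega)$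 of $g^s$ with $\sqrt{g^s}(z_0)=g_0(z_0)$. For any such $\sqrt{g^s}$ the function $g_0/\sqrt{g^s}$ has a lift $G=\mu^{-1}(g_0/\sqrt{g^s})\in\mathcal{SR}_{\mathbb R}(\Omega)$ through $\mu$, that is, $\mu\circ G=g_0/\sqrt{g^s}$, with $G(z_0)=0$. For any such $G$ the set $\{q\in\Omega:\nu(G(q))=0\}$ has empty interior, does not meet $\mathbb S_{z_0}$, and $g_v$ vanishes on $\mathbb S_q$ for each $q$ in this set. Let $m\in\mathbb Z$ be even if $\sqrt{g^s}(\mathbb S_{z_0})\subset\mathbb H\setminus(-\infty,0)$ and odd if $\sqrt{g^s}(\mathbb S_{z_0})\subset(-\infty,0)$. Then there is a logarithm $\log_{*,0,0}((-1)^m\sqrt{g^s})\in\mathcal{SR}_{\mathbb R}(\Omega)$ of $(-1)^m\sqrt{g^s}$ on $\Omega$ whose value at $z_0$ is the principal logarithm of $(-1)^m\sqrt{g^s}(z_0)$. With any such logarithm and $\log_{*,m,0}:=\log_{*,0,0}+m\pi\mathcal I$, the function $g$ has a $*$-logarithm $f\in\mathcal{SR}_\omega(\Omega)$ on $\Omega$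 given by $$f=\log_{*,m,0}\bigl((-1)^m\sqrt{g^s}\bigr)+\frac{g_v}{\nu\bigl(\mu^{-1}(g_0/\sqrt{g^s})\bigr)\sqrt{g^s}}$$ at each point of $\Omega$ where $\nu(\mu^{-1}(g_0/\sqrt{g^s}))\ne0$ (the singularities of the right-hand side at the other points are removable). -/

import Mathlib

open scoped Quaternion

noncomputable section

namespace StarLog

/-! ### Quaternions, slices and axially symmetric domains -/

/-- The `2`-sphere of quaternionic imaginary units. -/
def imagUnits : Set ℍ[ℝ] := {q | q ^ 2 = -1}

/-- The point `x + I y` of `ℍ`, for `z = x + i y`; for an imaginary unit `I` this identifies `ℂ`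
with the slice `ℂ_I = ℝ + I ℝ`. -/
def slicePt (I : ℍ[ℝ]) (z : ℂ) : ℍ[ℝ] := (z.re : ℍ[ℝ]) + I * (z.im : ℍ[ℝ])

/-- The slice `Ω_I = Ω ∩ ℂ_I`, read as a subset of `ℂ`. -/
def sliceSet (Ω : Set ℍ[ℝ]) (I : ℍ[ℝ]) : Set ℂ := {z | slicePt I z ∈ Ω}

/-- The sphere `𝕊_q = x + y 𝕊` through `q = x + I y` (it is `{q}` if `q` is real). -/
def sphereOf (q : ℍ[ℝ]) : Set ℍ[ℝ] := {p | p.re = q.re ∧ ‖p.im‖ = ‖q.im‖}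

/-- The imaginary unit function `q = x + I y ↦ I` (`y > 0`); the value at real `q` is `0`. -/
def imagUnit (q : ℍ[ℝ]) : ℍ[ℝ] := ‖q.im‖⁻¹ • q.im

/-- `q` lies in `(-∞, 0) ⊆ ℝ ⊆ ℍ`. -/
def IsNegReal (q : ℍ[ℝ]) : Prop := ∃ t : ℝ, t < 0 ∧ q = (t : ℍ[ℝ])

/-- Axially symmetric subsets of `ℍ`. -/
def IsAxSymm (Ω : Set ℍ[ℝ]) : Prop :=
  ∀ I ∈ imagUnits, ∀ J ∈ imagUnits, ∀ z : ℂ, slicePt I z ∈ Ω → slicePt J z ∈ Ω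

/-- Axially symmetric domains (nonempty, open, connected). -/
structure IsAxSymmDomain (Ω : Set ℍ[ℝ]) : Prop where
  isOpen : IsOpen Ω
  isConnected : IsConnected Ω
  axSymm : IsAxSymm Ω

/-- Basic domains: axially symmetric domains such that each connected component of each slice
`Ω_I` is simply connected. -/
structure IsBasicDomain (Ω : Set ℍ[ℝ]) : Prop extends IsAxSymmDomain Ω where
  simplyConnected : ∀ I ∈ imagUnits, ∀ z ∈ sliceSet Ω I,
    IsSimplyConnected (connectedComponentIn (sliceSet Ω I) z)

/-- Basic product domains: basic domains that do not meet the real axis. -/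
structure IsBasicProductDomain (Ω : Set ℍ[ℝ]) : Prop extends IsBasicDomain Ω where
  no_real : ∀ x : ℝ, (x : ℍ[ℝ]) ∉ Ω

/-! ### Stem functions and slice regular functions

The complexification `ℍ ⊗ ℂ = ℍ + ι ℍ` is the ring `ℍ[ℂ]` of quaternions with complex
coefficients. Its central imaginary unit `ι` is the scalar `Complex.I`. -/

/-- The element `a + ι b` of `ℍ + ι ℍ`. -/
def toHC (a b : ℍ[ℝ]) : ℍ[ℂ] :=
  ⟨⟨a.re, b.re⟩, ⟨a.imI, b.imI⟩, ⟨a.imJ, b.imJ⟩, ⟨a.imK, b.imK⟩⟩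

/-- The part `a` of `a + ι b`. -/
def reHC (w : ℍ[ℂ]) : ℍ[ℝ] := ⟨w.re.re, w.imI.re, w.imJ.re, w.imK.re⟩

/-- The part `b` of `a + ι b`. -/
def imHC (w : ℍ[ℂ]) : ℍ[ℝ] := ⟨w.re.im, w.imI.im, w.imJ.im, w.imK.im⟩

/-- The involution `a + ι b ↦ a - ι b`. -/
def conjHC (w : ℍ[ℂ]) : ℍ[ℂ] := toHC (reHC w) (-imHC w)

/-- The map `φ_J : a + ι b ↦ a + J b`. -/
def phi (J : ℍ[ℝ]) (w : ℍ[ℂ]) : ℍ[ℝ] := reHC w + J * imHC w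

/-- `F` is a holomorphic map from `D ⊆ ℂ` to the complex vector space `ℍ + ι ℍ ≅ ℂ⁴`. -/
structure IsHolo (D : Set ℂ) (F : ℂ → ℍ[ℂ]) : Prop where
  re : DifferentiableOn ℂ (fun z => (F z).re) D
  imI : DifferentiableOn ℂ (fun z => (F z).imI) D
  imJ : DifferentiableOn ℂ (fun z => (F z).imJ) D
  imK : DifferentiableOn ℂ (fun z => (F z).imK) D

/-- `f` is the slice function on `Ω` induced by the stem function `F`. -/
def IsInducedBy (Ω : Set ℍ[ℝ]) (F : ℂ → ℍ[ℂ]) (f : ℍ[ℝ] → ℍ[ℝ]) : Prop :=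
  ∀ I ∈ imagUnits, ∀ z ∈ sliceSet Ω I,
    F (starRingEnd ℂ z) = conjHC (F z) ∧ f (slicePt I z) = phi I (F z)

/-- Slice regular functions on `Ω` (the values outside `Ω` are irrelevant):
slice functions induced by a holomorphic stem function. -/
def IsSliceRegular (Ω : Set ℍ[ℝ]) (f : ℍ[ℝ] → ℍ[ℝ]) : Prop :=
  ∃ F : ℂ → ℍ[ℂ], IsInducedBy Ω F f ∧ ∀ I ∈ imagUnits, IsHolo (sliceSet Ω I) F

/-- Slice preserving functions: `f` maps `Ω_I` into `ℂ_I`, for all `I`. -/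
def IsSlicePreserving (Ω : Set ℍ[ℝ]) (f : ℍ[ℝ] → ℍ[ℝ]) : Prop :=
  ∀ I ∈ imagUnits, ∀ z ∈ sliceSet Ω I, f (slicePt I z) ∈ Set.range (slicePt I)

/-- The class `SR_ℝ(Ω)` of slice regular and slice preserving functions. -/
def IsSRReal (Ω : Set ℍ[ℝ]) (f : ℍ[ℝ] → ℍ[ℝ]) : Prop :=
  IsSliceRegular Ω f ∧ IsSlicePreserving Ω f

/-- The slice function induced by a stem function `F`. -/
def induced (F : ℂ → ℍ[ℂ]) (q : ℍ[ℝ]) : ℍ[ℝ] := phi (imagUnit q) (F ⟨q.re, ‖q.im‖⟩)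

/-- The imaginary unit `i` of the standard basis of `ℍ`. -/
def unitI : ℍ[ℝ] := ⟨0, 1, 0, 0⟩

/-- The stem function of a slice function `f`, recovered from the values of `f` on `ℂ_i`;
`stem_eq` shows that it is the inducing stem function. -/
def stem (f : ℍ[ℝ] → ℍ[ℝ]) (z : ℂ) : ℍ[ℂ] :=
  toHC ((2 : ℝ)⁻¹ • (f (slicePt unitI z) + f (slicePt unitI (starRingEnd ℂ z))))
    ((2 : ℝ)⁻¹ • (-unitI * (f (slicePt unitI z) - f (slicePt unitI (starRingEnd ℂ z)))))

theorem unitI_mem : unitI ∈ imagUnits := by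
  have h0 : unitI.re = 0 := rfl
  have h1 : unitI.imI = 1 := rfl
  have h2 : unitI.imJ = 0 := rfl
  have h3 : unitI.imK = 0 := rfl
  change unitI ^ 2 = -1
  rw [pow_two]
  ext <;> simp [h0, h1, h2, h3]

theorem stem_eq {Ω : Set ℍ[ℝ]} (hΩ : IsAxSymm Ω) {F : ℂ → ℍ[ℂ]} {f : ℍ[ℝ] → ℍ[ℝ]}
    (h : IsInducedBy Ω F f) {I : ℍ[ℝ]} (hI : I ∈ imagUnits) {z : ℂ} (hz : z ∈ sliceSet Ω I) :
    stem f z = F z := by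
  have hz1 : z ∈ sliceSet Ω unitI := hΩ I hI unitI unitI_mem z hz
  have hneg : -unitI ∈ imagUnits := by
    change (-unitI) ^ 2 = -1
    rw [neg_sq]
    exact unitI_mem
  have hz2 : starRingEnd ℂ z ∈ sliceSet Ω unitI := by
    have h1 := hΩ I hI (-unitI) hneg z hz
    have h2 : slicePt (-unitI) z = slicePt unitI (starRingEnd ℂ z) := by
      simp [slicePt]
    change slicePt unitI (starRingEnd ℂ z) ∈ Ω
    rwa [← h2]
  have e1 := (h unitI unitI_mem z hz1).2
  have e2 := (h unitI unitI_mem _ hz2).2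
  rw [(h unitI unitI_mem z hz1).1] at e2
  have e3 : phi unitI (conjHC (F z)) = reHC (F z) - unitI * imHC (F z) := by
    have r1 : reHC (conjHC (F z)) = reHC (F z) := rfl
    have r2 : imHC (conjHC (F z)) = -imHC (F z) := rfl
    rw [phi, r1, r2, mul_neg, sub_eq_add_neg]
  have hI2 : unitI * unitI = -1 := by rw [← pow_two]; exact unitI_mem
  have s1 : (2 : ℝ)⁻¹ • (f (slicePt unitI z) + f (slicePt unitI (starRingEnd ℂ z)))
      = reHC (F z) := by
    rw [e1, e2, e3, phi]
    module
  have s2 : (2 : ℝ)⁻¹ • (-unitI * (f (slicePt unitI z) - f (slicePt unitI (starRingEnd ℂ z))))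
      = imHC (F z) := by
    have : -unitI * (f (slicePt unitI z) - f (slicePt unitI (starRingEnd ℂ z)))
        = (2 : ℝ) • imHC (F z) := by
      have h3 : f (slicePt unitI z) - f (slicePt unitI (starRingEnd ℂ z))
          = unitI * ((2 : ℝ) • imHC (F z)) := by
        rw [e1, e2, e3, phi, mul_smul_comm]
        module
      rw [h3, neg_mul, ← mul_assoc, hI2, neg_one_mul, neg_neg]
    rw [this, smul_smul]
    norm_num
  unfold stem
  rw [s1, s2]
  rfl

/-! ### Scalar and vectorial part, symmetrization, `*`-exponential -/

/-- For a slice function `f = f₀ + f₁ i + f₂ j + f₃ k` with slice preserving `f₀, f₁, f₂, f₃`,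
the component that is induced by the complex coordinate `c` of the stem function of `f`. -/
def component (c : ℍ[ℂ] → ℂ) (f : ℍ[ℝ] → ℍ[ℝ]) : ℍ[ℝ] → ℍ[ℝ] :=
  induced (fun z => ((c (stem f z) : ℂ) : ℍ[ℂ]))

/-- The scalar part `f₀`. -/
def scalarPart (f : ℍ[ℝ] → ℍ[ℝ]) : ℍ[ℝ] → ℍ[ℝ] := component (fun w => w.re) f

/-- The vectorial part `f_v = f - f₀`. -/
def vecPart (f : ℍ[ℝ] → ℍ[ℝ]) (q : ℍ[ℝ]) : ℍ[ℝ] := f q - scalarPart f q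

/-- The symmetrization `f^s = f₀² + f₁² + f₂² + f₃²`. -/
def symmetrization (f : ℍ[ℝ] → ℍ[ℝ]) (q : ℍ[ℝ]) : ℍ[ℝ] :=
  component (fun w => w.re) f q ^ 2 + component (fun w => w.imI) f q ^ 2
    + component (fun w => w.imJ) f q ^ 2 + component (fun w => w.imK) f q ^ 2

/-- The `n`-th power for the `*`-product. The `*`-product of slice functions is induced by the
pointwise product of their stem functions, so this is induced by the power of the stem function. -/
def starPow (f : ℍ[ℝ] → ℍ[ℝ]) (n : ℕ) : ℍ[ℝ] → ℍ[ℝ] := induced (fun z => stem f z ^ n)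

/-- `f` is a `*`-logarithm of `g` on `Ω`: `exp_* f = ∑ f^{*n} / n!` converges to `g` on `Ω`. -/
def IsStarLog (Ω : Set ℍ[ℝ]) (f g : ℍ[ℝ] → ℍ[ℝ]) : Prop :=
  ∀ q ∈ Ω, HasSum (fun n : ℕ => ((n.factorial : ℝ)⁻¹) • starPow f n q) (g q)

/-- The entire function `μ(q) = ∑ (-1)^m q^m / (2m)!`, so that `μ(q²) = cos q`. -/
def mu (q : ℍ[ℝ]) : ℍ[ℝ] := ∑' m : ℕ, ((-1 : ℝ) ^ m / ((2 * m).factorial : ℝ)) • q ^ m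

/-- The entire function `ν(q) = ∑ (-1)^m q^m / (2m+1)!`, so that `ν(q²) = sin q / q`. -/
def nu (q : ℍ[ℝ]) : ℍ[ℝ] := ∑' m : ℕ, ((-1 : ℝ) ^ m / ((2 * m + 1).factorial : ℝ)) • q ^ m

/-- The principal logarithm `log₀ q = log |q| + I arg q` of `q ∈ ℍ \ (-∞, 0]`, where
`q = |q| (cos (arg q) + I sin (arg q))` with an imaginary unit `I` and `arg q ∈ [0, π)`. -/
def qlog (q : ℍ[ℝ]) : ℍ[ℝ] :=
  ((Real.log ‖q‖ : ℝ) : ℍ[ℝ]) + Real.arccos (q.re / ‖q‖) • imagUnit q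

/-! ### Vectorial classes -/

/-- A function together with a set on which it is considered. -/
structure LocalFun where
  dom : Set ℍ[ℝ]
  toFun : ℍ[ℝ] → ℍ[ℝ]

/-- Vectorial functions: slice regular functions `f` with `f = f_v`. -/
def IsVectorial (U : Set ℍ[ℝ]) (f : ℍ[ℝ] → ℍ[ℝ]) : Prop :=
  IsSliceRegular U f ∧ ∀ q ∈ U, f q = vecPart f q

/-- `u` is a vectorial function on an axially symmetric domain that contains `p`. -/
structure IsLocalVec (p : ℍ[ℝ]) (u : LocalFun) : Prop where
  domain : IsAxSymmDomain u.dom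
  mem : p ∈ u.dom
  vectorial : IsVectorial u.dom u.toFun

/-- Linear dependence over `SR_ℝ(V)` of functions on an axially symmetric domain `V`. -/
def LinDep (V : Set ℍ[ℝ]) (f g : ℍ[ℝ] → ℍ[ℝ]) : Prop :=
  ∃ a b : ℍ[ℝ] → ℍ[ℝ], IsSRReal V a ∧ IsSRReal V b ∧
    ((∃ q ∈ V, a q ≠ 0) ∨ (∃ q ∈ V, b q ≠ 0)) ∧ ∀ q ∈ V, a q * f q + b q * g q = 0

/-- Equivalence at `p`: linear dependence over `SR_ℝ(V)` for some axially symmetric domain `V`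
that contains `p`. As the zero function is linearly dependent on every function, the relation is
transitive only with the convention, made here, that zero is equivalent to zero only. -/
def EquivAt (p : ℍ[ℝ]) (u v : LocalFun) : Prop :=
  ∃ V : Set ℍ[ℝ], IsAxSymmDomain V ∧ p ∈ V ∧ V ⊆ u.dom ∩ v.dom ∧
    LinDep V u.toFun v.toFun ∧ ((∀ q ∈ V, u.toFun q = 0) ↔ (∀ q ∈ V, v.toFun q = 0))

/-- A vectorial class on `Ω`: at each `p ∈ Ω` an equivalence class of local vectorial functions
at `p`, given as the set of its representatives, such that these classes are compatible. -/
structure VectorialClass (Ω : Set ℍ[ℝ]) where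
  cls : ℍ[ℝ] → Set LocalFun
  isClass : ∀ p ∈ Ω, ∃ u, IsLocalVec p u ∧ cls p = {v | IsLocalVec p v ∧ EquivAt p u v}
  compat : ∀ p ∈ Ω, ∀ q ∈ Ω, ∀ u ∈ cls p, ∀ v ∈ cls q, u.dom ⊆ Ω → v.dom ⊆ Ω →
    ∀ r ∈ u.dom ∩ v.dom, EquivAt r u v

/-- The set `SR_ω(Ω)`: `g ∈ SR_ω(Ω)` if `g` is slice regular on
`Ω` and the germ of `g_v` at each `p ∈ Ω` is zero or belongs to `ω(p)`. In particular
`SR_ℝ(Ω) ⊆ SR_ω(Ω)` for every `ω`, and `SR_[0](Ω) = SR_ℝ(Ω)`. -/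
def VectorialClass.IsSR {Ω : Set ℍ[ℝ]} (ω : VectorialClass Ω) (g : ℍ[ℝ] → ℍ[ℝ]) : Prop :=
  IsSliceRegular Ω g ∧
    ∀ p ∈ Ω, (∀ᶠ q in nhds p, vecPart g q = 0) ∨ (⟨Ω, vecPart g⟩ : LocalFun) ∈ ω.cls p

/-- `u` is a minimal representative of `ω` on the axially symmetric domain `u.dom ⊆ Ω`: it
represents `ω` at each point, and has neither real nor spherical zeroes. -/
structure VectorialClass.IsMinimal {Ω : Set ℍ[ℝ]} (ω : VectorialClass Ω) (u : LocalFun) :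
    Prop where
  domain : IsAxSymmDomain u.dom
  subset : u.dom ⊆ Ω
  mem_cls : ∀ p ∈ u.dom, u ∈ ω.cls p
  no_sphere : ∀ p ∈ u.dom, ∃ q ∈ sphereOf p, u.toFun q ≠ 0

/-- The zero set `Z(ω)`: the union of the zero sets of all minimal representatives of `ω` on
axially symmetric subdomains of `Ω`. It is empty for `ω = [0]`, which has no such representative. -/
def VectorialClass.zeroSet {Ω : Set ℍ[ℝ]} (ω : VectorialClass Ω) : Set ℍ[ℝ] :=
  {q | ∃ u : LocalFun, ω.IsMinimal u ∧ q ∈ u.dom ∧ u.toFun q = 0}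

/-! ### The ingredients of the formula -/

/-- `s` is a square root `√(g^s)` on `Ω` with `√(g^s)(z₀) = g₀(z₀)`. -/
structure IsSqrtSymm (Ω : Set ℍ[ℝ]) (g : ℍ[ℝ] → ℍ[ℝ]) (z₀ : ℍ[ℝ]) (s : ℍ[ℝ] → ℍ[ℝ]) : Prop where
  srReal : IsSRReal Ω s
  sq_eq : ∀ q ∈ Ω, s q ^ 2 = symmetrization g q
  value : s z₀ = scalarPart g z₀

/-- `G` is the lift of `h` through `μ` that vanishes at `z₀`, denoted by `μ⁻¹(h)`. -/
structure IsMuLift (Ω : Set ℍ[ℝ]) (h : ℍ[ℝ] → ℍ[ℝ]) (z₀ : ℍ[ℝ]) (G : ℍ[ℝ] → ℍ[ℝ]) : Prop where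
  srReal : IsSRReal Ω G
  mu_eq : ∀ q ∈ Ω, mu (G q) = h q
  value : G z₀ = 0

/-- `L` is the logarithm `log_{*,0,0} h` of the slice preserving function `h` on `Ω`, normalized
by the condition that it is the principal logarithm of `h` at `z₀`. -/
structure IsLogZero (Ω : Set ℍ[ℝ]) (h : ℍ[ℝ] → ℍ[ℝ]) (z₀ : ℍ[ℝ]) (L : ℍ[ℝ] → ℍ[ℝ]) : Prop where
  srReal : IsSRReal Ω L
  isLog : IsStarLog Ω L h
  value : L z₀ = qlog (h z₀)

end StarLog

end

open scoped Quaternion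

noncomputable section

namespace StarLog

open Filter Topology Set Metric

/-! ### Holomorphic functions on simply connected domains -/

section Holomorphic

/-! Since `Ω` misses the real axis, a slice regular function on it is the same as a holomorphic map
from the simply connected set `D = up Ω` in the upper half plane to `ℍ[ℂ]`, and slice preserving
functions correspond to scalar maps. Everything becomes complex analysis on `D`. Let `g₀ + V` be the
stem of `g`, let `cnorm` be the quadratic form that induces the symmetrization, and let `w = coord
z₀`.

For a scalar `α` and a vector `W` one has exp(α + W) = e^α (μ(N) + ν(N) W) with N = `cnorm W`
(`hasSum_phi_pow`). A logarithm of `g` therefore arises from σ² = `cnorm (g₀ + V)`, e^α = σ, μ(γ) =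
g₀/σ and W = V/(ν(γ)σ). The required identity `cnorm W = γ` follows from μ(c)² + c ν(c)² = 1
(`muC_sq_add`). What remains is the existence of σ, γ and W.

The root σ exists because the symmetrization has no zeros. The map μ is doubly ramified at each
preimage of ±1 except at 0, where it is unramified. So g₀/σ lifts with γ(w) = 0 as soon as 1 -
(g₀/σ)² = `cnorm V`/σ² is locally a square at all points other than w
(`exists_muC_lift_of_locally_sq`). The assumption on the zeros of the class gives exactly this. Near
p one has V = (z - p)^n v, where v is a minimal representative, so `cnorm (v p) ≠ 0` unless p = w
(`exists_local_minimal`). At w itself `cnorm V` vanishes (`cnorm_im_stem_eq_zero`), which permits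
the normalization σ(w) = g₀(w).

Finally, ν(γ) = 0 forces γ ≠ 0, since ν(0) = 1, so the point is not w. There the same factorization
of V shows that V is divisible by ν(γ)σ (`exists_vector_quotient`): the singularities of W are
removable. -/

theorem isSimplyConnected_ball (c : ℂ) {r : ℝ} (hr : 0 < r) : IsSimplyConnected (ball c r) := by
  have := (convex_ball c r).contractibleSpace (nonempty_ball.2 hr)
  exact (inferInstance : SimplyConnectedSpace (ball c r))

theorem eqOn_zero_or_of_mul_eq_zero {D : Set ℂ} (hD : IsOpen D) (hc : IsPreconnected D)
    {a b : ℂ → ℂ} (ha : DifferentiableOn ℂ a D) (hb : DifferentiableOn ℂ b D)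
    (h : ∀ z ∈ D, a z * b z = 0) : (∀ z ∈ D, a z = 0) ∨ ∀ z ∈ D, b z = 0 :=
  (ha.analyticOnNhd hD).eq_zero_or_eq_zero_of_mul_eq_zero (hb.analyticOnNhd hD) h hc

theorem eqOn_zero_of_eventually {D : Set ℂ} (hD : IsOpen D) (hc : IsPreconnected D)
    {a : ℂ → ℂ} (ha : DifferentiableOn ℂ a D) {z : ℂ} (hz : z ∈ D) (h : ∀ᶠ x in 𝓝 z, a x = 0) :
    ∀ x ∈ D, a x = 0 :=
  (ha.analyticOnNhd hD).eqOn_zero_of_preconnected_of_eventuallyEq_zero hc hz h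

theorem eventually_ne_zero {D : Set ℂ} (hD : IsOpen D) (hc : IsPreconnected D)
    {a : ℂ → ℂ} (ha : DifferentiableOn ℂ a D) (h0 : ∃ z ∈ D, a z ≠ 0) {z : ℂ} (hz : z ∈ D) :
    ∀ᶠ x in 𝓝[≠] z, a x ≠ 0 := by
  rcases ((ha.analyticOnNhd hD) z hz).eventually_eq_zero_or_eventually_ne_zero with h | h
  · obtain ⟨y, hy, hy0⟩ := h0
    exact absurd (eqOn_zero_of_eventually hD hc ha hz h y hy) hy0
  · exact h

theorem differentiableOn_of_local {D : Set ℂ} {f : ℂ → ℂ}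
    (h : ∀ z ∈ D, ∃ c : ℂ → ℂ, AnalyticAt ℂ c z ∧ ∀ᶠ x in 𝓝 z, f x = c x) :
    DifferentiableOn ℂ f D := fun z hz => by
  obtain ⟨c, hc, hfc⟩ := h z hz
  exact (hc.differentiableAt.congr_of_eventuallyEq hfc).differentiableWithinAt

/-- Analytic divisibility is a local property. -/
theorem exists_quotient {D : Set ℂ} (hD : IsOpen D) (hc : IsPreconnected D)
    {a b : ℂ → ℂ} (ha : DifferentiableOn ℂ a D) (h0 : ∃ z ∈ D, a z ≠ 0)
    (h : ∀ z ∈ D, ∃ c : ℂ → ℂ, AnalyticAt ℂ c z ∧ ∀ᶠ x in 𝓝 z, b x = a x * c x) :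
    ∃ c : ℂ → ℂ, DifferentiableOn ℂ c D ∧ ∀ z ∈ D, b z = a z * c z := by
  classical
  choose! c hca hcb using h
  refine ⟨fun z => c z z, differentiableOn_of_local fun z hz => ⟨c z, hca z hz, ?_⟩,
    fun z hz => (hcb z hz).self_of_nhds⟩
  filter_upwards [hD.mem_nhds hz, (hcb z hz).eventually_nhds, (hca z hz).eventually_analyticAt]
    with x hx hbx hax
  -- Zeros of `a` are isolated, so the two local quotients agree on a punctured neighbourhood of
  -- `x`, hence at `x` by continuity.
  have e1 : ∀ᶠ y in 𝓝[≠] x, c x y = c z y := by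
    filter_upwards [eventually_ne_zero hD hc ha h0 hx, nhdsWithin_le_nhds (hcb x hx),
      nhdsWithin_le_nhds hbx] with y h1 h2 h3
    exact mul_left_cancel₀ h1 (h2.symm.trans h3)
  exact ((hca x hx).continuousAt.eventuallyEq_nhds_iff_eventuallyEq_nhdsNE
    hax.continuousAt).1 e1 |>.self_of_nhds

/-- A continuous logarithm comes from lifting through `exp`. It is holomorphic because near each
point it differs by a constant from a principal logarithm; a shift by a constant gives the
prescribed value `c` at `w`. -/
theorem exists_log {D : Set ℂ} (hD : IsOpen D) (hs : IsSimplyConnected D) {f : ℂ → ℂ}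
    (hf : DifferentiableOn ℂ f D) (h0 : ∀ z ∈ D, f z ≠ 0) {w c : ℂ} (hw : w ∈ D)
    (hc : Complex.exp c = f w) :
    ∃ l : ℂ → ℂ, DifferentiableOn ℂ l D ∧ (∀ z ∈ D, Complex.exp (l z) = f z) ∧ l w = c := by
  obtain ⟨l, hl, hlf⟩ := Complex.exists_continuousOn_eqOn_exp_comp hs hD hf.continuousOn
    (by rintro ⟨z, hz, hz0⟩; exact h0 z hz hz0)
  have hd : DifferentiableOn ℂ l D := by
    intro z hz
    have e0 : f z = Complex.exp (l z) := (hlf hz).symm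
    have e1 : ∀ᶠ x in 𝓝 z, l x = Complex.log (f x / f z) + l z := by
      have h1 : ContinuousAt (fun x => (l x - l z).im) z :=
        Complex.continuous_im.continuousAt.comp
          ((hl.continuousAt (hD.mem_nhds hz)).sub continuousAt_const)
      have h2 : ∀ᶠ x in 𝓝 z, (l x - l z).im ∈ Ioo (-Real.pi) Real.pi :=
        h1.eventually_mem (Ioo_mem_nhds (by simp [Real.pi_pos]) (by simp [Real.pi_pos]))
      filter_upwards [h2, hD.mem_nhds hz] with x hx hxD
      have : f x = Complex.exp (l x) := (hlf hxD).symm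
      rw [this, e0, ← Complex.exp_sub, Complex.log_exp hx.1 hx.2.le]
      ring
    have h3 : DifferentiableAt ℂ (fun x => Complex.log (f x / f z) + l z) z := by
      have h4 : DifferentiableAt ℂ f z := (hf z hz).differentiableAt (hD.mem_nhds hz)
      refine DifferentiableAt.add_const _ (DifferentiableAt.clog (h4.div_const _) ?_)
      rw [div_self (h0 z hz)]
      exact Complex.one_mem_slitPlane
    exact (h3.congr_of_eventuallyEq e1).differentiableWithinAt
  refine ⟨fun z => l z + (c - l w), hd.add_const _, fun z hz => ?_, by ring⟩
  have : Complex.exp (l w) = f w := hlf hw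
  rw [Complex.exp_add, Complex.exp_sub, hc, this, div_self (h0 w hw), mul_one]
  exact hlf hz

/-- An analytic function that does not vanish at a point has an analytic square root there. -/
theorem exists_local_sqrt {f : ℂ → ℂ} {z : ℂ} (hf : AnalyticAt ℂ f z) (h0 : f z ≠ 0) :
    ∃ r : ℂ → ℂ, AnalyticAt ℂ r z ∧ (∀ᶠ x in 𝓝 z, r x ^ 2 = f x) ∧ r z ≠ 0 := by
  obtain ⟨ε, hε, hb⟩ := Metric.eventually_nhds_iff_ball.1
    (hf.eventually_analyticAt.and (hf.continuousAt.eventually_ne h0))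
  obtain ⟨l, hl, hlf, -⟩ := exists_log isOpen_ball (isSimplyConnected_ball z hε)
    (fun x hx => (hb x hx).1.differentiableAt.differentiableWithinAt) (fun x hx => (hb x hx).2)
    (mem_ball_self hε) (Complex.exp_log h0)
  refine ⟨fun x => Complex.exp (l x / 2), ?_, ?_, Complex.exp_ne_zero _⟩
  · exact ((hl.div_const 2).cexp.analyticOnNhd isOpen_ball) z (mem_ball_self hε)
  · filter_upwards [ball_mem_nhds z hε] with x hx
    rw [← hlf x hx, ← Complex.exp_nat_mul]
    congr 1
    push_cast
    ring

end Holomorphic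

/-! ### Global holomorphic square roots, with zeros allowed -/

section SquareRoot

/-- Holomorphic functions on a connected open set form an integral domain, and (a - b)(a + b) = 0.
-/
theorem eq_or_eq_neg_of_sq_eq {D : Set ℂ} (hD : IsOpen D) (hc : IsPreconnected D) {a b : ℂ → ℂ}
    (ha : DifferentiableOn ℂ a D) (hb : DifferentiableOn ℂ b D)
    (h : ∀ z ∈ D, a z ^ 2 = b z ^ 2) : (∀ z ∈ D, a z = b z) ∨ ∀ z ∈ D, a z = -b z := by
  rcases eqOn_zero_or_of_mul_eq_zero hD hc (ha.sub hb) (ha.add hb)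
    (fun z hz => by simp only [Pi.sub_apply, Pi.add_apply]; linear_combination h z hz) with h | h
  · exact Or.inl fun z hz => sub_eq_zero.1 (h z hz)
  · exact Or.inr fun z hz => eq_neg_of_add_eq_zero_left (h z hz)

/-- Local square roots `κ i` on balls `B i` that cover `D`. -/
structure SqrtData (D : Set ℂ) (f : ℂ → ℂ) where
  r : D → ℝ
  κ : D → ℂ → ℂ
  pos : ∀ i, 0 < r i
  diff : ∀ i : D, DifferentiableOn ℂ (κ i) (ball i (r i))
  sq : ∀ i : D, ∀ x ∈ ball (i : ℂ) (r i), κ i x ^ 2 = f x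

namespace SqrtData

variable {D : Set ℂ} {f : ℂ → ℂ} (S : SqrtData D f)

def B (i : D) : Set ℂ := ball i (S.r i)

open scoped Classical in
/-- The sign by which two local square roots differ. -/
def sgn (i j : D) : ℤˣ := if ∀ x ∈ S.B i ∩ S.B j, S.κ j x = S.κ i x then 1 else -1

theorem sgn_spec (i j : D) {x : ℂ} (hx : x ∈ S.B i ∩ S.B j) :
    S.κ j x = ((S.sgn i j : ℤ) : ℂ) * S.κ i x := by
  unfold sgn
  split_ifs with h
  · simpa using h x hx
  · have hcv : Convex ℝ (S.B i ∩ S.B j) := (convex_ball _ _).inter (convex_ball _ _)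
    rcases eq_or_eq_neg_of_sq_eq (isOpen_ball.inter isOpen_ball) hcv.isPreconnected
      ((S.diff j).mono inter_subset_right) ((S.diff i).mono inter_subset_left)
      (fun z hz => (S.sq j z hz.2).trans (S.sq i z hz.1).symm) with h' | h'
    · exact absurd h' h
    · simpa using h' x hx

/-- The cocycle relation of the double covering. As `f` may vanish at `x`, the signs are compared at
a nearby point `y` with `f y ≠ 0`. -/
theorem sgn_comp (hD : IsOpen D) (hf : ∀ U : Set ℂ, IsOpen U → U ⊆ D → U.Nonempty → ∃ y ∈ U, f y ≠ 0)
    (i j k : D) {x : ℂ} (hxD : x ∈ D) (hx : x ∈ S.B i ∩ S.B j ∩ S.B k) :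
    S.sgn j k * S.sgn i j = S.sgn i k := by
  obtain ⟨y, ⟨⟨⟨hi, hj⟩, hk⟩, -⟩, hy⟩ := hf (S.B i ∩ S.B j ∩ S.B k ∩ D)
    (((isOpen_ball.inter isOpen_ball).inter isOpen_ball).inter hD) inter_subset_right ⟨x, hx, hxD⟩
  have h0 : S.κ i y ≠ 0 := fun h => hy (by rw [← S.sq i y hi, h]; simp)
  have h1 := S.sgn_spec i k ⟨hi, hk⟩
  rw [S.sgn_spec j k ⟨hj, hk⟩, S.sgn_spec i j ⟨hi, hj⟩, ← mul_assoc] at h1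
  have h2 := mul_right_cancel₀ h0 h1
  apply Units.ext
  push_cast
  exact_mod_cast h2

/-- The double covering of `D` by the local square roots. -/
def core (hD : IsOpen D)
    (hf : ∀ U : Set ℂ, IsOpen U → U ⊆ D → U.Nonempty → ∃ y ∈ U, f y ≠ 0) :
    FiberBundleCore D D ℤˣ where
  baseSet i := {x | (x : ℂ) ∈ S.B i}
  isOpen_baseSet i := isOpen_ball.preimage continuous_subtype_val
  indexAt x := x
  mem_baseSet_at x := mem_ball_self (S.pos x)
  coordChange i j _ v := S.sgn i j * v
  coordChange_self i x _ v := by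
    have : S.sgn i i = 1 := if_pos fun _ _ => rfl
    rw [this, one_mul]
  continuousOn_coordChange i j := (continuous_const.mul continuous_snd).continuousOn
  coordChange_comp i j k x hx v := by
    rw [← mul_assoc, S.sgn_comp hD hf i j k x.2 hx]

end SqrtData

/-- On a simply connected domain, a holomorphic function which locally has a holomorphic square
root has one globally. -/
theorem exists_sqrt {D : Set ℂ} (hD : IsOpen D) (hs : IsSimplyConnected D) {f : ℂ → ℂ}
    (hf : DifferentiableOn ℂ f D)
    (h : ∀ z ∈ D, ∃ r : ℂ → ℂ, AnalyticAt ℂ r z ∧ ∀ᶠ x in 𝓝 z, r x ^ 2 = f x) :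
    ∃ r : ℂ → ℂ, DifferentiableOn ℂ r D ∧ ∀ z ∈ D, r z ^ 2 = f z := by
  classical
  have hc : IsPreconnected D := hs.isPathConnected.isConnected.isPreconnected
  by_cases h0 : ∃ z ∈ D, f z ≠ 0
  swap
  · push Not at h0
    exact ⟨0, differentiableOn_const 0, fun z hz => by simp [h0 z hz]⟩
  have hf0 : ∀ U : Set ℂ, IsOpen U → U ⊆ D → U.Nonempty → ∃ y ∈ U, f y ≠ 0 := by
    rintro U hU hUD ⟨x, hx⟩
    by_contra hcon
    push Not at hcon
    obtain ⟨z, hz, hz0⟩ := h0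
    exact hz0 (eqOn_zero_of_eventually hD hc hf (hUD hx)
      (Filter.mem_of_superset (hU.mem_nhds hx) hcon) z hz)
  have hloc : ∀ i : D, ∃ ρ : ℝ, ∃ k : ℂ → ℂ, 0 < ρ ∧ DifferentiableOn ℂ k (ball (i : ℂ) ρ) ∧
      ∀ x ∈ ball (i : ℂ) ρ, k x ^ 2 = f x := by
    intro i
    obtain ⟨k, hk, hkf⟩ := h i i.2
    obtain ⟨ρ, hρ, hb⟩ := Metric.eventually_nhds_iff_ball.1 (hk.eventually_analyticAt.and hkf)
    exact ⟨ρ, k, hρ, fun x hx => (hb x hx).1.differentiableAt.differentiableWithinAt,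
      fun x hx => (hb x hx).2⟩
  choose ρ k hρ hk hkf using hloc
  let S : SqrtData D f := ⟨ρ, k, hρ, hk, hkf⟩
  let Z := S.core hD hf0
  have := hs.simplyConnectedSpace
  have := hD.locallyPathConnectedSpace
  obtain ⟨z₀⟩ : Nonempty D := hs.nonempty.to_subtype
  -- Lifting the identity of the simply connected `D` gives a section of the covering, that is, a
  -- coherent choice of signs.
  obtain ⟨s, ⟨-, hsp⟩, -⟩ := (FiberBundle.isCoveringMap (F := ℤˣ)
    (E := Z.Fiber)).existsUnique_continuousMap_lifts (ContinuousMap.id D) z₀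
      (⟨z₀, (1 : ℤˣ)⟩ : Z.TotalSpace) rfl
  have hp : ∀ x, (s x).proj = x := fun x => congrFun hsp x
  let v : D → ℤˣ := fun x => (s x).snd
  let u : D → D → ℤˣ := fun i x => (Z.localTriv i (s x)).2
  have hu : ∀ i x, u i x = S.sgn x i * v x := by
    intro i x
    change S.sgn (s x).proj i * v x = _
    rw [hp x]
  -- Read in a fixed trivialization, the section is continuous with values in a discrete group, so
  -- it is locally constant. The glued root is then locally a constant sign times one `k i`.
  have huc : ∀ i x : D, (x : ℂ) ∈ S.B i → ContinuousAt (u i) x := by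
    intro i x hx
    have h1 : ContinuousAt (Z.localTriv i) (s x) :=
      (Z.localTriv i).continuousAt (by
        rw [FiberBundleCore.mem_localTriv_source, hp x]
        exact hx)
    exact continuousAt_snd.comp (h1.comp s.continuous.continuousAt)
  refine ⟨fun x => if hx : x ∈ D then ((v ⟨x, hx⟩ : ℤ) : ℂ) * k ⟨x, hx⟩ x else 0,
    differentiableOn_of_local fun z hz => ?_, fun z hz => ?_⟩
  · refine ⟨fun x => ((u ⟨z, hz⟩ ⟨z, hz⟩ : ℤ) : ℂ) * k ⟨z, hz⟩ x,
      analyticAt_const.mul ((hk ⟨z, hz⟩).analyticOnNhd isOpen_ball z (mem_ball_self (hρ _))), ?_⟩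
    have h1 : ∀ᶠ y in 𝓝 (⟨z, hz⟩ : D), u ⟨z, hz⟩ y = u ⟨z, hz⟩ ⟨z, hz⟩ :=
      (huc ⟨z, hz⟩ ⟨z, hz⟩ (mem_ball_self (hρ _))).eventually_mem
        ((isOpen_discrete {u ⟨z, hz⟩ ⟨z, hz⟩}).mem_nhds rfl)
    rw [nhds_subtype_eq_comap, Filter.eventually_comap] at h1
    filter_upwards [h1, hD.mem_nhds hz, ball_mem_nhds z (hρ ⟨z, hz⟩)] with x hx hxD hxB
    have e1 := hx ⟨x, hxD⟩ rfl
    rw [dif_pos hxD, ← e1, hu]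
    have e2 := S.sgn_spec ⟨x, hxD⟩ ⟨z, hz⟩ (x := x) ⟨mem_ball_self (hρ _), hxB⟩
    change k ⟨z, hz⟩ x = _ * k ⟨x, hxD⟩ x at e2
    rw [e2]
    have e3 : ((S.sgn ⟨x, hxD⟩ ⟨z, hz⟩ : ℤ) : ℂ) * ((S.sgn ⟨x, hxD⟩ ⟨z, hz⟩ : ℤ) : ℂ) = 1 := by
      rw [← Int.cast_mul, ← Units.val_mul, Int.units_mul_self]
      simp
    push_cast
    linear_combination (-(v ⟨x, hxD⟩ : ℤ) * k ⟨x, hxD⟩ x : ℂ) * e3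
  · simp only [dif_pos hz]
    have e3 : ((v ⟨z, hz⟩ : ℤ) : ℂ) ^ 2 = 1 := by
      rw [sq, ← Int.cast_mul, ← Units.val_mul, Int.units_mul_self]
      simp
    rw [mul_pow, e3, one_mul]
    exact hkf ⟨z, hz⟩ z (mem_ball_self (hρ _))

end SquareRoot

/-! ### Logarithms from iterated square roots, without simple connectedness -/

section RootTower

/-- The n-th equation puts `a - b` into `2 ^ n * 2πi ℤ`, whose nonzero elements exceed `‖a - b‖` for
large `n`. A value of the logarithm is thus determined by the whole tower of roots. -/
theorem eq_of_exp_div_two_pow {a b : ℂ}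
    (h : ∀ n : ℕ, Complex.exp (a / 2 ^ n) = Complex.exp (b / 2 ^ n)) : a = b := by
  obtain ⟨n, hn⟩ := pow_unbounded_of_one_lt (‖a - b‖) (one_lt_two)
  obtain ⟨m, hm⟩ := Complex.exp_eq_exp_iff_exists_int.1 (h n)
  have h2 : (2 : ℂ) ^ n ≠ 0 := pow_ne_zero _ two_ne_zero
  have e1 : a - b = 2 ^ n * (m * (2 * Real.pi * Complex.I)) := by
    field_simp at hm
    linear_combination hm
  have e2 : ‖a - b‖ = 2 ^ n * (|(m : ℝ)| * (2 * Real.pi)) := by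
    rw [e1]
    simp [abs_of_pos Real.pi_pos]
  by_cases hm0 : m = 0
  · rw [hm0] at e1
    simpa [sub_eq_zero] using e1
  · exfalso
    have h3 : (1 : ℝ) ≤ |(m : ℝ)| := by exact_mod_cast Int.one_le_abs hm0
    have h4 : (1 : ℝ) ≤ |(m : ℝ)| * (2 * Real.pi) := by nlinarith [Real.pi_gt_three]
    have h5 : (2 : ℝ) ^ n * 1 ≤ 2 ^ n * (|(m : ℝ)| * (2 * Real.pi)) := by gcongr
    linarith

/-- If `F₀` has a tower of iterated square roots on a connected open set, then it has a
logarithm there. -/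
theorem exists_log_of_root_tower {X : Set ℂ} (hX : IsOpen X) (hc : IsPreconnected X)
    {F : ℕ → ℂ → ℂ} (hF : ∀ n, DifferentiableOn ℂ (F n) X) (h0 : ∀ x ∈ X, F 0 x ≠ 0)
    (hsq : ∀ n, ∀ x ∈ X, F (n + 1) x ^ 2 = F n x) {x₀ : ℂ} (hx₀ : x₀ ∈ X) (h1 : ∀ n, F n x₀ = 1) :
    ∃ φ : ℂ → ℂ, DifferentiableOn ℂ φ X ∧
      (∀ x ∈ X, ∀ n : ℕ, Complex.exp (φ x / 2 ^ n) = F n x) ∧ φ x₀ = 0 := by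
  classical
  -- `P x c` says that `c` is compatible with every level of the tower. Such a `c` is unique, so
  -- there is no monodromy and local solutions glue.
  set P : ℂ → ℂ → Prop := fun x c => ∀ n : ℕ, Complex.exp (c / 2 ^ n) = F n x with hP
  have uniq : ∀ x c c', P x c → P x c' → c = c' := fun x c c' h h' =>
    eq_of_exp_div_two_pow fun n => (h n).trans (h' n).symm
  have ext : ∀ (x : ℂ) (ε : ℝ), ball x ε ⊆ X → ∀ y ∈ ball x ε, ∀ c, P y c →
      ∃ l : ℂ → ℂ, DifferentiableOn ℂ l (ball x ε) ∧ ∀ z ∈ ball x ε, P z (l z) := by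
    intro x ε hb y hy c hyc
    have hε : 0 < ε := pos_of_mem_ball hy
    obtain ⟨l, hl, hlF, hly⟩ := exists_log isOpen_ball (isSimplyConnected_ball x hε)
      ((hF 0).mono hb) (fun z hz => h0 z (hb hz)) hy (c := c) (by simpa using hyc 0)
    refine ⟨l, hl, fun z hz n => ?_⟩
    induction n generalizing z with
    | zero => simpa using hlF z hz
    | succ n ih =>
      have hd : DifferentiableOn ℂ (fun z => Complex.exp (l z / 2 ^ (n + 1))) (ball x ε) :=
        (hl.div_const _).cexp
      have hs : ∀ z ∈ ball x ε, Complex.exp (l z / 2 ^ (n + 1)) ^ 2 = F (n + 1) z ^ 2 := by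
        intro z hz
        rw [hsq n z (hb hz), ← ih z hz, ← Complex.exp_nat_mul]
        congr 1
        field_simp
        push_cast
        ring
      -- Both functions are square roots of `F n`, so they agree up to one sign on the ball;
      -- compatibility at `y` excludes the minus sign.
      rcases eq_or_eq_neg_of_sq_eq isOpen_ball (convex_ball x ε).isPreconnected hd
        ((hF (n + 1)).mono hb) hs with h | h
      · exact h z hz
      · exfalso
        have e1 := h y hy
        have e2 := hyc (n + 1)
        rw [hly, e2] at e1
        have e3 : F (n + 1) y = 0 := by linear_combination e1 / 2
        exact Complex.exp_ne_zero _ (e2.trans e3)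
  have hopen : IsOpen {x | x ∈ X ∧ ∃ c, P x c} := by
    refine isOpen_iff_mem_nhds.2 fun x hx => ?_
    obtain ⟨ε, hε, hb⟩ := Metric.isOpen_iff.1 hX x hx.1
    obtain ⟨c, hxc⟩ := hx.2
    obtain ⟨l, -, hl⟩ := ext x ε hb x (mem_ball_self hε) c hxc
    filter_upwards [ball_mem_nhds x hε] with z hz
    exact ⟨hb hz, l z, hl z hz⟩
  have hopen' : IsOpen {x | x ∈ X ∧ ¬∃ c, P x c} := by
    refine isOpen_iff_mem_nhds.2 fun x hx => ?_
    obtain ⟨ε, hε, hb⟩ := Metric.isOpen_iff.1 hX x hx.1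
    filter_upwards [ball_mem_nhds x hε] with z hz
    refine ⟨hb hz, ?_⟩
    rintro ⟨c, hzc⟩
    obtain ⟨l, -, hl⟩ := ext x ε hb z hz c hzc
    exact hx.2 ⟨l x, hl x (mem_ball_self hε)⟩
  -- The points with a compatible value and those without one both form open sets, and `x₀` belongs
  -- to the first with `c = 0`.
  have hall : ∀ x ∈ X, ∃ c, P x c := by
    by_contra hcon
    push Not at hcon
    obtain ⟨y, hy, hyc⟩ := hcon
    obtain ⟨x, -, h, h'⟩ := hc _ _ hopen hopen'
      (fun x hx => (em (∃ c, P x c)).imp (fun h => ⟨hx, h⟩) (fun h => ⟨hx, h⟩))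
      ⟨x₀, hx₀, hx₀, 0, fun n => by simp [h1 n]⟩ ⟨y, hy, hy, fun ⟨c, hc⟩ => hyc c hc⟩
    exact h'.2 h.2
  choose! φ hφ using hall
  refine ⟨φ, fun x hx => ?_, fun x hx => hφ x hx, uniq x₀ _ _ (hφ x₀ hx₀) fun n => by simp [h1 n]⟩
  obtain ⟨ε, hε, hb⟩ := Metric.isOpen_iff.1 hX x hx
  obtain ⟨l, hl, hlP⟩ := ext x ε hb x (mem_ball_self hε) _ (hφ x hx)
  refine ((hl.differentiableAt (ball_mem_nhds x hε)).congr_of_eventuallyEq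
    ?_).differentiableWithinAt
  filter_upwards [ball_mem_nhds x hε] with z hz
  exact uniq z _ _ (hφ z (hb hz)) (hlP z hz)

/-- The double cover of `D` branched at `w` is connected because its two sheets meet at 0. Given a
separation by `U ∋ 0` and `V`, the images of `U ∩ -U` and of `V` under the open map `x ↦ x ^ 2 + w`
cover `D`, so they share a point; its preimages `a` and `b = ±a` contradict disjointness. -/
theorem isPreconnected_sq_preimage {D : Set ℂ} (hc : IsPreconnected D) {w : ℂ}
    (hw : w ∈ D) : IsPreconnected {x : ℂ | x ^ 2 + w ∈ D} := by
  have hmap : IsOpenMap fun x : ℂ => x ^ 2 + w := by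
    have h1 : IsOpenMap fun x : ℂ => x ^ 2 := (Complex.isOpenQuotientMap_pow 2).isOpenMap
    exact (isOpenMap_add_right w).comp h1
  have key : ∀ U V : Set ℂ, IsOpen U → IsOpen V → {x : ℂ | x ^ 2 + w ∈ D} ⊆ U ∪ V →
      (0 : ℂ) ∈ U → ({x : ℂ | x ^ 2 + w ∈ D} ∩ V).Nonempty →
      ({x : ℂ | x ^ 2 + w ∈ D} ∩ (U ∩ V)).Nonempty := by
    intro U V hU hV hUV h0 ⟨y, hyX, hyV⟩
    by_contra hne
    have hdis : ∀ x, x ^ 2 + w ∈ D → x ∈ U → x ∉ V := fun x hx hxU hxV => hne ⟨x, hx, hxU, hxV⟩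
    have himg : ∀ A : Set ℂ, IsOpen A → IsOpen ((fun x : ℂ => x ^ 2 + w) '' A) :=
      fun A hA => hmap A hA
    have hneg : ∀ A : Set ℂ, IsOpen A → IsOpen {x : ℂ | -x ∈ A} :=
      fun A hA => hA.preimage continuous_neg
    have hroot : ∀ z : ℂ, ∃ x : ℂ, x ^ 2 + w = z := fun z => by
      obtain ⟨x, hx⟩ := IsAlgClosed.exists_pow_nat_eq (z - w) (n := 2) two_pos
      exact ⟨x, by rw [hx]; ring⟩
    have heq : ∀ x x' : ℂ, x ^ 2 + w = x' ^ 2 + w → x' = x ∨ x' = -x := fun x x' h =>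
      sq_eq_sq_iff_eq_or_eq_neg.1 (by linear_combination -h)
    have hsym : ∀ x : ℂ, x ^ 2 + w ∈ D → (-x) ^ 2 + w ∈ D := fun x hx => by rwa [neg_sq]
    obtain ⟨z, hzD, ⟨a, ⟨haU, haU'⟩, ha⟩, ⟨b, hbV, hb⟩⟩ := hc
      ((fun x : ℂ => x ^ 2 + w) '' (U ∩ {x | -x ∈ U})) ((fun x : ℂ => x ^ 2 + w) '' V)
      (himg _ (hU.inter (hneg U hU))) (himg _ hV) (by
        intro z hz
        obtain ⟨x, rfl⟩ := hroot z
        rcases hUV hz with hx | hx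
        · rcases hUV (hsym x hz) with hx' | hx'
          · exact Or.inl ⟨x, ⟨hx, hx'⟩, rfl⟩
          · exact Or.inr ⟨-x, hx', by simp⟩
        · exact Or.inr ⟨x, hx, rfl⟩)
      ⟨w, hw, 0, ⟨h0, by simpa using h0⟩, by simp⟩
      ⟨y ^ 2 + w, hyX, y, hyV, rfl⟩
    replace hzD : a ^ 2 + w ∈ D := by simp only at ha; rwa [ha]
    rcases heq a b (ha.trans hb.symm) with rfl | rfl
    · exact hdis _ hzD haU hbV
    · exact hdis _ (hsym a hzD) haU' hbV
  intro U V hU hV hUV hUne hVne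
  have h0X : (0 : ℂ) ∈ {x : ℂ | x ^ 2 + w ∈ D} := by simpa using hw
  rcases hUV h0X with h | h
  · exact key U V hU hV hUV h hVne
  · rw [inter_comm U V]
    exact key V U hV hU (by rwa [union_comm]) h hUne

end RootTower

/-! ### The entire functions μ and ν on the complex plane -/

section MuNu

/-- The restriction of `μ` to `ℂ`. -/
def muC (c : ℂ) : ℂ := ∑' m : ℕ, ((-1 : ℝ) ^ m / ((2 * m).factorial : ℝ)) • c ^ m

/-- The restriction of `ν` to `ℂ`. -/
def nuC (c : ℂ) : ℂ := ∑' m : ℕ, ((-1 : ℝ) ^ m / ((2 * m + 1).factorial : ℝ)) • c ^ m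

theorem norm_mu_coeff_le (m : ℕ) : ‖(-1 : ℝ) ^ m / ((2 * m).factorial : ℝ)‖ ≤ 1 / m.factorial := by
  rw [norm_div, norm_pow, norm_neg, norm_one, one_pow, Real.norm_natCast]
  gcongr
  omega

theorem norm_nu_coeff_le (m : ℕ) :
    ‖(-1 : ℝ) ^ m / ((2 * m + 1).factorial : ℝ)‖ ≤ 1 / m.factorial := by
  rw [norm_div, norm_pow, norm_neg, norm_one, one_pow, Real.norm_natCast]
  gcongr
  omega

theorem differentiable_tsum_of_coeff_le {a : ℕ → ℝ} (ha : ∀ m, ‖a m‖ ≤ 1 / m.factorial) :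
    Differentiable ℂ fun c : ℂ => ∑' m : ℕ, a m • c ^ m := by
  intro c
  have h := Complex.differentiableOn_tsum_of_summable_norm (U := ball (0 : ℂ) (‖c‖ + 1))
    (F := fun m c => a m • c ^ m) (Real.summable_pow_div_factorial (‖c‖ + 1))
    (fun m => ((differentiable_id.pow m).const_smul (a m)).differentiableOn) isOpen_ball (by
      intro m w hw
      rw [mem_ball_zero_iff] at hw
      rw [norm_smul, norm_pow, div_eq_mul_inv, mul_comm, ← one_div]
      gcongr
      exact ha m)
  exact h.differentiableAt (isOpen_ball.mem_nhds (by simp))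

theorem summable_smul_pow_of_coeff_le {A : Type*} [NormedRing A] [NormedAlgebra ℝ A]
    [NormOneClass A] [CompleteSpace A] {a : ℕ → ℝ} (ha : ∀ m, ‖a m‖ ≤ 1 / m.factorial) (c : A) :
    Summable fun m : ℕ => a m • c ^ m := by
  refine Summable.of_norm_bounded (Real.summable_pow_div_factorial ‖c‖) fun m => ?_
  rw [norm_smul, div_eq_mul_inv, mul_comm, ← one_div]
  exact mul_le_mul (norm_pow_le c m) (ha m) (norm_nonneg _) (by positivity)

theorem differentiable_nuC : Differentiable ℂ nuC := differentiable_tsum_of_coeff_le norm_nu_coeff_le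

theorem muC_sq (c : ℂ) : muC (c ^ 2) = Complex.cos c := by
  rw [← (Complex.hasSum_cos c).tsum_eq]
  refine tsum_congr fun m => ?_
  rw [Complex.real_smul, ← pow_mul]
  push_cast
  ring

theorem mul_nuC_sq (c : ℂ) : c * nuC (c ^ 2) = Complex.sin c := by
  rw [← (Complex.hasSum_sin c).tsum_eq, nuC, ← tsum_mul_left]
  refine tsum_congr fun m => ?_
  rw [Complex.real_smul, ← pow_mul]
  push_cast
  ring

theorem nuC_zero : nuC 0 = 1 := by
  rw [nuC, tsum_eq_single 0]
  · simp
  · intro m hm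
    simp [hm]

theorem muC_neg_sq (c : ℂ) : muC (-c ^ 2) = Complex.cosh c := by
  have : -c ^ 2 = (c * Complex.I) ^ 2 := by rw [mul_pow, Complex.I_sq]; ring
  rw [this, muC_sq, Complex.cos_mul_I]

theorem mul_nuC_neg_sq (c : ℂ) : c * nuC (-c ^ 2) = Complex.sinh c := by
  have h : -c ^ 2 = (c * Complex.I) ^ 2 := by rw [mul_pow, Complex.I_sq]; ring
  have := mul_nuC_sq (c * Complex.I)
  rw [← h, Complex.sin_mul_I] at this
  exact mul_right_cancel₀ Complex.I_ne_zero (by linear_combination this)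

/-- With c = d² this is cos² d + sin² d = 1. -/
theorem muC_sq_add (c : ℂ) : muC c ^ 2 + c * nuC c ^ 2 = 1 := by
  obtain ⟨d, rfl⟩ := IsAlgClosed.exists_pow_nat_eq c (n := 2) two_pos
  rw [muC_sq]
  linear_combination Complex.cos_sq_add_sin_sq d +
    (d * nuC (d ^ 2) + Complex.sin d) * mul_nuC_sq d

end MuNu

/-! ### Lifting holomorphic functions through μ -/

section Lift

variable {D : Set ℂ} {w : ℂ} {e : ℕ}

/-- The half-angle formulas for `h = cos φ` and `k = sin φ / (z - w) ^ (e / 2)`. -/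
theorem exists_half_angle (hD : IsOpen D) (hs : IsSimplyConnected D) (hw : w ∈ D) {h k : ℂ → ℂ}
    (hh : DifferentiableOn ℂ h D) (hk : DifferentiableOn ℂ k D)
    (hhk : ∀ z ∈ D, h z ^ 2 + (z - w) ^ e * k z ^ 2 = 1) (hhw : h w = 1) :
    ∃ h₁ k₁ : ℂ → ℂ, (DifferentiableOn ℂ h₁ D ∧ DifferentiableOn ℂ k₁ D ∧
      (∀ z ∈ D, h₁ z ^ 2 + (z - w) ^ e * k₁ z ^ 2 = 1) ∧ h₁ w = 1) ∧
      (∀ z ∈ D, 2 * h₁ z ^ 2 = 1 + h z) ∧ ∀ z ∈ D, 2 * h₁ z * k₁ z = k z := by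
  have hc : IsPreconnected D := hs.isPathConnected.isConnected.isPreconnected
  have hne : ∀ z ∈ D, h z = -1 → z ≠ w := by
    rintro z - hz rfl
    rw [hhw] at hz
    norm_num at hz
  have ha : ∀ z ∈ D, AnalyticAt ℂ h z := hh.analyticOnNhd hD
  have hka : ∀ z ∈ D, AnalyticAt ℂ k z := hk.analyticOnNhd hD
  -- the local square root of `(1 - h) / (2 (z - w) ^ e)` where `h = -1`
  have hσ : ∀ z ∈ D, h z = -1 → ∃ σ : ℂ → ℂ, AnalyticAt ℂ σ z ∧ σ z ≠ 0 ∧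
      ∀ᶠ x in 𝓝 z, 2 * (x - w) ^ e * σ x ^ 2 = 1 - h x := by
    intro z hz hz1
    have hzw : z - w ≠ 0 := sub_ne_zero.2 (hne z hz hz1)
    have h2 : (2 : ℂ) * (z - w) ^ e ≠ 0 := mul_ne_zero two_ne_zero (pow_ne_zero _ hzw)
    have han : AnalyticAt ℂ (fun x => 2 * (x - w) ^ e) z := by fun_prop
    obtain ⟨σ, hσ, hσ', hσ0⟩ := exists_local_sqrt (f := fun x => (1 - h x) / (2 * (x - w) ^ e))
      ((analyticAt_const.sub (ha z hz)).div han h2)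
      (div_ne_zero (by rw [hz1]; norm_num) h2)
    refine ⟨σ, hσ, hσ0, ?_⟩
    filter_upwards [hσ', han.continuousAt.eventually_ne h2] with x hx hx0
    rw [hx, ← mul_div_assoc, mul_div_cancel_left₀ _ hx0]
  obtain ⟨h₁, hh₁, hh₁'⟩ : ∃ h₁ : ℂ → ℂ, DifferentiableOn ℂ h₁ D ∧
      ∀ z ∈ D, h₁ z ^ 2 = (1 + h z) / 2 := by
    -- Only points with `h z = -1` matter. There (1 + h)(1 - h) = (z - w)^e k² and 1 - h = 2 (z -
    -- w)^e σ², so (1 + h)/2 is the square of k/(2σ).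
    refine exists_sqrt hD hs ((hh.const_add 1).div_const 2) fun z hz => ?_
    by_cases hz1 : h z = -1
    · obtain ⟨σ, hσa, hσ0, hσe⟩ := hσ z hz hz1
      have h2 : (2 : ℂ) * σ z ≠ 0 := mul_ne_zero two_ne_zero hσ0
      refine ⟨fun x => k x / (2 * σ x), (hka z hz).div (analyticAt_const.mul hσa) h2, ?_⟩
      have hzc : ContinuousAt (fun x => 1 - h x) z :=
        continuousAt_const.sub (ha z hz).continuousAt
      filter_upwards [hσe, hD.mem_nhds hz, hσa.continuousAt.eventually_ne hσ0,
        hzc.eventually_ne (show 1 - h z ≠ 0 by rw [hz1]; norm_num)] with x hx hxD hx0 hxh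
      have := hhk x hxD
      rw [div_pow, div_eq_div_iff (pow_ne_zero 2 (mul_ne_zero two_ne_zero hx0)) two_ne_zero]
      refine mul_left_cancel₀ hxh ?_
      linear_combination (-2 * k x ^ 2) * hx + 4 * σ x ^ 2 * this
    · obtain ⟨σ, hσa, hσe, -⟩ := exists_local_sqrt (f := fun x => (1 + h x) / 2)
        (z := z) ((analyticAt_const.add (ha z hz)).div_const)
        (div_ne_zero (fun h => hz1 (by linear_combination h)) two_ne_zero)
      exact ⟨σ, hσa, hσe⟩
  obtain ⟨h₂, hh₂, hh₂', hh₂w⟩ : ∃ h₂ : ℂ → ℂ, DifferentiableOn ℂ h₂ D ∧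
      (∀ z ∈ D, h₂ z ^ 2 = (1 + h z) / 2) ∧ h₂ w = 1 := by
    have h1 : h₁ w ^ 2 = 1 := by rw [hh₁' w hw, hhw]; norm_num
    rcases mul_self_eq_one_iff.1 ((sq _).symm.trans h1) with h | h
    · exact ⟨h₁, hh₁, hh₁', h⟩
    · exact ⟨fun z => -h₁ z, hh₁.neg, fun z hz => by rw [neg_sq, hh₁' z hz], by simp [h]⟩
  have h2a : ∀ z ∈ D, AnalyticAt ℂ h₂ z := hh₂.analyticOnNhd hD
  have h2ne : ∃ z ∈ D, h₂ z ≠ 0 := ⟨w, hw, by rw [hh₂w]; exact one_ne_zero⟩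
  obtain ⟨k₁, hk₁, hk₁'⟩ := exists_quotient hD hc (a := fun z => 2 * h₂ z) (b := k)
    (hh₂.const_mul 2) ⟨w, hw, by rw [hh₂w]; norm_num⟩ (by
      intro z hz
      by_cases hz0 : h₂ z = 0
      · have hz1 : h z = -1 := by
          have := hh₂' z hz
          rw [hz0] at this
          linear_combination (-2) * this
        obtain ⟨σ, hσa, hσ0, hσe⟩ := hσ z hz hz1
        obtain ⟨ε, hε, hb⟩ := Metric.eventually_nhds_iff_ball.1
          ((hσa.eventually_analyticAt.and hσe).and ((hD.mem_nhds hz)))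
        have hσd : DifferentiableOn ℂ σ (ball z ε) := fun x hx =>
          (hb x hx).1.1.differentiableAt.differentiableWithinAt
        have hsub : ball z ε ⊆ D := fun x hx => (hb x hx).2
        -- Near a zero of `h₂` this gives `k = ±2 h₂ σ`, so `k` is divisible by `2 h₂` although `h₂`
        -- vanishes.
        have hsq : ∀ x ∈ ball z ε \ {w}, k x ^ 2 = (2 * h₂ x * σ x) ^ 2 := by
          intro x hx
          have h1 := hhk x (hsub hx.1)
          have h2 := hh₂' x (hsub hx.1)
          have h3 := (hb x hx.1).1.2
          have h4 : (x - w) ^ e ≠ 0 := pow_ne_zero _ (sub_ne_zero.2 hx.2)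
          refine mul_left_cancel₀ h4 ?_
          linear_combination h1 - 4 * (x - w) ^ e * σ x ^ 2 * h2 - (1 + h x) * h3
        have hev : ∀ᶠ x in 𝓝 z, x ≠ w := by
          exact eventually_ne_nhds (hne z hz hz1)
        obtain ⟨δ, hδ, hbδ⟩ := Metric.eventually_nhds_iff_ball.1
          (hev.and (ball_mem_nhds z hε))
        have hkd : DifferentiableOn ℂ k (ball z δ) := hk.mono fun x hx => hsub (hbδ x hx).2
        have hpd : DifferentiableOn ℂ (fun x => 2 * h₂ x * σ x) (ball z δ) :=
          ((hh₂.mono fun x hx => hsub (hbδ x hx).2).const_mul 2).mul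
            (hσd.mono fun x hx => (hbδ x hx).2)
        rcases eq_or_eq_neg_of_sq_eq isOpen_ball (convex_ball z δ).isPreconnected hkd hpd
          (fun x hx => hsq x ⟨(hbδ x hx).2, (hbδ x hx).1⟩) with h | h
        · exact ⟨σ, hσa, Filter.mem_of_superset (ball_mem_nhds z hδ) h⟩
        · refine ⟨fun x => -σ x, hσa.neg, Filter.mem_of_superset (ball_mem_nhds z hδ) ?_⟩
          intro x hx
          have := h x hx
          change k x = 2 * h₂ x * -σ x
          rw [this]
          ring
      · refine ⟨fun x => k x / (2 * h₂ x), (hka z hz).div (analyticAt_const.mul (h2a z hz))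
          (mul_ne_zero two_ne_zero hz0), ?_⟩
        filter_upwards [(h2a z hz).continuousAt.eventually_ne hz0] with x hx
        field_simp)
  refine ⟨h₂, k₁, ⟨hh₂, hk₁, ?_, hh₂w⟩, fun z hz => by rw [hh₂' z hz]; ring,
    fun z hz => (hk₁' z hz).symm⟩
  have hd1 : DifferentiableOn ℂ (fun z => 4 * h₂ z ^ 2) D := (hh₂.pow 2).const_mul 4
  have hd2 : DifferentiableOn ℂ (fun z => h₂ z ^ 2 + (z - w) ^ e * k₁ z ^ 2 - 1) D :=
    ((hh₂.pow 2).add ((by fun_prop : DifferentiableOn ℂ (fun z => (z - w) ^ e) D).mul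
      (hk₁.pow 2))).sub_const 1
  -- The given identity equals `4 h₂ ^ 2` times the wanted one; the factor can be cancelled because
  -- it is nonzero at `w`.
  rcases eqOn_zero_or_of_mul_eq_zero hD hc hd1 hd2 (fun z hz => by
    have h1 := hhk z hz
    have h2 := hh₂' z hz
    have h3 := hk₁' z hz
    rw [h3] at h1
    have h4 : h z = 2 * h₂ z ^ 2 - 1 := by linear_combination (-2) * h2
    rw [h4] at h1
    linear_combination h1) with h | h
  · exfalso
    have := h w hw
    rw [hh₂w] at this
    norm_num at this
  · exact fun z hz => sub_eq_zero.1 (h z hz)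

/-- Lifting through `μ`. -/
theorem exists_muC_lift (hD : IsOpen D) (hs : IsSimplyConnected D) (hw : w ∈ D) {h k : ℂ → ℂ}
    (hh : DifferentiableOn ℂ h D) (hk : DifferentiableOn ℂ k D)
    (hhk : ∀ z ∈ D, h z ^ 2 + (z - w) ^ e * k z ^ 2 = 1) (hhw : h w = 1) :
    ∃ γ : ℂ → ℂ, DifferentiableOn ℂ γ D ∧ (∀ z ∈ D, muC (γ z) = h z) ∧ γ w = 0 := by
  have hc : IsPreconnected D := hs.isPathConnected.isConnected.isPreconnected
  let T := {p : (ℂ → ℂ) × (ℂ → ℂ) // DifferentiableOn ℂ p.1 D ∧ DifferentiableOn ℂ p.2 D ∧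
      (∀ z ∈ D, p.1 z ^ 2 + (z - w) ^ e * p.2 z ^ 2 = 1) ∧ p.1 w = 1}
  have hstep : ∀ p : T, ∃ q : T, (∀ z ∈ D, 2 * q.1.1 z ^ 2 = 1 + p.1.1 z) ∧
      ∀ z ∈ D, 2 * q.1.1 z * q.1.2 z = p.1.2 z := by
    rintro ⟨⟨h, k⟩, h1, h2, h3, h4⟩
    obtain ⟨h₁, k₁, hp, hq, hr⟩ := exists_half_angle hD hs hw h1 h2 h3 h4
    exact ⟨⟨⟨h₁, k₁⟩, hp⟩, hq, hr⟩
  choose next hnext hnext' using hstep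
  let t : ℕ → T := fun n => next^[n] ⟨⟨h, k⟩, hh, hk, hhk, hhw⟩
  have ht : ∀ n, t (n + 1) = next (t n) := fun n => Function.iterate_succ_apply' _ _ _
  set X : Set ℂ := {x : ℂ | x ^ 2 + w ∈ D} with hX
  have hsub : Differentiable ℂ fun x : ℂ => x ^ 2 + w := by fun_prop
  have hXo : IsOpen X := hD.preimage hsub.continuous
  have h0X : (0 : ℂ) ∈ X := by simpa [hX] using hw
  -- In the variable x = √(z - w) the sine is x^e k, without half-integral powers. Thus `F n` plays
  -- the role of exp(iθ/2^n) with cos θ = h, and `F'` that of its inverse; the half-angle formulas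
  -- give `F (n + 1) ^ 2 = F n`.
  let F : ℕ → ℂ → ℂ := fun n x =>
    (t n).1.1 (x ^ 2 + w) + Complex.I * x ^ e * (t n).1.2 (x ^ 2 + w)
  let F' : ℕ → ℂ → ℂ := fun n x =>
    (t n).1.1 (x ^ 2 + w) - Complex.I * x ^ e * (t n).1.2 (x ^ 2 + w)
  have hFF' : ∀ n, ∀ x ∈ X, F n x * F' n x = 1 := by
    intro n x hx
    have h1 := (t n).2.2.2.1 _ hx
    rw [add_sub_cancel_right] at h1
    simp only [F, F']
    linear_combination h1 - (x ^ e * (t n).1.2 (x ^ 2 + w)) ^ 2 * Complex.I_sq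
  have hF0 : ∀ n, F n 0 = 1 := by
    intro n
    have h1 := (t n).2.2.2.1 w hw
    have h2 : (t n).1.1 w = 1 := (t n).2.2.2.2
    rw [h2, sub_self] at h1
    -- For `e > 0` the power vanishes; for `e = 0` the condition `h w = 1` forces the second
    -- function to vanish at `w`.
    have h3 : ((0 : ℂ) ^ e * (t n).1.2 w) = 0 := by
      rcases mul_eq_zero.1 (show (0 : ℂ) ^ e * (t n).1.2 w ^ 2 = 0 by linear_combination h1)
        with h | h
      · rw [h, zero_mul]
      · rw [pow_eq_zero_iff two_ne_zero] at h
        rw [h, mul_zero]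
    simp only [F]
    rw [zero_pow two_ne_zero, zero_add, h2, mul_assoc, h3]
    ring
  obtain ⟨φ, hφ, hφF, hφ0⟩ := exists_log_of_root_tower hXo (isPreconnected_sq_preimage hc hw)
    (F := F) (by
      intro n
      have h1 : DifferentiableOn ℂ (fun x => (t n).1.1 (x ^ 2 + w)) X :=
        (t n).2.1.comp hsub.differentiableOn fun x hx => hx
      have h2 : DifferentiableOn ℂ (fun x => (t n).1.2 (x ^ 2 + w)) X :=
        (t n).2.2.1.comp hsub.differentiableOn fun x hx => hx
      exact h1.add ((by fun_prop : DifferentiableOn ℂ (fun x => Complex.I * x ^ e) X).mul h2))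
    (fun x hx h0 => by simpa [h0] using hFF' 0 x hx)
    (by
      intro n x hx
      have h1 := (t (n + 1)).2.2.2.1 _ hx
      have h2 := hnext (t n) _ hx
      have h3 := hnext' (t n) _ hx
      rw [← ht] at h2 h3
      rw [add_sub_cancel_right] at h1
      simp only [F]
      linear_combination h2 - h1 + Complex.I * x ^ e * h3 +
        (x ^ e * (t (n + 1)).1.2 (x ^ 2 + w)) ^ 2 * Complex.I_sq) h0X hF0
  have hcosh : ∀ x ∈ X, Complex.cosh (φ x) = h (x ^ 2 + w) := by
    intro x hx
    have h1 : Complex.exp (φ x) = F 0 x := by simpa using hφF x hx 0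
    have h2 : Complex.exp (-φ x) = F' 0 x := by
      rw [Complex.exp_neg, h1]
      exact inv_eq_of_mul_eq_one_right (hFF' 0 x hx)
    have h3 : F 0 x + F' 0 x = 2 * h (x ^ 2 + w) := by
      change h _ + _ + (h _ - _) = _
      ring
    rw [Complex.cosh, h1, h2, h3]
    ring
  have hnegX : ∀ x ∈ X, -x ∈ X := fun x hx => by simpa [hX] using hx
  -- Replacing `x` by `-x` fixes the tower if `e` is even and inverts it if `e` is odd. So `φ` is
  -- even or odd, and `φ ^ 2` is a function of z = x² + w.
  have heven : ∀ x ∈ X, φ (-x) ^ 2 = φ x ^ 2 := by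
    intro x hx
    rcases Nat.even_or_odd e with he | he
    · have : φ (-x) = φ x := eq_of_exp_div_two_pow fun n => by
        rw [hφF _ (hnegX x hx), hφF _ hx]
        simp only [F, neg_sq, he.neg_pow]
      rw [this]
    · have : φ (-x) = -φ x := eq_of_exp_div_two_pow fun n => by
        rw [neg_div, Complex.exp_neg, hφF _ (hnegX x hx), hφF _ hx]
        refine (inv_eq_of_mul_eq_one_right ?_).symm
        have := hFF' n x hx
        simp only [F, F', neg_sq, he.neg_pow] at this ⊢
        linear_combination this
      rw [this, neg_sq]
  -- descend to `D`
  let ρ : ℂ → ℂ := fun z => (z - w) ^ (1 / 2 : ℂ)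
  have hρ : ∀ z, ρ z ^ 2 = z - w := fun z => by
    simp [ρ]
  have hρX : ∀ z ∈ D, ρ z ∈ X := fun z hz => by
    change ρ z ^ 2 + w ∈ D
    rwa [hρ, sub_add_cancel]
  have hsame : ∀ z ∈ D, ∀ x, x ^ 2 = z - w → φ (ρ z) ^ 2 = φ x ^ 2 := by
    intro z hz x hx
    have hxX : x ∈ X := by
      change x ^ 2 + w ∈ D
      rwa [hx, sub_add_cancel]
    rcases sq_eq_sq_iff_eq_or_eq_neg.1 ((hρ z).trans hx.symm) with h | h
    · rw [h]
    · rw [h, heven x hxX]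
  refine ⟨fun z => -φ (ρ z) ^ 2, ?_, fun z hz => ?_, ?_⟩
  -- Away from `w` a local holomorphic root may replace `ρ`; at `w`, continuity makes the
  -- singularity removable. The sign in `-φ ^ 2` turns the identity for cosh into one for μ.
  · rw [← Complex.differentiableOn_compl_singleton_and_continuousAt_iff (hD.mem_nhds hw)]
    constructor
    · intro z hz
      obtain ⟨σ, hσ, hσe, -⟩ := exists_local_sqrt (f := fun x => x - w) (z := z)
        (by fun_prop) (sub_ne_zero.2 hz.2)
      have hσX : σ z ∈ X := by
        change σ z ^ 2 + w ∈ D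
        rw [hσe.self_of_nhds, sub_add_cancel]
        exact hz.1
      have h1 : DifferentiableAt ℂ (fun x => -φ (σ x) ^ 2) z :=
        (((hφ.differentiableAt (hXo.mem_nhds hσX)).comp z hσ.differentiableAt).pow 2).neg
      refine (h1.congr_of_eventuallyEq ?_).differentiableWithinAt
      filter_upwards [hσe, hD.mem_nhds hz.1] with x hx hxD
      rw [hsame x hxD _ hx]
    · have hρ0 : ρ w = 0 := by simpa using hρ w
      have h1 : ContinuousAt ρ w := by
        have h2 : ∀ z, ‖ρ z‖ = √‖z - w‖ := fun z => by
          rw [← hρ z, norm_pow, Real.sqrt_sq (norm_nonneg _)]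
        rw [ContinuousAt, hρ0, tendsto_zero_iff_norm_tendsto_zero]
        simp only [h2]
        have : Continuous fun z : ℂ => √‖z - w‖ := by fun_prop
        simpa using this.tendsto w
      have h3 : ContinuousAt φ (ρ w) := by
        rw [hρ0]
        exact (hφ.differentiableAt (hXo.mem_nhds h0X)).continuousAt
      exact ((h3.comp h1).pow 2).neg
  · rw [muC_neg_sq, hcosh _ (hρX z hz), hρ, sub_add_cancel]
  · have hρ0 : ρ w = 0 := by simpa using hρ w
    simp [hρ0, hφ0]

/-- Lifting through `μ` a function that is ramified over `±1` except possibly at `w`. -/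
theorem exists_muC_lift_of_locally_sq (hD : IsOpen D) (hs : IsSimplyConnected D) (hw : w ∈ D)
    {h : ℂ → ℂ} (hh : DifferentiableOn ℂ h D) (hhw : h w = 1)
    (hsq : ∀ z ∈ D, z ≠ w → ∃ r : ℂ → ℂ, AnalyticAt ℂ r z ∧ ∀ᶠ x in 𝓝 z, r x ^ 2 = 1 - h x ^ 2) :
    ∃ γ : ℂ → ℂ, DifferentiableOn ℂ γ D ∧ (∀ z ∈ D, muC (γ z) = h z) ∧ γ w = 0 := by
  have hc : IsPreconnected D := hs.isPathConnected.isConnected.isPreconnected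
  have hf : DifferentiableOn ℂ (fun z => 1 - h z ^ 2) D := (hh.pow 2).const_sub 1
  have hfa := hf.analyticOnNhd hD
  by_cases h0 : ∀ᶠ z in 𝓝 w, 1 - h z ^ 2 = 0
  -- In the degenerate case `h ^ 2 = 1` throughout, and `k = 0` serves.
  · refine exists_muC_lift (e := 0) hD hs hw hh (differentiableOn_const (c := (0 : ℂ)))
      (fun z hz => ?_) hhw
    linear_combination -eqOn_zero_of_eventually hD hc hf hw h0 z hz
  · obtain ⟨n, g, hg, hg0, hgf⟩ := (hfa w hw).exists_eventuallyEq_pow_smul_nonzero_iff.2 h0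
    simp only [smul_eq_mul] at hgf
    have hpow : DifferentiableOn ℂ (fun z => (z - w) ^ n) D := by fun_prop
    -- Removing the full order of vanishing at `w` leaves a factor `q` with `q w ≠ 0`. It is locally
    -- a square everywhere, so it has a global root `k`, whatever the parity of `n`.
    obtain ⟨q, hq, hqf⟩ := exists_quotient hD hc hpow
      (by
        obtain ⟨y, hy, hyD⟩ := ((eventually_mem_nhdsWithin (a := w) (s := {w}ᶜ)).and
          (nhdsWithin_le_nhds (hD.mem_nhds hw))).exists
        exact ⟨y, hyD, pow_ne_zero _ (sub_ne_zero.2 hy)⟩)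
      (fun z hz => by
        by_cases hzw : z = w
        · rw [hzw]
          exact ⟨g, hg, hgf⟩
        · have h1 : AnalyticAt ℂ (fun z => (z - w) ^ n) z := by fun_prop
          refine ⟨fun z => (1 - h z ^ 2) / (z - w) ^ n, (hfa z hz).div h1
            (pow_ne_zero _ (sub_ne_zero.2 hzw)), ?_⟩
          filter_upwards [eventually_ne_nhds hzw] with x hx
          rw [mul_div_cancel₀]
          exact pow_ne_zero _ (sub_ne_zero.2 hx))
    have hqa := hq.analyticOnNhd hD
    have hqw : q w ≠ 0 := by
      have e1 : ∀ᶠ x in 𝓝[≠] w, q x = g x := by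
        filter_upwards [nhdsWithin_le_nhds hgf, nhdsWithin_le_nhds (hD.mem_nhds hw),
          eventually_mem_nhdsWithin] with x h1 h2 h3
        exact mul_left_cancel₀ (pow_ne_zero n (sub_ne_zero.2 h3)) ((hqf x h2).symm.trans h1)
      rw [((hqa w hw).continuousAt.eventuallyEq_nhds_iff_eventuallyEq_nhdsNE
        hg.continuousAt).1 e1 |>.self_of_nhds]
      exact hg0
    obtain ⟨k, hk, hkq⟩ := exists_sqrt hD hs hq (fun z hz => by
      by_cases hzw : z = w
      · obtain ⟨r, hr, hrq, -⟩ := exists_local_sqrt (hqa w hw) hqw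
        rw [hzw]
        exact ⟨r, hr, hrq⟩
      · obtain ⟨r, hr, hrf⟩ := hsq z hz hzw
        obtain ⟨σ, hσ, hσe, hσ0⟩ := exists_local_sqrt (f := fun z => (z - w) ^ n) (z := z)
          (by fun_prop) (pow_ne_zero _ (sub_ne_zero.2 hzw))
        refine ⟨fun x => r x / σ x, hr.div hσ hσ0, ?_⟩
        filter_upwards [hrf, hσe, hD.mem_nhds hz, eventually_ne_nhds hzw] with x h1 h2 h3 h4
        rw [div_pow, h1, h2, hqf x h3, mul_div_cancel_left₀]
        exact pow_ne_zero _ (sub_ne_zero.2 h4))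
    exact exists_muC_lift (e := n) hD hs hw hh hk (fun z hz => by
      rw [hkq z hz, ← hqf z hz]; ring) hhw

end Lift

/-! ### Coordinates on quaternionic slices -/

section Slices

/-- The point `x + i y` of the closed upper half plane that corresponds to `q = x + I y`. -/
def coord (q : ℍ[ℝ]) : ℂ := ⟨q.re, ‖q.im‖⟩

/-- The intersection of an axially symmetric set with an open upper half slice. -/
def up (U : Set ℍ[ℝ]) : Set ℂ := {z | 0 < z.im ∧ slicePt unitI z ∈ U}

theorem mul_self_of_mem {I : ℍ[ℝ]} (hI : I ∈ imagUnits) : I * I = -1 := by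
  rw [← pow_two]; exact hI

theorem neg_mem_imagUnits {I : ℍ[ℝ]} (hI : I ∈ imagUnits) : -I ∈ imagUnits := by
  change (-I) ^ 2 = -1
  rw [neg_sq]; exact hI

theorem norm_of_mem {I : ℍ[ℝ]} (hI : I ∈ imagUnits) : ‖I‖ = 1 := by
  have h : ‖I‖ ^ 2 = 1 := by
    rw [← norm_pow, show I ^ 2 = -1 from hI, norm_neg, norm_one]
  nlinarith [norm_nonneg I]

theorem re_of_mem {I : ℍ[ℝ]} (hI : I ∈ imagUnits) : I.re = 0 := by
  have h1 : I * I = -1 := mul_self_of_mem hI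
  have h2 : I * star I = 1 := by
    rw [Quaternion.self_mul_star, Quaternion.normSq_eq_norm_mul_self, norm_of_mem hI]; simp
  have h3 : I * (I + star I) = 0 := by rw [mul_add, h1, h2]; simp
  have h4 : I ≠ 0 := fun h => by rw [h] at h1; simp at h1
  have h5 := congrArg QuaternionAlgebra.re ((mul_eq_zero.1 h3).resolve_left h4)
  simp at h5
  linarith

theorem mem_imagUnits_of_re_norm {I : ℍ[ℝ]} (h0 : I.re = 0) (h1 : ‖I‖ = 1) : I ∈ imagUnits := by
  have h2 : star I = -I := by
    ext <;> simp [h0]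
  change I ^ 2 = -1
  have h3 := Quaternion.self_mul_star I
  rw [h2, Quaternion.normSq_eq_norm_mul_self, h1] at h3
  rw [pow_two]
  simp at h3
  rw [← neg_eq_iff_eq_neg]
  exact h3

/-- The ring homomorphism `x + i y ↦ x + I y`. -/
def sliceHom {I : ℍ[ℝ]} (hI : I ∈ imagUnits) : ℂ →ₐ[ℝ] ℍ[ℝ] :=
  Complex.lift ⟨I, mul_self_of_mem hI⟩

theorem sliceHom_apply {I : ℍ[ℝ]} (hI : I ∈ imagUnits) (z : ℂ) : sliceHom hI z = slicePt I z := by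
  simp only [sliceHom, slicePt, Complex.lift_apply, Complex.liftAux_apply]
  congr 1
  rw [← Quaternion.coe_commutes, Quaternion.coe_mul_eq_smul]

theorem continuous_slicePt (I : ℍ[ℝ]) : Continuous (slicePt I) :=
  (Quaternion.continuous_coe.comp Complex.continuous_re).add
    (continuous_const.mul (Quaternion.continuous_coe.comp Complex.continuous_im))

theorem continuous_sliceHom {I : ℍ[ℝ]} (hI : I ∈ imagUnits) : Continuous (sliceHom hI) := by
  simpa only [funext (sliceHom_apply hI)] using continuous_slicePt I

theorem slicePt_re {I : ℍ[ℝ]} (hI : I ∈ imagUnits) (z : ℂ) : (slicePt I z).re = z.re := by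
  rw [slicePt, ← Quaternion.coe_commutes, Quaternion.coe_mul_eq_smul]
  simp [re_of_mem hI]

theorem slicePt_im {I : ℍ[ℝ]} (hI : I ∈ imagUnits) (z : ℂ) : (slicePt I z).im = z.im • I := by
  rw [slicePt, ← Quaternion.coe_commutes, Quaternion.coe_mul_eq_smul]
  ext <;> simp [re_of_mem hI]

theorem slicePt_neg (I : ℍ[ℝ]) (z : ℂ) : slicePt (-I) z = slicePt I (starRingEnd ℂ z) := by
  simp [slicePt]

theorem coord_slicePt {I : ℍ[ℝ]} (hI : I ∈ imagUnits) (z : ℂ) :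
    coord (slicePt I z) = ⟨z.re, |z.im|⟩ := by
  rw [coord, slicePt_re hI, slicePt_im hI, norm_smul, norm_of_mem hI, mul_one, Real.norm_eq_abs]

theorem coord_slicePt_of_pos {I : ℍ[ℝ]} (hI : I ∈ imagUnits) {z : ℂ} (hz : 0 < z.im) :
    coord (slicePt I z) = z := by
  rw [coord_slicePt hI, abs_of_pos hz]

theorem imagUnit_slicePt_of_pos {I : ℍ[ℝ]} (hI : I ∈ imagUnits) {z : ℂ} (hz : 0 < z.im) :
    imagUnit (slicePt I z) = I := by
  rw [imagUnit, slicePt_im hI, norm_smul, norm_of_mem hI, mul_one, Real.norm_eq_abs,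
    abs_of_pos hz, smul_smul, inv_mul_cancel₀ hz.ne', one_smul]

theorem sliceHom_injective {I : ℍ[ℝ]} (hI : I ∈ imagUnits) : Function.Injective (sliceHom hI) :=
  (sliceHom hI).toRingHom.injective

theorem im_ne_zero_iff (q : ℍ[ℝ]) : q.im ≠ 0 ↔ ∀ x : ℝ, q ≠ (x : ℍ[ℝ]) := by
  constructor
  · rintro h x rfl
    exact h (by simp)
  · intro h h0
    refine h q.re ?_
    conv_lhs => rw [← Quaternion.re_add_im q, h0, add_zero]

theorem imagUnit_mem {q : ℍ[ℝ]} (hq : q.im ≠ 0) : imagUnit q ∈ imagUnits :=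
  mem_imagUnits_of_re_norm (by simp [imagUnit]) (by
    rw [imagUnit, norm_smul, norm_inv, norm_norm, inv_mul_cancel₀ (norm_ne_zero_iff.2 hq)])

theorem coord_im_pos {q : ℍ[ℝ]} (hq : q.im ≠ 0) : 0 < (coord q).im := norm_pos_iff.2 hq

theorem slicePt_coord {q : ℍ[ℝ]} (hq : q.im ≠ 0) : slicePt (imagUnit q) (coord q) = q := by
  rw [slicePt, ← Quaternion.coe_commutes, Quaternion.coe_mul_eq_smul, imagUnit, coord, smul_smul,
    mul_inv_cancel₀ (norm_ne_zero_iff.2 hq), one_smul]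
  exact Quaternion.re_add_im q

theorem continuous_coord : Continuous coord := by
  have h1 : Continuous fun q : ℍ[ℝ] => q.re := Quaternion.continuous_re
  have h2 : Continuous fun q : ℍ[ℝ] => q.im := Quaternion.continuous_im
  have : coord = fun q => (q.re : ℂ) + (‖q.im‖ : ℂ) * Complex.I := by
    funext q
    apply Complex.ext <;> simp [coord]
  rw [this]
  fun_prop

/-- Subsets of `ℍ` that do not meet the real axis. -/
def RealFree (U : Set ℍ[ℝ]) : Prop := ∀ x : ℝ, (x : ℍ[ℝ]) ∉ U

theorem RealFree.mono {U V : Set ℍ[ℝ]} (hU : RealFree U) (h : V ⊆ U) : RealFree V :=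
  fun x hx => hU x (h hx)

theorem RealFree.im_ne_zero {U : Set ℍ[ℝ]} (hU : RealFree U) {q : ℍ[ℝ]} (hq : q ∈ U) :
    q.im ≠ 0 :=
  (im_ne_zero_iff q).2 fun x hx => hU x (hx ▸ hq)

theorem RealFree.imagUnit_mem {U : Set ℍ[ℝ]} (hU : RealFree U) {q : ℍ[ℝ]} (hq : q ∈ U) :
    imagUnit q ∈ imagUnits :=
  StarLog.imagUnit_mem (hU.im_ne_zero hq)

theorem coord_mem_up {U : Set ℍ[ℝ]} (hs : IsAxSymm U) (hU : RealFree U) {q : ℍ[ℝ]} (hq : q ∈ U) :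
    coord q ∈ up U :=
  ⟨coord_im_pos (hU.im_ne_zero hq), hs _ (hU.imagUnit_mem hq) _ unitI_mem _ (by
    rwa [slicePt_coord (hU.im_ne_zero hq)])⟩

theorem slicePt_mem {U : Set ℍ[ℝ]} (hs : IsAxSymm U) {I : ℍ[ℝ]} (hI : I ∈ imagUnits) {z : ℂ}
    (hz : z ∈ up U) : slicePt I z ∈ U := hs _ unitI_mem _ hI _ hz.2

theorem up_eq_image {U : Set ℍ[ℝ]} (hs : IsAxSymm U) (hU : RealFree U) : up U = coord '' U := by
  ext z
  constructor
  · intro hz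
    exact ⟨slicePt unitI z, hz.2, coord_slicePt_of_pos unitI_mem hz.1⟩
  · rintro ⟨q, hq, rfl⟩
    exact coord_mem_up hs hU hq

theorem isOpen_up {U : Set ℍ[ℝ]} (hU : IsOpen U) : IsOpen (up U) :=
  (isOpen_lt continuous_const Complex.continuous_im).inter
    (hU.preimage (continuous_slicePt unitI))

theorem isPreconnected_up {U : Set ℍ[ℝ]} (hU : IsAxSymmDomain U) (hr : RealFree U) :
    IsPreconnected (up U) := by
  rw [up_eq_image hU.axSymm hr]
  exact hU.isConnected.isPreconnected.image _ continuous_coord.continuousOn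

theorem up_mono {U V : Set ℍ[ℝ]} (h : U ⊆ V) : up U ⊆ up V := fun _ hz => ⟨hz.1, h hz.2⟩

/-- The upper half slice is a full connected component of the slice: a connected set that left the
upper half plane would meet the real axis. -/
theorem isSimplyConnected_up {Ω : Set ℍ[ℝ]} (hΩ : IsBasicProductDomain Ω) :
    IsSimplyConnected (up Ω) := by
  have hr : RealFree Ω := hΩ.no_real
  obtain ⟨q, hq⟩ := hΩ.isConnected.nonempty
  have hz := coord_mem_up hΩ.axSymm hr hq
  have h := hΩ.simplyConnected unitI unitI_mem (coord q) hz.2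
  have heq : connectedComponentIn (sliceSet Ω unitI) (coord q) = up Ω := by
    apply Subset.antisymm
    · intro z hz'
      have hzS := connectedComponentIn_subset _ _ hz'
      refine ⟨?_, hzS⟩
      have hpre : IsPreconnected (Complex.im '' connectedComponentIn (sliceSet Ω unitI) (coord q)) :=
        isPreconnected_connectedComponentIn.image _ Complex.continuous_im.continuousOn
      by_contra hneg
      obtain ⟨y, hy, hy0⟩ := hpre.ordConnected.out (mem_image_of_mem _ hz')
        (mem_image_of_mem _ (mem_connectedComponentIn hz.2)) ⟨not_lt.1 hneg, hz.1.le⟩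
      have := connectedComponentIn_subset _ _ hy
      refine hr y.re ?_
      have e : slicePt unitI y = (y.re : ℍ[ℝ]) := by rw [slicePt, hy0]; simp
      rw [← e]
      exact this
    · exact (isPreconnected_up hΩ.toIsAxSymmDomain hr).subset_connectedComponentIn hz
        fun z hz => hz.2
  rwa [heq] at h

/-- The axially symmetric set that is obtained by rotating a subset of the upper half plane. -/
def rot (B : Set ℂ) : Set ℍ[ℝ] := {q | coord q ∈ B}

theorem isAxSymm_rot (B : Set ℂ) : IsAxSymm (rot B) := by
  intro I hI J hJ z hz
  change coord _ ∈ B at hz ⊢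
  rwa [coord_slicePt hJ, ← coord_slicePt hI]

theorem realFree_rot {B : Set ℂ} (hB : ∀ z ∈ B, 0 < z.im) : RealFree (rot B) := fun x hx => by
  have := hB _ hx
  simp [coord] at this

theorem up_rot {B : Set ℂ} (hB : ∀ z ∈ B, 0 < z.im) : up (rot B) = B := by
  ext z
  constructor
  · rintro ⟨h1, h2⟩
    change coord _ ∈ B at h2
    rwa [coord_slicePt_of_pos unitI_mem h1] at h2
  · intro h
    refine ⟨hB z h, ?_⟩
    change coord _ ∈ B
    rwa [coord_slicePt_of_pos unitI_mem (hB z h)]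

theorem isPreconnected_imagUnits : IsPreconnected imagUnits := by
  let j : EuclideanSpace ℝ (Fin 3) → ℍ[ℝ] := fun v => ⟨0, v 0, v 1, v 2⟩
  have hj : Continuous j := by
    have : j = fun v => v 0 • (⟨0, 1, 0, 0⟩ : ℍ[ℝ]) + v 1 • (⟨0, 0, 1, 0⟩ : ℍ[ℝ])
        + v 2 • (⟨0, 0, 0, 1⟩ : ℍ[ℝ]) := by
      funext v
      ext <;> simp [j]
    have hv : ∀ i : Fin 3, Continuous fun v : EuclideanSpace ℝ (Fin 3) => v i := fun i => by fun_prop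
    rw [this]
    exact (((hv 0).smul continuous_const).add ((hv 1).smul continuous_const)).add
      ((hv 2).smul continuous_const)
  have hnorm : ∀ v, ‖j v‖ ^ 2 = ‖v‖ ^ 2 := by
    intro v
    rw [EuclideanSpace.norm_sq_eq, Fin.sum_univ_three, pow_two,
      ← Quaternion.normSq_eq_norm_mul_self, Quaternion.normSq_def']
    simp [j]
  have himg : imagUnits = j '' sphere 0 1 := by
    ext I
    constructor
    · intro hI
      refine ⟨!₂[I.imI, I.imJ, I.imK], ?_, ?_⟩
      · have h := hnorm !₂[I.imI, I.imJ, I.imK]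
        have hjI : j !₂[I.imI, I.imJ, I.imK] = I := by
          ext <;> simp [j, re_of_mem hI]
        rw [hjI, norm_of_mem hI] at h
        rw [mem_sphere_zero_iff_norm]
        nlinarith [norm_nonneg (!₂[I.imI, I.imJ, I.imK] : EuclideanSpace ℝ (Fin 3))]
      · ext <;> simp [j, re_of_mem hI]
    · rintro ⟨v, hv, rfl⟩
      rw [mem_sphere_zero_iff_norm] at hv
      have h := hnorm v
      rw [hv] at h
      exact mem_imagUnits_of_re_norm rfl (by nlinarith [norm_nonneg (j v)])
  rw [himg]
  refine (isPreconnected_sphere ?_ 0 1).image _ hj.continuousOn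
  rw [rank_eq_card_basis (EuclideanSpace.basisFun (Fin 3) ℝ).toBasis]
  simp

/-- Supplies small symmetric neighbourhoods of spheres. Connectedness holds because `rot B` is a
continuous image of `B ×ˢ imagUnits`. -/
theorem isAxSymmDomain_rot {B : Set ℂ} (hB : ∀ z ∈ B, 0 < z.im) (ho : IsOpen B)
    (hc : IsPreconnected B) (hne : B.Nonempty) : IsAxSymmDomain (rot B) := by
  refine ⟨ho.preimage continuous_coord, ⟨?_, ?_⟩, isAxSymm_rot B⟩
  · obtain ⟨z, hz⟩ := hne
    refine ⟨slicePt unitI z, ?_⟩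
    change coord _ ∈ B
    rwa [coord_slicePt_of_pos unitI_mem (hB z hz)]
  · have : rot B = (fun p : ℂ × ℍ[ℝ] => slicePt p.2 p.1) '' (B ×ˢ imagUnits) := by
      ext q
      constructor
      · intro hq
        have h0 := (realFree_rot hB).im_ne_zero hq
        exact ⟨(coord q, imagUnit q), ⟨hq, imagUnit_mem h0⟩, slicePt_coord h0⟩
      · rintro ⟨⟨z, I⟩, ⟨hz, hI⟩, rfl⟩
        change coord _ ∈ B
        rwa [coord_slicePt_of_pos hI (hB z hz)]
    rw [this]
    refine (hc.prod isPreconnected_imagUnits).image _ (Continuous.continuousOn ?_)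
    exact (Quaternion.continuous_coe.comp (Complex.continuous_re.comp continuous_fst)).add
      (continuous_snd.mul (Quaternion.continuous_coe.comp (Complex.continuous_im.comp
        continuous_fst)))

theorem coord_eq_of_mem_sphereOf {p q : ℍ[ℝ]} (h : p ∈ sphereOf q) : coord p = coord q := by
  rw [coord, coord, h.1, h.2]

theorem slicePt_mem_sphereOf {I q : ℍ[ℝ]} (hI : I ∈ imagUnits) :
    slicePt I (coord q) ∈ sphereOf q := by
  refine ⟨slicePt_re hI _, ?_⟩
  rw [slicePt_im hI, norm_smul, norm_of_mem hI, mul_one]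
  exact norm_norm _

end Slices

/-! ### Stem functions -/

section Stem

@[simp] theorem reHC_re (w : ℍ[ℂ]) : (reHC w).re = w.re.re := rfl

@[simp] theorem imHC_re (w : ℍ[ℂ]) : (imHC w).re = w.re.im := rfl

@[simp] theorem conjHC_re (w : ℍ[ℂ]) : (conjHC w).re = starRingEnd ℂ w.re := rfl

@[simp] theorem reHC_imI (w : ℍ[ℂ]) : (reHC w).imI = w.imI.re := rfl

@[simp] theorem imHC_imI (w : ℍ[ℂ]) : (imHC w).imI = w.imI.im := rfl

@[simp] theorem conjHC_imI (w : ℍ[ℂ]) : (conjHC w).imI = starRingEnd ℂ w.imI := rfl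

@[simp] theorem reHC_imJ (w : ℍ[ℂ]) : (reHC w).imJ = w.imJ.re := rfl

@[simp] theorem imHC_imJ (w : ℍ[ℂ]) : (imHC w).imJ = w.imJ.im := rfl

@[simp] theorem conjHC_imJ (w : ℍ[ℂ]) : (conjHC w).imJ = starRingEnd ℂ w.imJ := rfl

@[simp] theorem reHC_imK (w : ℍ[ℂ]) : (reHC w).imK = w.imK.re := rfl

@[simp] theorem imHC_imK (w : ℍ[ℂ]) : (imHC w).imK = w.imK.im := rfl

@[simp] theorem conjHC_imK (w : ℍ[ℂ]) : (conjHC w).imK = starRingEnd ℂ w.imK := rfl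

theorem phi_add (J : ℍ[ℝ]) (v w : ℍ[ℂ]) : phi J (v + w) = phi J v + phi J w := by
  have h1 : reHC (v + w) = reHC v + reHC w := by ext <;> simp
  have h2 : imHC (v + w) = imHC v + imHC w := by ext <;> simp
  rw [phi, phi, phi, h1, h2, mul_add]
  abel

theorem phi_zero (J : ℍ[ℝ]) : phi J 0 = 0 := by
  have h := phi_add J 0 0
  rw [add_zero] at h
  exact left_eq_add.1 h

theorem phi_coe (J : ℍ[ℝ]) (c : ℂ) : phi J (c : ℍ[ℂ]) = slicePt J c := by
  have h1 : reHC (c : ℍ[ℂ]) = (c.re : ℍ[ℝ]) := by ext <;> simp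
  have h2 : imHC (c : ℍ[ℂ]) = (c.im : ℍ[ℝ]) := by ext <;> simp
  rw [phi, h1, h2, slicePt]

theorem phi_coe_mul {J : ℍ[ℝ]} (hJ : J ∈ imagUnits) (c : ℂ) (w : ℍ[ℂ]) :
    phi J ((c : ℍ[ℂ]) * w) = slicePt J c * phi J w := by
  have h1 : reHC ((c : ℍ[ℂ]) * w) = c.re • reHC w - c.im • imHC w := by
    rw [Quaternion.coe_mul_eq_smul]; ext <;> simp
  have h2 : imHC ((c : ℍ[ℂ]) * w) = c.re • imHC w + c.im • reHC w := by
    rw [Quaternion.coe_mul_eq_smul]; ext <;> simp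
  rw [phi, phi, h1, h2, slicePt, ← Quaternion.coe_commutes, Quaternion.coe_mul_eq_smul]
  have hJJ : J * (J * imHC w) = -imHC w := by
    rw [← mul_assoc, mul_self_of_mem hJ, neg_one_mul]
  rw [add_mul, Quaternion.coe_mul_eq_smul, smul_mul_assoc]
  simp only [mul_add, mul_smul_comm, hJJ]
  module

theorem phi_neg_conjHC (J : ℍ[ℝ]) (w : ℍ[ℂ]) : phi (-J) (conjHC w) = phi J w := by
  have r1 : reHC (conjHC w) = reHC w := rfl
  have r2 : imHC (conjHC w) = -imHC w := rfl
  rw [phi, phi, r1, r2, neg_mul_neg]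

theorem conjHC_conjHC (w : ℍ[ℂ]) : conjHC (conjHC w) = w := by
  ext <;> simp

/-- The complex quadratic form `w ↦ w₀² + w₁² + w₂² + w₃²` on `ℍ + ι ℍ`. -/
def cnorm (w : ℍ[ℂ]) : ℂ := w.re ^ 2 + w.imI ^ 2 + w.imJ ^ 2 + w.imK ^ 2

theorem cnorm_coe_mul (c : ℂ) (w : ℍ[ℂ]) : cnorm ((c : ℍ[ℂ]) * w) = c ^ 2 * cnorm w := by
  rw [Quaternion.coe_mul_eq_smul]
  simp [cnorm]
  ring

theorem eq_zero_of_reHC_imHC {w : ℍ[ℂ]} (h1 : reHC w = 0) (h2 : imHC w = 0) : w = 0 := by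
  have e1 := congrArg QuaternionAlgebra.re h1
  have e2 := congrArg QuaternionAlgebra.imI h1
  have e3 := congrArg QuaternionAlgebra.imJ h1
  have e4 := congrArg QuaternionAlgebra.imK h1
  have f1 := congrArg QuaternionAlgebra.re h2
  have f2 := congrArg QuaternionAlgebra.imI h2
  have f3 := congrArg QuaternionAlgebra.imJ h2
  have f4 := congrArg QuaternionAlgebra.imK h2
  simp only [reHC, imHC] at e1 e2 e3 e4 f1 f2 f3 f4
  ext
  · exact Complex.ext e1 f1
  · exact Complex.ext e2 f2
  · exact Complex.ext e3 f3
  · exact Complex.ext e4 f4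

/-- The two units ±i suffice: a + ib = a - ib = 0 gives a = b = 0. -/
theorem eq_zero_of_phi_eq_zero {w : ℍ[ℂ]} (h : ∀ I ∈ imagUnits, phi I w = 0) : w = 0 := by
  have h1 := h _ unitI_mem
  have h2 := h _ (neg_mem_imagUnits unitI_mem)
  rw [phi] at h1 h2
  rw [neg_mul] at h2
  have h3 : (2 : ℝ) • reHC w = 0 := by
    rw [two_smul]
    have : reHC w + reHC w = reHC w + unitI * imHC w + (reHC w + -(unitI * imHC w)) := by abel
    rw [this, h1, h2, add_zero]
  have h4 : reHC w = 0 := (smul_eq_zero.1 h3).resolve_left two_ne_zero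
  rw [h4, zero_add] at h1
  have h5 : unitI ≠ 0 := fun h0 => by
    have := norm_of_mem unitI_mem
    rw [h0, norm_zero] at this
    exact zero_ne_one this
  exact eq_zero_of_reHC_imHC h4 ((mul_eq_zero.1 h1).resolve_left h5)

theorem re_sq_add (q : ℍ[ℝ]) :
    ‖q‖ ^ 2 = q.re ^ 2 + q.imI ^ 2 + q.imJ ^ 2 + q.imK ^ 2 := by
  rw [pow_two, ← Quaternion.normSq_eq_norm_mul_self, Quaternion.normSq_def']

theorem cnorm_re (w : ℍ[ℂ]) : (cnorm w).re = ‖reHC w‖ ^ 2 - ‖imHC w‖ ^ 2 := by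
  rw [re_sq_add, re_sq_add]
  simp [cnorm, pow_two]
  ring

theorem cnorm_im (w : ℍ[ℂ]) : (cnorm w).im = 2 * (reHC w * star (imHC w)).re := by
  simp [cnorm, pow_two]
  ring

/-- A slice function vanishes somewhere on a sphere iff its symmetrization vanishes there. -/
theorem exists_phi_eq_zero_iff (w : ℍ[ℂ]) : (∃ I ∈ imagUnits, phi I w = 0) ↔ cnorm w = 0 := by
  constructor
  · rintro ⟨I, hI, h⟩
    have h1 : reHC w = -(I * imHC w) := eq_neg_of_add_eq_zero_left h
    apply Complex.ext
    · rw [cnorm_re, h1, norm_neg, norm_mul, norm_of_mem hI, one_mul, sub_self, Complex.zero_re]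
    · rw [cnorm_im, h1, neg_mul, mul_assoc, Quaternion.self_mul_star,
        ← Quaternion.coe_commutes, Quaternion.coe_mul_eq_smul]
      simp [re_of_mem hI]
  · intro h
    have h1 : ‖reHC w‖ ^ 2 = ‖imHC w‖ ^ 2 := by
      have := cnorm_re w
      rw [h, Complex.zero_re] at this
      linarith
    have h2 : (reHC w * star (imHC w)).re = 0 := by
      have := cnorm_im w
      rw [h, Complex.zero_im] at this
      linarith
    have h3 : ‖reHC w‖ = ‖imHC w‖ := by
      have := abs_eq_abs.2 (sq_eq_sq_iff_eq_or_eq_neg.1 h1)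
      rwa [abs_norm, abs_norm] at this
    by_cases h0 : imHC w = 0
    · rw [h0, norm_zero, norm_eq_zero] at h3
      refine ⟨unitI, unitI_mem, ?_⟩
      rw [phi, h0, h3]
      simp
    · have hn : ‖imHC w‖ ≠ 0 := norm_ne_zero_iff.2 h0
      -- Solving a + Ib = 0 gives I = -ab⁻¹. The real part of `cnorm w = 0` makes it a unit, the
      -- imaginary part makes it purely imaginary.
      refine ⟨-(reHC w * (imHC w)⁻¹), mem_imagUnits_of_re_norm ?_ ?_, ?_⟩
      · have : (imHC w)⁻¹ = (Quaternion.normSq (imHC w))⁻¹ • star (imHC w) := rfl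
        rw [this, mul_smul_comm]
        simp only [Quaternion.re_neg, Quaternion.re_smul]
        rw [h2]
        simp
      · rw [norm_neg, norm_mul, norm_inv, h3, mul_inv_cancel₀ hn]
      · rw [phi, neg_mul, inv_mul_cancel_right₀ h0, add_neg_cancel]

/-- Extension of a function on the upper half plane to a stem function. -/
def extendStem (F : ℂ → ℍ[ℂ]) (z : ℂ) : ℍ[ℂ] :=
  if 0 < z.im then F z else conjHC (F (starRingEnd ℂ z))

variable {U : Set ℍ[ℝ]}

theorem sliceSet_im_ne_zero (hr : RealFree U) {I : ℍ[ℝ]} {z : ℂ} (hz : z ∈ sliceSet U I) :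
    z.im ≠ 0 := fun h => by
  refine hr z.re ?_
  have e : slicePt I z = (z.re : ℍ[ℝ]) := by rw [slicePt, h]; simp
  rw [← e]
  exact hz

theorem mem_up_or (hs : IsAxSymm U) (hr : RealFree U) {I : ℍ[ℝ]} (hI : I ∈ imagUnits) {z : ℂ}
    (hz : z ∈ sliceSet U I) : z ∈ up U ∨ (z.im < 0 ∧ starRingEnd ℂ z ∈ up U) := by
  rcases lt_or_gt_of_ne (sliceSet_im_ne_zero hr hz) with h | h
  · refine Or.inr ⟨h, by simpa using h, ?_⟩
    rw [← slicePt_neg]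
    exact hs _ hI _ (neg_mem_imagUnits unitI_mem) _ hz
  · exact Or.inl ⟨h, hs _ hI _ unitI_mem _ hz⟩

/-- No compatibility on the real axis is needed, so any function on the upper half plane extends by
reflection; below the axis, x + Iy is rewritten as x + (-I)(-y). -/
theorem isInducedBy_extendStem (hs : IsAxSymm U) (hr : RealFree U) {F : ℂ → ℍ[ℂ]}
    {f : ℍ[ℝ] → ℍ[ℝ]} (hf : ∀ q ∈ U, f q = induced F q) : IsInducedBy U (extendStem F) f := by
  intro I hI z hz
  rw [hf _ hz, induced]
  rcases mem_up_or hs hr hI hz with h | ⟨h, h'⟩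
  · have h1 : ¬ 0 < (starRingEnd ℂ z).im := by simpa using h.1.le
    rw [extendStem, extendStem, if_neg h1, if_pos h.1, Complex.conj_conj,
      imagUnit_slicePt_of_pos hI h.1]
    exact ⟨rfl, congrArg (fun w => phi I (F w)) (coord_slicePt_of_pos hI h.1)⟩
  · have h1 : ¬ 0 < z.im := not_lt.2 h.le
    have h2 : slicePt I z = slicePt (-I) (starRingEnd ℂ z) := by
      rw [slicePt_neg, Complex.conj_conj]
    have hI' := neg_mem_imagUnits hI
    rw [extendStem, extendStem, if_pos h'.1, if_neg h1, h2, imagUnit_slicePt_of_pos hI' h'.1]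
    refine ⟨(conjHC_conjHC _).symm, ?_⟩
    have h3 := congrArg (fun w => phi (-I) (F w)) (coord_slicePt_of_pos hI' h'.1)
    refine h3.trans ?_
    rw [← phi_neg_conjHC, neg_neg]

theorem isHolo_extendStem (hU : IsOpen U) (hs : IsAxSymm U) (hr : RealFree U) {F : ℂ → ℍ[ℂ]}
    (hF : IsHolo (up U) F) {I : ℍ[ℝ]} (hI : I ∈ imagUnits) :
    IsHolo (sliceSet U I) (extendStem F) := by
  have key : ∀ c : ℍ[ℂ] → ℂ, (∀ w, c (conjHC w) = starRingEnd ℂ (c w)) →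
      DifferentiableOn ℂ (fun z => c (F z)) (up U) →
      DifferentiableOn ℂ (fun z => c (extendStem F z)) (sliceSet U I) := by
    intro c hc hd z hz
    rcases mem_up_or hs hr hI hz with h | ⟨h, h'⟩
    · refine ((hd.differentiableAt ((isOpen_up hU).mem_nhds h)).congr_of_eventuallyEq
        ?_).differentiableWithinAt
      filter_upwards [(isOpen_lt continuous_const Complex.continuous_im).mem_nhds h.1] with x hx
      rw [extendStem, if_pos hx]
    · have h1 := hd.differentiableAt ((isOpen_up hU).mem_nhds h')
      have h2 : DifferentiableAt ℂ (fun z => starRingEnd ℂ (c (F (starRingEnd ℂ z)))) z := by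
        have := h1.conj_conj
        rwa [Complex.conj_conj] at this
      refine (h2.congr_of_eventuallyEq ?_).differentiableWithinAt
      filter_upwards [(isOpen_lt Complex.continuous_im continuous_const).mem_nhds h] with x hx
      rw [extendStem, if_neg (not_lt.2 (le_of_lt hx)), hc]
  exact ⟨key (fun w => w.re) (fun w => rfl) hF.re, key (fun w => w.imI) (fun w => rfl) hF.imI,
    key (fun w => w.imJ) (fun w => rfl) hF.imJ, key (fun w => w.imK) (fun w => rfl) hF.imK⟩

end Stem

/-! ### Slice regular functions in terms of stem functions on the upper half plane -/

section SliceRegular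

variable {U V : Set ℍ[ℝ]} {f : ℍ[ℝ] → ℍ[ℝ]}

theorem IsHolo.mono {D D' : Set ℂ} {F : ℂ → ℍ[ℂ]} (hF : IsHolo D F) (h : D' ⊆ D) : IsHolo D' F :=
  ⟨hF.re.mono h, hF.imI.mono h, hF.imJ.mono h, hF.imK.mono h⟩

theorem IsHolo.congr {D : Set ℂ} {F G : ℂ → ℍ[ℂ]} (hF : IsHolo D F) (h : ∀ z ∈ D, G z = F z) :
    IsHolo D G :=
  ⟨hF.re.congr fun z hz => by rw [h z hz], hF.imI.congr fun z hz => by rw [h z hz],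
    hF.imJ.congr fun z hz => by rw [h z hz], hF.imK.congr fun z hz => by rw [h z hz]⟩

theorem IsHolo.coe {D : Set ℂ} {c : ℂ → ℂ} (hc : DifferentiableOn ℂ c D) :
    IsHolo D fun z => ((c z : ℂ) : ℍ[ℂ]) :=
  ⟨by simpa using hc, by simp, by simp, by simp⟩

theorem up_subset_sliceSet : up U ⊆ sliceSet U unitI := fun _ hz => hz.2

theorem isSliceRegular_of_eq_induced (hU : IsOpen U) (hs : IsAxSymm U) (hr : RealFree U)
    {F : ℂ → ℍ[ℂ]} (hF : IsHolo (up U) F) (hf : ∀ q ∈ U, f q = induced F q) :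
    IsSliceRegular U f :=
  ⟨extendStem F, isInducedBy_extendStem hs hr hf, fun _ hI => isHolo_extendStem hU hs hr hF hI⟩

theorem stem_eq_of_eq_induced (hs : IsAxSymm U) (hr : RealFree U)
    {F : ℂ → ℍ[ℂ]} (hf : ∀ q ∈ U, f q = induced F q) {z : ℂ} (hz : z ∈ up U) :
    stem f z = F z := by
  rw [stem_eq hs (isInducedBy_extendStem hs hr hf) unitI_mem hz.2, extendStem, if_pos hz.1]

theorem isHolo_stem (hs : IsAxSymm U) (hf : IsSliceRegular U f) : IsHolo (up U) (stem f) := by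
  obtain ⟨F, hF, hh⟩ := hf
  exact ((hh _ unitI_mem).mono up_subset_sliceSet).congr fun z hz =>
    stem_eq hs hF unitI_mem hz.2

theorem eq_phi_stem (hs : IsAxSymm U) (hr : RealFree U) (hf : IsSliceRegular U f)
    {q : ℍ[ℝ]} (hq : q ∈ U) : f q = phi (imagUnit q) (stem f (coord q)) := by
  obtain ⟨F, hF, -⟩ := hf
  have h0 := hr.im_ne_zero hq
  have h1 : coord q ∈ sliceSet U (imagUnit q) := by
    change slicePt _ _ ∈ U
    rwa [slicePt_coord h0]
  have h2 := (hF _ (imagUnit_mem h0) _ h1).2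
  rw [slicePt_coord h0] at h2
  rw [h2, stem_eq hs hF (imagUnit_mem h0) h1]

theorem eq_phi_stem_slicePt (hs : IsAxSymm U) (hr : RealFree U) (hf : IsSliceRegular U f)
    {I : ℍ[ℝ]} (hI : I ∈ imagUnits) {z : ℂ} (hz : z ∈ up U) :
    f (slicePt I z) = phi I (stem f z) := by
  rw [eq_phi_stem hs hr hf (slicePt_mem hs hI hz), imagUnit_slicePt_of_pos hI hz.1,
    coord_slicePt_of_pos hI hz.1]

theorem stem_eq_zero_iff (hs : IsAxSymm U) (hr : RealFree U) (hf : IsSliceRegular U f) {z : ℂ}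
    (hz : z ∈ up U) : stem f z = 0 ↔ ∀ I ∈ imagUnits, f (slicePt I z) = 0 := by
  constructor
  · intro h I hI
    rw [eq_phi_stem_slicePt hs hr hf hI hz, h, phi_zero]
  · intro h
    exact eq_zero_of_phi_eq_zero fun I hI => by
      rw [← eq_phi_stem_slicePt hs hr hf hI hz, h I hI]

theorem forall_eq_zero_iff (hs : IsAxSymm U) (hr : RealFree U) (hf : IsSliceRegular U f) :
    (∀ q ∈ U, f q = 0) ↔ ∀ z ∈ up U, stem f z = 0 := by
  constructor
  · intro h z hz
    exact (stem_eq_zero_iff hs hr hf hz).2 fun I hI => h _ (slicePt_mem hs hI hz)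
  · intro h q hq
    rw [eq_phi_stem hs hr hf hq, h _ (coord_mem_up hs hr hq), phi_zero]

theorem IsSliceRegular.mono (h : V ⊆ U) (hf : IsSliceRegular U f) : IsSliceRegular V f := by
  obtain ⟨F, hF, hh⟩ := hf
  exact ⟨F, fun I hI z hz => hF I hI z (h hz), fun I hI => (hh I hI).mono fun z hz => h hz⟩

/-- The slice preserving function that is induced by a complex function. -/
def ev (c : ℂ → ℂ) (q : ℍ[ℝ]) : ℍ[ℝ] := slicePt (imagUnit q) (c (coord q))

theorem ev_eq_induced (c : ℂ → ℂ) (q : ℍ[ℝ]) : ev c q = induced (fun z => ((c z : ℂ) : ℍ[ℂ])) q :=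
  (phi_coe _ _).symm

theorem isSRReal_of_eq_ev (hU : IsOpen U) (hs : IsAxSymm U) (hr : RealFree U) {c : ℂ → ℂ}
    (hc : DifferentiableOn ℂ c (up U)) (hf : ∀ q ∈ U, f q = ev c q) : IsSRReal U f := by
  refine ⟨isSliceRegular_of_eq_induced hU hs hr (IsHolo.coe hc) fun q hq => by
    rw [hf q hq, ev_eq_induced], ?_⟩
  intro I hI z hz
  rw [hf _ hz, ev]
  rcases mem_up_or hs hr hI hz with h | ⟨-, h⟩
  · rw [imagUnit_slicePt_of_pos hI h.1]
    exact mem_range_self _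
  · have h2 : slicePt I z = slicePt (-I) (starRingEnd ℂ z) := by
      rw [slicePt_neg, Complex.conj_conj]
    rw [h2, imagUnit_slicePt_of_pos (neg_mem_imagUnits hI) h.1, slicePt_neg]
    exact mem_range_self _

theorem stem_eq_coe_of_eq_ev (hs : IsAxSymm U) (hr : RealFree U) {c : ℂ → ℂ}
    (hf : ∀ q ∈ U, f q = ev c q) {z : ℂ} (hz : z ∈ up U) : stem f z = ((c z : ℂ) : ℍ[ℂ]) :=
  stem_eq_of_eq_induced (F := fun z => ((c z : ℂ) : ℍ[ℂ])) hs hr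
    (fun q hq => (hf q hq).trans (ev_eq_induced c q)) hz

/-- Two slices, ℂ_i and ℂ_j, already intersect only in ℝ. -/
theorem eq_coe_of_mem_range {a : ℍ[ℝ]} (h : ∀ I ∈ imagUnits, a ∈ range (slicePt I)) :
    a = (a.re : ℍ[ℝ]) := by
  let J : ℍ[ℝ] := ⟨0, 0, 1, 0⟩
  have hJ : J ∈ imagUnits := mem_imagUnits_of_re_norm rfl (by
    have h := re_sq_add J
    simp [J] at h
    exact h.resolve_right (by intro h; linarith [norm_nonneg J]))
  obtain ⟨x, hx⟩ := h _ unitI_mem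
  obtain ⟨y, hy⟩ := h _ hJ
  have e1 : x.im • unitI = a.im := by rw [← slicePt_im unitI_mem, hx]
  have e2 : y.im • J = a.im := by rw [← slicePt_im hJ, hy]
  have hI : a.imI = 0 :=
    (congrArg QuaternionAlgebra.imI e2).symm.trans (mul_zero y.im)
  have hJ' : a.imJ = 0 :=
    (congrArg QuaternionAlgebra.imJ e1).symm.trans (mul_zero x.im)
  have hK : a.imK = 0 :=
    (congrArg QuaternionAlgebra.imK e1).symm.trans (mul_zero x.im)
  ext <;> simp [hI, hJ', hK]

/-- The stem function of a slice preserving function is scalar. -/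
theorem IsSRReal.exists_ev (hs : IsAxSymm U) (hr : RealFree U) (hf : IsSRReal U f) :
    ∃ c : ℂ → ℂ, DifferentiableOn ℂ c (up U) ∧ (∀ q ∈ U, f q = ev c q) ∧
      ∀ z ∈ up U, stem f z = ((c z : ℂ) : ℍ[ℂ]) := by
  have key : ∀ z ∈ up U, stem f z = (((stem f z).re : ℂ) : ℍ[ℂ]) := by
    intro z hz
    set w := stem f z with hw
    have h1 : ∀ I ∈ imagUnits, phi I w ∈ range (slicePt I) := fun I hI => by
      rw [hw, ← eq_phi_stem_slicePt hs hr hf.1 hI hz]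
      exact hf.2 I hI z (slicePt_mem hs hI hz)
    -- As ℂ_I = ℂ_{-I}, both a + Ib and a - Ib lie in ℂ_I, hence so do a and b. This holds for every
    -- I, so a and b are real.
    have h2 : ∀ I ∈ imagUnits, phi (-I) w ∈ range (slicePt I) := fun I hI => by
      obtain ⟨x, hx⟩ := h1 (-I) (neg_mem_imagUnits hI)
      exact ⟨starRingEnd ℂ x, by rw [← slicePt_neg, hx]⟩
    have h3 : ∀ I ∈ imagUnits, reHC w ∈ range (slicePt I) := fun I hI => by
      obtain ⟨x, hx⟩ := h1 I hI
      obtain ⟨y, hy⟩ := h2 I hI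
      refine ⟨(x + y) / 2, ?_⟩
      have e : (x + y) / 2 = (2⁻¹ : ℝ) • (x + y) := by
        rw [Complex.real_smul]; push_cast; ring
      rw [← sliceHom_apply hI, e, map_smul, map_add, sliceHom_apply, sliceHom_apply, hx, hy, phi,
        phi]
      rw [neg_mul]
      module
    have h4 : ∀ I ∈ imagUnits, imHC w ∈ range (slicePt I) := fun I hI => by
      obtain ⟨x, hx⟩ := h1 I hI
      obtain ⟨y, hy⟩ := h3 I hI
      refine ⟨-Complex.I * (x - y), ?_⟩
      have hII : slicePt I Complex.I = I := by simp [slicePt]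
      rw [← sliceHom_apply hI, map_mul, map_neg, map_sub, sliceHom_apply, sliceHom_apply,
        sliceHom_apply, hx, hy, phi, hII, add_sub_cancel_left, ← mul_assoc, neg_mul,
        mul_self_of_mem hI]
      simp
    have h5 := eq_coe_of_mem_range h3
    have h6 := eq_coe_of_mem_range h4
    ext
    · simp
    · have e1 := congrArg QuaternionAlgebra.imI h5
      have e2 := congrArg QuaternionAlgebra.imI h6
      simp at e1 e2
      exact Complex.ext e1 e2
    · have e1 := congrArg QuaternionAlgebra.imJ h5
      have e2 := congrArg QuaternionAlgebra.imJ h6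
      simp at e1 e2
      exact Complex.ext e1 e2
    · have e1 := congrArg QuaternionAlgebra.imK h5
      have e2 := congrArg QuaternionAlgebra.imK h6
      simp at e1 e2
      exact Complex.ext e1 e2
  refine ⟨fun z => (stem f z).re, (isHolo_stem hs hf.1).re, fun q hq => ?_, key⟩
  rw [eq_phi_stem hs hr hf.1 hq, key _ (coord_mem_up hs hr hq), phi_coe]
  rfl

theorem scalarPart_apply (q : ℍ[ℝ]) : scalarPart f q = ev (fun z => (stem f z).re) q :=
  phi_coe _ _

theorem symmetrization_apply (hr : RealFree U) {q : ℍ[ℝ]} (hq : q ∈ U) :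
    symmetrization f q = ev (fun z => cnorm (stem f z)) q := by
  have hI := hr.imagUnit_mem hq
  simp only [symmetrization, component, induced, phi_coe, ev, cnorm, ← sliceHom_apply hI, map_add,
    map_pow]
  rfl

theorem re_add_im (w : ℍ[ℂ]) : ((w.re : ℂ) : ℍ[ℂ]) + w.im = w := Quaternion.re_add_im w

theorem vecPart_apply (hs : IsAxSymm U) (hr : RealFree U) (hf : IsSliceRegular U f) {q : ℍ[ℝ]}
    (hq : q ∈ U) : vecPart f q = induced (fun z => (stem f z).im) q := by
  rw [vecPart, eq_phi_stem hs hr hf hq, scalarPart_apply, ev, ← phi_coe, sub_eq_iff_eq_add',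
    induced]
  change _ = _ + phi _ (stem f (coord q)).im
  rw [← phi_add, re_add_im]

theorem IsHolo.im {D : Set ℂ} {F : ℂ → ℍ[ℂ]} (hF : IsHolo D F) : IsHolo D fun z => (F z).im :=
  ⟨by simp, by simpa using hF.imI, by simpa using hF.imJ, by simpa using hF.imK⟩

theorem isVectorial_of_eq_induced (hU : IsOpen U) (hs : IsAxSymm U) (hr : RealFree U)
    {F : ℂ → ℍ[ℂ]} (hF : IsHolo (up U) F) (hF0 : ∀ z ∈ up U, (F z).re = 0)
    (hf : ∀ q ∈ U, f q = induced F q) : IsVectorial U f := by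
  have hreg := isSliceRegular_of_eq_induced hU hs hr hF hf
  refine ⟨hreg, fun q hq => ?_⟩
  have hz := coord_mem_up hs hr hq
  rw [vecPart, scalarPart_apply, ev, stem_eq_of_eq_induced hs hr hf hz, hF0 _ hz]
  simp [slicePt]

theorem stem_vecPart (hs : IsAxSymm U) (hr : RealFree U) (hf : IsSliceRegular U f) {z : ℂ}
    (hz : z ∈ up U) : stem (vecPart f) z = (stem f z).im :=
  stem_eq_of_eq_induced hs hr (fun _ hq => vecPart_apply hs hr hf hq) hz

theorem isVectorial_vecPart (hU : IsOpen U) (hs : IsAxSymm U) (hr : RealFree U)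
    (hf : IsSliceRegular U f) : IsVectorial U (vecPart f) :=
  isVectorial_of_eq_induced hU hs hr (isHolo_stem hs hf).im (fun _ _ => by simp)
    fun _ hq => vecPart_apply hs hr hf hq

end SliceRegular

/-! ### Vectorial classes in terms of stem functions -/

section Classes

variable {U V : Set ℍ[ℝ]} {f g : ℍ[ℝ] → ℍ[ℝ]}

theorem mem_of_coord_mem_up (hs : IsAxSymm U) {q : ℍ[ℝ]} (h : coord q ∈ up U) : q ∈ U := by
  have h0 : q.im ≠ 0 := norm_pos_iff.1 h.1
  rw [← slicePt_coord h0]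
  exact slicePt_mem hs (imagUnit_mem h0) h

theorem eq_zero_iff_components (w : ℍ[ℂ]) :
    w = 0 ↔ w.re = 0 ∧ w.imI = 0 ∧ w.imJ = 0 ∧ w.imK = 0 := by
  constructor
  · rintro rfl
    exact ⟨rfl, rfl, rfl, rfl⟩
  · rintro ⟨h1, h2, h3, h4⟩
    ext
    exacts [h1, h2, h3, h4]

theorem IsHolo.eqOn_zero {D : Set ℂ} (hD : IsOpen D) (hc : IsPreconnected D) {F : ℂ → ℍ[ℂ]}
    (hF : IsHolo D F) {z : ℂ} (hz : z ∈ D) (h : ∀ᶠ x in 𝓝 z, F x = 0) : ∀ x ∈ D, F x = 0 := by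
  intro x hx
  simp only [eq_zero_iff_components] at h ⊢
  exact ⟨eqOn_zero_of_eventually hD hc hF.re hz (h.mono fun _ h => h.1) x hx,
    eqOn_zero_of_eventually hD hc hF.imI hz (h.mono fun _ h => h.2.1) x hx,
    eqOn_zero_of_eventually hD hc hF.imJ hz (h.mono fun _ h => h.2.2.1) x hx,
    eqOn_zero_of_eventually hD hc hF.imK hz (h.mono fun _ h => h.2.2.2) x hx⟩

theorem IsHolo.eqOn_zero_of_coe_mul {D : Set ℂ} (hD : IsOpen D) (hc : IsPreconnected D)
    {F : ℂ → ℍ[ℂ]} (hF : IsHolo D F) {a : ℂ → ℂ} (ha : DifferentiableOn ℂ a D)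
    (ha0 : ∃ z ∈ D, a z ≠ 0) (h : ∀ x ∈ D, ((a x : ℂ) : ℍ[ℂ]) * F x = 0) : ∀ x ∈ D, F x = 0 := by
  obtain ⟨z, hz, hz0⟩ := ha0
  have key : ∀ c : ℂ → ℂ, DifferentiableOn ℂ c D → (∀ x ∈ D, a x * c x = 0) →
      ∀ x ∈ D, c x = 0 := fun c hcd hac =>
    (eqOn_zero_or_of_mul_eq_zero hD hc ha hcd hac).resolve_left fun h => hz0 (h z hz)
  simp only [eq_zero_iff_components, Quaternion.coe_mul_eq_smul, Quaternion.re_smul,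
    Quaternion.imI_smul, Quaternion.imJ_smul, Quaternion.imK_smul, smul_eq_mul] at h ⊢
  exact fun x hx => ⟨key _ hF.re (fun x hx => (h x hx).1) x hx,
    key _ hF.imI (fun x hx => (h x hx).2.1) x hx, key _ hF.imJ (fun x hx => (h x hx).2.2.1) x hx,
    key _ hF.imK (fun x hx => (h x hx).2.2.2) x hx⟩

theorem linear_relation_iff (hs : IsAxSymm V) (hr : RealFree V) (hf : IsSliceRegular V f)
    (hg : IsSliceRegular V g) (a b : ℂ → ℂ) :
    (∀ q ∈ V, ev a q * f q + ev b q * g q = 0) ↔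
      ∀ z ∈ up V, ((a z : ℂ) : ℍ[ℂ]) * stem f z + ((b z : ℂ) : ℍ[ℂ]) * stem g z = 0 := by
  have e : ∀ q ∈ V, ev a q * f q + ev b q * g q = phi (imagUnit q)
      (((a (coord q) : ℂ) : ℍ[ℂ]) * stem f (coord q)
        + ((b (coord q) : ℂ) : ℍ[ℂ]) * stem g (coord q)) := fun q hq => by
    rw [phi_add, phi_coe_mul (hr.imagUnit_mem hq), phi_coe_mul (hr.imagUnit_mem hq),
      eq_phi_stem hs hr hf hq, eq_phi_stem hs hr hg hq, ev, ev]
  constructor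
  · intro h z hz
    refine eq_zero_of_phi_eq_zero fun I hI => ?_
    have h1 := e _ (slicePt_mem hs hI hz)
    rw [h _ (slicePt_mem hs hI hz), imagUnit_slicePt_of_pos hI hz.1,
      coord_slicePt_of_pos hI hz.1] at h1
    exact h1.symm
  · intro h q hq
    rw [e q hq, h _ (coord_mem_up hs hr hq), phi_zero]

theorem exists_ev_ne_zero_iff (hs : IsAxSymm V) (hr : RealFree V) (a : ℂ → ℂ) :
    (∃ q ∈ V, ev a q ≠ 0) ↔ ∃ z ∈ up V, a z ≠ 0 := by
  constructor
  · rintro ⟨q, hq, h⟩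
    refine ⟨coord q, coord_mem_up hs hr hq, fun h0 => h ?_⟩
    rw [ev, h0]
    simp [slicePt]
  · rintro ⟨z, hz, h⟩
    refine ⟨slicePt unitI z, hz.2, fun h0 => h ?_⟩
    rw [ev, imagUnit_slicePt_of_pos unitI_mem hz.1, coord_slicePt_of_pos unitI_mem hz.1,
      ← sliceHom_apply unitI_mem, ← map_zero (sliceHom unitI_mem)] at h0
    exact sliceHom_injective unitI_mem h0

/-- Linear dependence of slice regular functions in terms of their stem functions. -/
theorem LinDep.exists_stem (hs : IsAxSymm V) (hr : RealFree V) (hf : IsSliceRegular V f)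
    (hg : IsSliceRegular V g) (h : LinDep V f g) :
    ∃ a b : ℂ → ℂ, DifferentiableOn ℂ a (up V) ∧ DifferentiableOn ℂ b (up V) ∧
      ((∃ z ∈ up V, a z ≠ 0) ∨ ∃ z ∈ up V, b z ≠ 0) ∧
      ∀ z ∈ up V, ((a z : ℂ) : ℍ[ℂ]) * stem f z + ((b z : ℂ) : ℍ[ℂ]) * stem g z = 0 := by
  obtain ⟨a', b', ha', hb', hne, hrel⟩ := h
  obtain ⟨a, ha, haa, -⟩ := ha'.exists_ev hs hr
  obtain ⟨b, hb, hbb, -⟩ := hb'.exists_ev hs hr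
  refine ⟨a, b, ha, hb, ?_, (linear_relation_iff hs hr hf hg a b).1 fun q hq => ?_⟩
  · rw [← exists_ev_ne_zero_iff hs hr, ← exists_ev_ne_zero_iff hs hr]
    exact hne.imp (fun ⟨q, hq, h⟩ => ⟨q, hq, by rwa [← haa q hq]⟩)
      fun ⟨q, hq, h⟩ => ⟨q, hq, by rwa [← hbb q hq]⟩
  · rw [← haa q hq, ← hbb q hq, hrel q hq]

theorem LinDep.of_stem (hV : IsOpen V) (hs : IsAxSymm V) (hr : RealFree V)
    (hf : IsSliceRegular V f) (hg : IsSliceRegular V g) {a b : ℂ → ℂ}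
    (ha : DifferentiableOn ℂ a (up V)) (hb : DifferentiableOn ℂ b (up V))
    (hne : (∃ z ∈ up V, a z ≠ 0) ∨ ∃ z ∈ up V, b z ≠ 0)
    (h : ∀ z ∈ up V, ((a z : ℂ) : ℍ[ℂ]) * stem f z + ((b z : ℂ) : ℍ[ℂ]) * stem g z = 0) :
    LinDep V f g :=
  ⟨ev a, ev b, isSRReal_of_eq_ev hV hs hr ha fun _ _ => rfl,
    isSRReal_of_eq_ev hV hs hr hb fun _ _ => rfl, by
      rwa [exists_ev_ne_zero_iff hs hr, exists_ev_ne_zero_iff hs hr],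
    (linear_relation_iff hs hr hf hg a b).2 h⟩

/-- The identity theorem, used to carry the convention on the zero function in `EquivAt` to smaller
domains. -/
theorem forall_eq_zero_congr {W R : Set ℍ[ℝ]} (hW : IsAxSymmDomain W) (hr : RealFree W)
    (hR : IsOpen R) (hRs : IsAxSymm R) (hRW : R ⊆ W) (hne : (up R).Nonempty)
    (hf : IsSliceRegular W f) : (∀ q ∈ R, f q = 0) ↔ ∀ q ∈ W, f q = 0 := by
  refine ⟨fun h => ?_, fun h q hq => h q (hRW hq)⟩
  rw [forall_eq_zero_iff hRs (hr.mono hRW) (hf.mono hRW)] at h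
  rw [forall_eq_zero_iff hW.axSymm hr hf]
  obtain ⟨z, hz⟩ := hne
  exact (isHolo_stem hW.axSymm hf).eqOn_zero (isOpen_up hW.isOpen) (isPreconnected_up hW hr)
    (up_mono hRW hz) (Filter.mem_of_superset ((isOpen_up hR).mem_nhds hz) h)

/-- A vectorial class is closed under division by slice preserving functions. -/
theorem mem_cls_of_eq_mul {Ω : Set ℍ[ℝ]} (hr : RealFree Ω) (ω : VectorialClass Ω) {p : ℍ[ℝ]}
    (hp : p ∈ Ω) {u v : LocalFun} (hu : u ∈ ω.cls p) (huΩ : u.dom ⊆ Ω) (hv : IsLocalVec p v)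
    (hvΩ : v.dom ⊆ Ω) {a : ℂ → ℂ} (ha : AnalyticAt ℂ a (coord p))
    (ha0 : ¬∀ᶠ z in 𝓝 (coord p), a z = 0)
    (h : ∀ᶠ z in 𝓝 (coord p), stem u.toFun z = ((a z : ℂ) : ℍ[ℂ]) * stem v.toFun z) :
    v ∈ ω.cls p := by
  obtain ⟨t, ht, hcls⟩ := ω.isClass p hp
  rw [hcls] at hu ⊢
  obtain ⟨hu1, W, hW, hpW, hWsub, hdep, hiff⟩ := hu
  have hWt : W ⊆ t.dom := fun q hq => (hWsub hq).1
  have hWu : W ⊆ u.dom := fun q hq => (hWsub hq).2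
  have hrW : RealFree W := hr.mono (hWu.trans huΩ)
  have hrv : RealFree v.dom := hr.mono hvΩ
  have htW : IsSliceRegular W t.toFun := ht.vectorial.1.mono hWt
  have huW : IsSliceRegular W u.toFun := hu1.vectorial.1.mono hWu
  obtain ⟨α, β, hα, hβ, hne, hrel⟩ := hdep.exists_stem hW.axSymm hrW htW huW
  have hpup := coord_mem_up hW.axSymm hrW hpW
  have hpv := coord_mem_up hv.domain.axSymm hrv hv.mem
  obtain ⟨ε, hε, hball⟩ := Metric.eventually_nhds_iff_ball.1
    ((h.and ha.eventually_analyticAt).and (((isOpen_up hW.isOpen).eventually_mem hpup).and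
      ((isOpen_up hv.domain.isOpen).eventually_mem hpv)))
  set B := ball (coord p) ε with hB
  have hBW : B ⊆ up W := fun z hz => (hball z hz).2.1
  have hBv : B ⊆ up v.dom := fun z hz => (hball z hz).2.2
  have hBpos : ∀ z ∈ B, 0 < z.im := fun z hz => (hBW hz).1
  have haB : DifferentiableOn ℂ a B := fun z hz =>
    (hball z hz).1.2.differentiableAt.differentiableWithinAt
  have hBc : IsPreconnected B := (convex_ball _ _).isPreconnected
  have hpB : coord p ∈ B := mem_ball_self hε
  have hdom := isAxSymmDomain_rot hBpos isOpen_ball hBc ⟨_, hpB⟩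
  have hRW : rot B ⊆ W := fun q hq => mem_of_coord_mem_up hW.axSymm (hBW hq)
  have hRv : rot B ⊆ v.dom := fun q hq => mem_of_coord_mem_up hv.domain.axSymm (hBv hq)
  have hup : up (rot B) = B := up_rot hBpos
  have hrR := realFree_rot hBpos
  have htR := htW.mono hRW
  have huR := huW.mono hRW
  have hvR := hv.vectorial.1.mono hRv
  have hvB : IsHolo B (stem v.toFun) := by
    have := isHolo_stem hdom.axSymm hvR
    rwa [hup] at this
  have haB0 : ∃ z ∈ B, a z ≠ 0 := by
    by_contra hcon
    push Not at hcon
    exact ha0 (Filter.mem_of_superset (ball_mem_nhds _ hε) hcon)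
  have hres : ∀ c : ℂ → ℂ, DifferentiableOn ℂ c (up W) → (∃ z ∈ up W, c z ≠ 0) →
      ∃ z ∈ B, c z ≠ 0 := by
    rintro c hc ⟨z, hz, hz0⟩
    by_contra hcon
    push Not at hcon
    exact hz0 (eqOn_zero_of_eventually (isOpen_up hW.isOpen) (isPreconnected_up hW hrW) hc hpup
      (Filter.mem_of_superset (ball_mem_nhds _ hε) hcon) z hz)
  refine ⟨hv, rot B, hdom, hpB, fun q hq => ⟨hWt (hRW hq), hRv hq⟩, ?_, ?_⟩
  -- Substituting u = av into αt + βu = 0 gives αt + (βa)v = 0. The relation stays nontrivial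
  -- because neither `β` (if nonzero) nor `a` vanishes identically on the ball.
  · refine LinDep.of_stem hdom.isOpen hdom.axSymm hrR htR hvR (a := α) (b := fun z => β z * a z)
      ?_ ?_ ?_ ?_ <;> rw [hup]
    · exact hα.mono hBW
    · exact (hβ.mono hBW).mul haB
    · refine hne.imp (hres α hα) fun h => ?_
      by_contra hcon
      push Not at hcon
      obtain ⟨y, hy, hy0⟩ := hres β hβ h
      obtain ⟨x, hx, hx0⟩ := haB0
      rcases eqOn_zero_or_of_mul_eq_zero isOpen_ball hBc (hβ.mono hBW) haB hcon with h' | h'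
      · exact hy0 (h' y hy)
      · exact hx0 (h' x hx)
    · intro z hz
      have h1 := hrel z (hBW hz)
      rw [(hball z hz).1.1, ← mul_assoc, ← Quaternion.coe_mul] at h1
      exact h1
  · have hneR : (up (rot B)).Nonempty := by rw [hup]; exact ⟨_, hpB⟩
    rw [forall_eq_zero_congr hW hrW hdom.isOpen hdom.axSymm hRW hneR htW, hiff,
      ← forall_eq_zero_congr hW hrW hdom.isOpen hdom.axSymm hRW hneR huW,
      forall_eq_zero_iff hdom.axSymm hrR huR, forall_eq_zero_iff hdom.axSymm hrR hvR, hup]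
    constructor
    · intro h0
      exact hvB.eqOn_zero_of_coe_mul isOpen_ball hBc haB haB0 fun z hz => by
        rw [← (hball z hz).1.1, h0 z hz]
    · intro h0 z hz
      rw [(hball z hz).1.1, h0 z hz, mul_zero]

/-- A neighbourhood of `p` need not contain whole spheres, but it meets the nearby ones in at least
two points: the units have no isolated point. Two equations a + Ib = a + Jb = 0 with I ≠ J force a =
b = 0. -/
theorem eventually_stem_eq_zero (hU : IsOpen U) (hs : IsAxSymm U) (hr : RealFree U)
    (hf : IsSliceRegular U f) {p : ℍ[ℝ]} (hp : p ∈ U) (h : ∀ᶠ q in 𝓝 p, f q = 0) :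
    ∀ᶠ z in 𝓝 (coord p), stem f z = 0 := by
  have h0 := hr.im_ne_zero hp
  have hI := imagUnit_mem h0
  have hc : Continuous fun x : ℂ × ℍ[ℝ] => slicePt x.2 x.1 :=
    (Quaternion.continuous_coe.comp (Complex.continuous_re.comp continuous_fst)).add
      (continuous_snd.mul (Quaternion.continuous_coe.comp (Complex.continuous_im.comp
        continuous_fst)))
  have h1 : ∀ᶠ x in 𝓝 (coord p, imagUnit p), f (slicePt x.2 x.1) = 0 := by
    refine (hc.tendsto (coord p, imagUnit p)).eventually (p := fun q => f q = 0) ?_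
    rwa [slicePt_coord h0]
  rw [nhds_prod_eq, Filter.eventually_prod_iff] at h1
  obtain ⟨P, hP, Q, hQ, hPQ⟩ := h1
  have hnt : imagUnits.Nontrivial := ⟨unitI, unitI_mem, -unitI, neg_mem_imagUnits unitI_mem, by
    intro h
    have h2 := congrArg QuaternionAlgebra.imI h
    change (1 : ℝ) = -1 at h2
    norm_num at h2⟩
  obtain ⟨J, ⟨hQJ, hJ⟩, hne⟩ := accPt_iff_nhds.1
    (isPreconnected_imagUnits.preperfect_of_nontrivial hnt _ hI) _ hQ
  filter_upwards [hP, (isOpen_up hU).mem_nhds (coord_mem_up hs hr hp)] with z hz hzU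
  have e1 := hPQ hz hQ.self_of_nhds
  have e2 := hPQ hz hQJ
  simp only at e1 e2
  rw [eq_phi_stem_slicePt hs hr hf hI hzU, phi] at e1
  rw [eq_phi_stem_slicePt hs hr hf hJ hzU, phi] at e2
  have e3 : (J - imagUnit p) * imHC (stem f z) = 0 := by
    rw [sub_mul, sub_eq_zero]
    exact add_left_cancel (e2.trans e1.symm)
  have e4 := (mul_eq_zero.1 e3).resolve_left (sub_ne_zero.2 hne)
  rw [e4, mul_zero, add_zero] at e1
  exact eq_zero_of_reHC_imHC e1 e4

end Classes

/-! ### Minimal representatives and the zeros of the vectorial part -/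

section Minimal

variable {Ω : Set ℍ[ℝ]} {g : ℍ[ℝ] → ℍ[ℝ]}

/-- Division of a vector of holomorphic functions by the highest possible power of `z - w`. -/
theorem exists_eq_pow_mul {D : Set ℂ} (hD : IsOpen D) {V : ℂ → ℍ[ℂ]} (hV : IsHolo D V)
    (hV0 : ∀ z ∈ D, (V z).re = 0) {w : ℂ} (hw : w ∈ D) (hne : ¬∀ᶠ z in 𝓝 w, V z = 0) :
    ∃ (n : ℕ) (v : ℂ → ℍ[ℂ]) (ε : ℝ), 0 < ε ∧ ball w ε ⊆ D ∧ IsHolo (ball w ε) v ∧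
      (∀ z ∈ ball w ε, (v z).re = 0 ∧ v z ≠ 0 ∧
        V z = (((z - w) ^ n : ℂ) : ℍ[ℂ]) * v z) := by
  let Φ : ℂ → Fin 3 → ℂ := fun z => ![(V z).imI, (V z).imJ, (V z).imK]
  have hΦ : AnalyticAt ℂ Φ w := by
    rw [analyticAt_pi_iff]
    intro i
    fin_cases i
    · exact hV.imI.analyticOnNhd hD w hw
    · exact hV.imJ.analyticOnNhd hD w hw
    · exact hV.imK.analyticOnNhd hD w hw
  have hΦ0 : ¬∀ᶠ z in 𝓝 w, Φ z = 0 := by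
    refine fun h => hne ?_
    filter_upwards [h, hD.eventually_mem hw] with z hz hzD
    rw [eq_zero_iff_components]
    exact ⟨hV0 z hzD, congrFun hz 0, congrFun hz 1, congrFun hz 2⟩
  obtain ⟨n, γ, hγ, hγ0, hγe⟩ := hΦ.exists_eventuallyEq_pow_smul_nonzero_iff.2 hΦ0
  obtain ⟨ε, hε, hb⟩ := Metric.eventually_nhds_iff_ball.1
    (((hD.eventually_mem hw).and hγ.eventually_analyticAt).and
      ((hγ.continuousAt.eventually_ne hγ0).and hγe))
  have hd : ∀ i, DifferentiableOn ℂ (fun z => γ z i) (ball w ε) := fun i z hz =>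
    ((analyticAt_pi_iff.1 (hb z hz).1.2) i).differentiableAt.differentiableWithinAt
  obtain ⟨v, hv⟩ : ∃ v : ℂ → ℍ[ℂ], ∀ z, (v z).re = 0 ∧ (v z).imI = γ z 0 ∧ (v z).imJ = γ z 1 ∧
      (v z).imK = γ z 2 := ⟨fun z => ⟨0, γ z 0, γ z 1, γ z 2⟩, fun z => ⟨rfl, rfl, rfl, rfl⟩⟩
  refine ⟨n, v, ε, hε, fun z hz => (hb z hz).1.1,
    ⟨(differentiableOn_const 0).congr fun z _ => (hv z).1, (hd 0).congr fun z _ => (hv z).2.1,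
      (hd 1).congr fun z _ => (hv z).2.2.1, (hd 2).congr fun z _ => (hv z).2.2.2⟩,
    fun z hz => ⟨(hv z).1, fun h => ?_, ?_⟩⟩
  · rw [eq_zero_iff_components, (hv z).2.1, (hv z).2.2.1, (hv z).2.2.2] at h
    refine (hb z hz).2.1 (funext fun i => ?_)
    fin_cases i
    exacts [h.2.1, h.2.2.1, h.2.2.2]
  · have h := (hb z hz).2.2
    obtain ⟨h0, h1, h2, h3⟩ := hv z
    rw [Quaternion.coe_mul_eq_smul]
    ext
    · simpa [h0] using hV0 z (hb z hz).1.1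
    · simpa [Φ, h1] using congrFun h 0
    · simpa [Φ, h2] using congrFun h 1
    · simpa [Φ, h3] using congrFun h 2

/-- The germs of a nonzero vectorial part represent the class everywhere. -/
theorem vecPart_mem_cls (hΩ : IsAxSymmDomain Ω) (hr : RealFree Ω) (ω : VectorialClass Ω)
    (hg : ω.IsSR g) (hne : ∃ z ∈ up Ω, (stem g z).im ≠ 0) {p : ℍ[ℝ]} (hp : p ∈ Ω) :
    (⟨Ω, vecPart g⟩ : LocalFun) ∈ ω.cls p := by
  refine (hg.2 p hp).resolve_left fun h => ?_
  obtain ⟨z, hz, hz0⟩ := hne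
  refine hz0 ?_
  have h1 := eventually_stem_eq_zero hΩ.isOpen hΩ.axSymm hr
    (isVectorial_vecPart hΩ.isOpen hΩ.axSymm hr hg.1).1 hp h
  rw [← stem_vecPart hΩ.axSymm hr hg.1 hz]
  exact (isHolo_stem hΩ.axSymm (isVectorial_vecPart hΩ.isOpen hΩ.axSymm hr hg.1).1).eqOn_zero
    (isOpen_up hΩ.isOpen) (isPreconnected_up hΩ hr) (coord_mem_up hΩ.axSymm hr hp) h1 z hz

/-- Away from the zeros of the class, the vectorial part of `g` is locally the product of a
power of `z - w` and a function with nonvanishing symmetrization. -/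
theorem exists_local_minimal (hΩ : IsAxSymmDomain Ω) (hr : RealFree Ω) (ω : VectorialClass Ω)
    (hg : ω.IsSR g) (hne : ∃ z ∈ up Ω, (stem g z).im ≠ 0) {w : ℂ} (hw : w ∈ up Ω) :
    ∃ (n : ℕ) (v : ℂ → ℍ[ℂ]) (ε : ℝ), 0 < ε ∧ ball w ε ⊆ up Ω ∧ IsHolo (ball w ε) v ∧
      (∀ z ∈ ball w ε, (stem g z).im = (((z - w) ^ n : ℂ) : ℍ[ℂ]) * v z) ∧
      (cnorm (v w) = 0 → ∃ I ∈ imagUnits, slicePt I w ∈ ω.zeroSet) := by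
  have hDo := isOpen_up hΩ.isOpen
  have hH := (isHolo_stem hΩ.axSymm hg.1).im
  obtain ⟨n, v, ε, hε, hB, hv, hvB⟩ := exists_eq_pow_mul hDo hH (fun _ _ => by simp) hw
    (fun h => by
      obtain ⟨z, hz, hz0⟩ := hne
      exact hz0 (hH.eqOn_zero hDo (isPreconnected_up hΩ hr) hw h z hz))
  refine ⟨n, v, ε, hε, hB, hv, fun z hz => (hvB z hz).2.2, fun hN => ?_⟩
  have hwB : w ∈ ball w ε := mem_ball_self hε
  have hpos : ∀ z ∈ ball w ε, 0 < z.im := fun z hz => (hB hz).1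
  have hdom := isAxSymmDomain_rot hpos isOpen_ball (convex_ball _ _).isPreconnected ⟨w, hwB⟩
  have hup := up_rot hpos
  have hrR := realFree_rot hpos
  have hsub : rot (ball w ε) ⊆ Ω := fun q hq => mem_of_coord_mem_up hΩ.axSymm (hB hq)
  have hvec : IsVectorial (rot (ball w ε)) (induced v) :=
    isVectorial_of_eq_induced hdom.isOpen hdom.axSymm hrR (by rwa [hup])
      (fun z hz => (hvB z (by rwa [hup] at hz)).1) fun _ _ => rfl
  have hstem : ∀ z ∈ ball w ε, stem (induced v) z = v z := fun z hz =>
    stem_eq_of_eq_induced hdom.axSymm hrR (fun _ _ => rfl) (by rwa [hup])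
  -- Dividing by (z - w)^n stays in the class, and `v` vanishes nowhere on the ball, so there are no
  -- spherical zeros. Isotropy of `v w` then produces an actual zero on the sphere.
  have hmin : ω.IsMinimal ⟨rot (ball w ε), induced v⟩ := by
    refine ⟨hdom, hsub, fun p hp => ?_, fun p hp => ?_⟩
    · have ha : Differentiable ℂ fun z : ℂ => (z - w) ^ n := by fun_prop
      refine mem_cls_of_eq_mul hr ω (hsub hp)
        (vecPart_mem_cls hΩ hr ω hg hne (hsub hp)) Subset.rfl ⟨hdom, hp, hvec⟩ hsub
        (a := fun z => (z - w) ^ n) (ha.analyticAt _) (fun h => ?_) ?_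
      · have h1 := (eventually_ne_zero isOpen_univ isPreconnected_univ ha.differentiableOn
          ⟨w + 1, mem_univ _, by simp⟩ (mem_univ (coord p)))
        obtain ⟨x, hx, hx'⟩ := (h1.and (nhdsWithin_le_nhds h)).exists
        exact hx hx'
      · filter_upwards [isOpen_ball.eventually_mem hp] with z hz
        rw [hstem z hz, stem_vecPart hΩ.axSymm hr hg.1 (hB hz), (hvB z hz).2.2]
    · have h0 := (hvB _ hp).2.1
      by_contra hcon
      push Not at hcon
      refine h0 (eq_zero_of_phi_eq_zero fun I hI => ?_)
      have h1 := hcon _ (slicePt_mem_sphereOf (q := p) hI)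
      simp only [induced] at h1
      rwa [imagUnit_slicePt_of_pos hI (hpos _ hp),
        show (⟨(slicePt I (coord p)).re, ‖(slicePt I (coord p)).im‖⟩ : ℂ) = coord p from
          coord_slicePt_of_pos hI (hpos _ hp)] at h1
  obtain ⟨I, hI, hIv⟩ := (exists_phi_eq_zero_iff _).2 hN
  refine ⟨I, hI, _, hmin, ?_, ?_⟩
  · change coord _ ∈ ball w ε
    rwa [coord_slicePt_of_pos hI (hpos w hwB)]
  · change phi (imagUnit (slicePt I w)) (v (coord (slicePt I w))) = 0
    rwa [coord_slicePt_of_pos hI (hpos w hwB), imagUnit_slicePt_of_pos hI (hpos w hwB)]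

/-- The symmetrization of the vectorial part of `g` vanishes at the zeros of the class. -/
theorem cnorm_im_stem_eq_zero (hΩ : IsAxSymmDomain Ω) (hr : RealFree Ω) (ω : VectorialClass Ω)
    (hg : ω.IsSR g) {z₀ : ℍ[ℝ]} (hz₀ : z₀ ∈ ω.zeroSet) :
    cnorm (stem g (coord z₀)).im = 0 := by
  by_cases hne : ∃ z ∈ up Ω, (stem g z).im ≠ 0
  swap
  · push Not at hne
    obtain ⟨u, hu, hzu, -⟩ := hz₀
    rw [hne _ (coord_mem_up hΩ.axSymm hr (hu.subset hzu))]
    simp [cnorm]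
  obtain ⟨u, hu, hzu, hu0⟩ := hz₀
  have hzΩ := hu.subset hzu
  obtain ⟨W, hW, hzW, hWsub, hdep, -⟩ := ω.compat z₀ hzΩ z₀ hzΩ _ (hu.mem_cls z₀ hzu) _
    (vecPart_mem_cls hΩ hr ω hg hne hzΩ) hu.subset Subset.rfl z₀ ⟨hzu, hzΩ⟩
  have hWΩ : W ⊆ Ω := fun q hq => (hWsub hq).2
  have hrW := hr.mono hWΩ
  have hWu : W ⊆ u.dom := fun q hq => (hWsub hq).1
  have hureg : IsSliceRegular u.dom u.toFun := by
    obtain ⟨t, -, hcls⟩ := ω.isClass z₀ hzΩ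
    have := hu.mem_cls z₀ hzu
    rw [hcls] at this
    exact this.1.vectorial.1
  have hvreg := isVectorial_vecPart hΩ.isOpen hΩ.axSymm hr hg.1
  obtain ⟨a, b, ha, hb, hab, hrel⟩ := hdep.exists_stem hW.axSymm hrW (hureg.mono hWu)
    (hvreg.1.mono hWΩ)
  have hwW := coord_mem_up hW.axSymm hrW hzW
  set w := coord z₀ with hw
  have hDo := isOpen_up hW.isOpen
  have hDc := isPreconnected_up hW hrW
  have hzim := hr.im_ne_zero hzΩ
  -- the minimal representative at `w`
  have hUw : stem u.toFun w ≠ 0 := by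
    intro h0
    obtain ⟨q, hq, hq0⟩ := hu.no_sphere z₀ hzu
    have hc := coord_eq_of_mem_sphereOf hq
    have hqu : q ∈ u.dom := by
      refine mem_of_coord_mem_up hu.domain.axSymm ?_
      rw [hc]
      exact up_mono hWu hwW
    refine hq0 ?_
    rw [eq_phi_stem hu.domain.axSymm (hr.mono hu.subset) hureg hqu, hc, h0, phi_zero]
  have hUN : cnorm (stem u.toFun w) = 0 := by
    rw [← exists_phi_eq_zero_iff]
    refine ⟨imagUnit z₀, imagUnit_mem hzim, ?_⟩
    rw [hw, ← eq_phi_stem hu.domain.axSymm (hr.mono hu.subset) hureg hzu, hu0]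
  have hUH : IsHolo (up W) (stem u.toFun) :=
    (isHolo_stem hu.domain.axSymm hureg).mono (up_mono hWu)
  have hVH : IsHolo (up W) fun z => (stem g z).im :=
    ((isHolo_stem hΩ.axSymm hg.1).im).mono (up_mono hWΩ)
  have hrel' : ∀ z ∈ up W, ((b z : ℂ) : ℍ[ℂ]) * (stem g z).im
      = ((-a z : ℂ) : ℍ[ℂ]) * stem u.toFun z := fun z hz => by
    have := hrel z hz
    rw [stem_vecPart hΩ.axSymm hr hg.1 (up_mono hWΩ hz)] at this
    rw [Quaternion.coe_neg, neg_mul]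
    exact eq_neg_of_add_eq_zero_right this
  have hb0 : ∃ z ∈ up W, b z ≠ 0 := by
    by_contra hcon
    push Not at hcon
    have ha0 : ∃ z ∈ up W, a z ≠ 0 := hab.resolve_right fun ⟨z, hz, h⟩ => h (hcon z hz)
    refine hUw (hUH.eqOn_zero_of_coe_mul hDo hDc ha ha0 (fun z hz => ?_) w hwW)
    have := hrel z hz
    rwa [hcon z hz, Quaternion.coe_zero, zero_mul, add_zero] at this
  have hbne := eventually_ne_zero hDo hDc hb hb0 hwW
  -- a component `c` with `c (U w) ≠ 0` yields `(c U) V = (c V) U`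
  have key : ∀ c : ℍ[ℂ] → ℂ, (∀ (x : ℂ) (y : ℍ[ℂ]), c ((x : ℍ[ℂ]) * y) = x * c y) →
      DifferentiableOn ℂ (fun z => c (stem u.toFun z)) (up W) →
      DifferentiableOn ℂ (fun z => c (stem g z).im) (up W) → c (stem u.toFun w) ≠ 0 →
      cnorm (stem g w).im = 0 := by
    intro c hc hcU hcV hcw
    have hN : ∀ F : ℂ → ℍ[ℂ], IsHolo (up W) F → DifferentiableOn ℂ (fun z => cnorm (F z)) (up W) :=
      fun F hF => (((hF.re.pow 2).add (hF.imI.pow 2)).add (hF.imJ.pow 2)).add (hF.imK.pow 2)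
    -- V and U are proportional, so `cnorm` scales by the square of the ratio cV/cU. After
    -- cancelling `b ^ 2` off its zeros, continuity carries the identity to `w`, where `cnorm U`
    -- vanishes and `c U` does not.
    have h1 : ∀ᶠ z in 𝓝[≠] w, c (stem u.toFun z) ^ 2 * cnorm (stem g z).im
        = c (stem g z).im ^ 2 * cnorm (stem u.toFun z) := by
      filter_upwards [hbne, nhdsWithin_le_nhds (hDo.eventually_mem hwW)] with z hz hzW
      have e1 := congrArg c (hrel' z hzW)
      have e2 := congrArg cnorm (hrel' z hzW)
      rw [hc, hc] at e1
      rw [cnorm_coe_mul, cnorm_coe_mul] at e2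
      refine mul_left_cancel₀ (pow_ne_zero 2 hz) ?_
      linear_combination c (stem u.toFun z) ^ 2 * e2
        - (b z * c (stem g z).im - a z * c (stem u.toFun z)) * cnorm (stem u.toFun z) * e1
    have hcont : ∀ F : ℂ → ℂ, DifferentiableOn ℂ F (up W) → ContinuousAt F w := fun F hF =>
      (hF.differentiableAt (hDo.mem_nhds hwW)).continuousAt
    have h2 := ((((hcont _ hcU).pow 2).mul (hcont _ (hN _ hVH))).eventuallyEq_nhds_iff_eventuallyEq_nhdsNE
      (((hcont _ hcV).pow 2).mul (hcont _ (hN _ hUH)))).1 h1 |>.self_of_nhds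
    have h3 : c (stem u.toFun w) ^ 2 * cnorm (stem g w).im
        = c (stem g w).im ^ 2 * cnorm (stem u.toFun w) := h2
    rw [hUN, mul_zero] at h3
    exact (mul_eq_zero.1 h3).resolve_left (pow_ne_zero 2 hcw)
  have hsm : ∀ (x : ℂ) (y : ℍ[ℂ]), (x : ℍ[ℂ]) * y = x • y := fun x y =>
    Quaternion.coe_mul_eq_smul x y
  by_contra hcon
  refine hUw ((eq_zero_iff_components _).2 ⟨?_, ?_, ?_, ?_⟩) <;> by_contra h0
  · exact hcon (key (fun y => y.re) (fun x y => by rw [hsm]; simp) hUH.re hVH.re h0)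
  · exact hcon (key (fun y => y.imI) (fun x y => by rw [hsm]; simp) hUH.imI hVH.imI h0)
  · exact hcon (key (fun y => y.imJ) (fun x y => by rw [hsm]; simp) hUH.imJ hVH.imJ h0)
  · exact hcon (key (fun y => y.imK) (fun x y => by rw [hsm]; simp) hUH.imK hVH.imK h0)

end Minimal

/-! ### The `*`-exponential -/

section StarExp

theorem hasSum_exp (a : ℂ) : HasSum (fun n : ℕ => ((n.factorial : ℝ)⁻¹) • a ^ n) (Complex.exp a) := by
  have h := NormedSpace.expSeries_div_hasSum_exp a
  rw [← Complex.exp_eq_exp_ℂ] at h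
  refine h.congr_fun fun n => ?_
  rw [Complex.real_smul]
  push_cast
  field_simp

theorem mul_self_of_re_eq_zero {W : ℍ[ℂ]} (hW : W.re = 0) : W * W = ((-cnorm W : ℂ) : ℍ[ℂ]) := by
  obtain ⟨N, hN⟩ : ∃ N, N = cnorm W := ⟨_, rfl⟩
  rw [← hN]
  ext
  · have : N = W.imI ^ 2 + W.imJ ^ 2 + W.imK ^ 2 := by rw [hN]; simp [cnorm, hW]
    simp [hW]
    rw [this]
    ring
  · simp [hW]
    ring
  · simp [hW]
    ring
  · simp [hW]
    ring

/-- The powers of `α + W` for a vector `W` with `W * W = β ^ 2`. -/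
theorem coe_add_pow {W : ℍ[ℂ]} (hW : W.re = 0) {α : ℂ} {P Q : ℕ → ℂ} (hP0 : P 0 = 1)
    (hQ0 : Q 0 = 0) (hP : ∀ n, P (n + 1) = α * P n - cnorm W * Q n)
    (hQ : ∀ n, Q (n + 1) = P n + α * Q n) (n : ℕ) :
    ((α : ℍ[ℂ]) + W) ^ n = (P n : ℍ[ℂ]) + (Q n : ℍ[ℂ]) * W := by
  induction n with
  | zero => simp [hP0, hQ0]
  | succ n ih =>
    rw [pow_succ', ih, hP, hQ]
    have h1 : W * (P n : ℍ[ℂ]) = (P n : ℍ[ℂ]) * W := (Quaternion.coe_commutes _ _).symm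
    have h2 : W * ((Q n : ℍ[ℂ]) * W) = ((-(cnorm W * Q n) : ℂ) : ℍ[ℂ]) := by
      rw [← mul_assoc, ← Quaternion.coe_commutes, mul_assoc, mul_self_of_re_eq_zero hW,
        ← Quaternion.coe_mul]
      congr 1
      ring
    rw [add_mul, mul_add, mul_add, h1, h2, ← mul_assoc, ← Quaternion.coe_mul, ← Quaternion.coe_mul,
      sub_eq_add_neg, Quaternion.coe_add, Quaternion.coe_add, add_mul]
    abel

/-- Since W² = `-cnorm W` is a central scalar, powers of α + W stay in the span of 1 and W, and the
exponential reduces to two scalar series. -/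
theorem hasSum_phi_pow {I : ℍ[ℝ]} (hI : I ∈ imagUnits) {W : ℍ[ℂ]} (hW : W.re = 0) (α : ℂ) :
    HasSum (fun n : ℕ => ((n.factorial : ℝ)⁻¹) • phi I (((α : ℍ[ℂ]) + W) ^ n))
      (slicePt I (Complex.exp α * muC (cnorm W))
        + slicePt I (Complex.exp α * nuC (cnorm W)) * phi I W) := by
  suffices h : ∃ P Q : ℕ → ℂ, (∀ n, ((α : ℍ[ℂ]) + W) ^ n = (P n : ℍ[ℂ]) + (Q n : ℍ[ℂ]) * W) ∧
      HasSum (fun n : ℕ => ((n.factorial : ℝ)⁻¹) • P n) (Complex.exp α * muC (cnorm W)) ∧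
      HasSum (fun n : ℕ => ((n.factorial : ℝ)⁻¹) • Q n) (Complex.exp α * nuC (cnorm W)) by
    obtain ⟨P, Q, hPQ, hP, hQ⟩ := h
    have h1 := (hP.map (sliceHom hI) (continuous_sliceHom hI)).add
      ((hQ.map (sliceHom hI) (continuous_sliceHom hI)).mul_right (phi I W))
    simp only [sliceHom_apply] at h1
    convert h1 using 2 with n
    rw [hPQ, phi_add, phi_coe, phi_coe_mul hI, smul_add, Function.comp_apply, Function.comp_apply,
      map_smul, map_smul, sliceHom_apply, sliceHom_apply, smul_mul_assoc]
  obtain ⟨β, hβ⟩ := IsAlgClosed.exists_pow_nat_eq (-cnorm W) (n := 2) two_pos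
  have hc : cnorm W = -β ^ 2 := by rw [hβ, neg_neg]
  by_cases h0 : β = 0
  · rw [h0] at hc
    have hc0 : cnorm W = 0 := by rw [hc]; simp
    have hmu : muC (cnorm W) = 1 := by rw [hc, muC_neg_sq, Complex.cosh_zero]
    rw [hmu, hc0, nuC_zero, mul_one]
    -- Here W² = 0, so the coefficient of W is the derivative of α^n; at `n = 0` the factor `n`
    -- makes the truncated exponent irrelevant.
    refine ⟨fun n => α ^ n, fun n => n * α ^ (n - 1), coe_add_pow hW (by simp) (by simp) ?_ ?_,
      hasSum_exp α, ?_⟩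
    · intro n
      rw [hc0]; ring
    · intro n
      rcases n with - | n
      · simp
      · simp only [Nat.add_sub_cancel]
        push_cast
        ring
    · rw [← hasSum_nat_add_iff' 1]
      simp only [Finset.range_one, Finset.sum_singleton]
      have h1 := hasSum_exp α
      have e : (fun n : ℕ => (((n + 1).factorial : ℝ)⁻¹) • (((n + 1 : ℕ) : ℂ) * α ^ (n + 1 - 1)))
          = fun n : ℕ => ((n.factorial : ℝ)⁻¹) • α ^ n := by
        funext n
        rw [Nat.add_sub_cancel, Complex.real_smul, Complex.real_smul, Nat.factorial_succ]
        have h2 : ((n : ℂ) + 1) ≠ 0 := Nat.cast_add_one_ne_zero n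
        have h3 : (n.factorial : ℂ) ≠ 0 := by exact_mod_cast n.factorial_ne_zero
        push_cast
        field_simp
      rw [e]
      simpa using h1
  · have hnu : nuC (cnorm W) = Complex.sinh β / β := by
      rw [hc, ← mul_nuC_neg_sq, mul_div_cancel_left₀ _ h0]
    have hmu : muC (cnorm W) = Complex.cosh β := by rw [hc, muC_neg_sq]
    rw [hmu, hnu]
    have s1 := hasSum_exp (α + β)
    have s2 := hasSum_exp (α - β)
    -- With W² = β² ≠ 0 these are the parts of (α + W)^n even and odd in β, as for the eigenvalues α
    -- ± β.
    refine ⟨fun n => ((α + β) ^ n + (α - β) ^ n) / 2, fun n => ((α + β) ^ n - (α - β) ^ n) / (2 * β),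
      coe_add_pow hW (by simp) (by simp) ?_ ?_, ?_, ?_⟩
    · intro n
      rw [hc]
      field_simp
      ring
    · intro n
      field_simp
      ring
    · have h := (s1.add s2).div_const 2
      have e1 : (Complex.exp (α + β) + Complex.exp (α - β)) / 2
          = Complex.exp α * Complex.cosh β := by
        rw [Complex.cosh, Complex.exp_add, sub_eq_add_neg, Complex.exp_add]
        ring
      rw [e1] at h
      refine h.congr_fun fun n => ?_
      rw [← smul_add, smul_div_assoc]
    · have h := (s1.sub s2).div_const (2 * β)
      have e1 : (Complex.exp (α + β) - Complex.exp (α - β)) / (2 * β)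
          = Complex.exp α * (Complex.sinh β / β) := by
        rw [Complex.sinh, Complex.exp_add, sub_eq_add_neg α β, Complex.exp_add]
        field_simp
      rw [e1] at h
      refine h.congr_fun fun n => ?_
      rw [← smul_sub, smul_div_assoc]

theorem mu_slicePt {I : ℍ[ℝ]} (hI : I ∈ imagUnits) (c : ℂ) :
    mu (slicePt I c) = slicePt I (muC c) := by
  have h := ((summable_smul_pow_of_coeff_le norm_mu_coeff_le c).hasSum.map (sliceHom hI)
    (continuous_sliceHom hI)).tsum_eq
  rw [mu, muC, ← sliceHom_apply hI, ← sliceHom_apply hI, ← h]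
  exact tsum_congr fun m => by rw [Function.comp_apply, map_smul, map_pow]

theorem nu_slicePt {I : ℍ[ℝ]} (hI : I ∈ imagUnits) (c : ℂ) :
    nu (slicePt I c) = slicePt I (nuC c) := by
  have h := ((summable_smul_pow_of_coeff_le norm_nu_coeff_le c).hasSum.map (sliceHom hI)
    (continuous_sliceHom hI)).tsum_eq
  rw [nu, nuC, ← sliceHom_apply hI, ← sliceHom_apply hI, ← h]
  exact tsum_congr fun m => by rw [Function.comp_apply, map_smul, map_pow]

/-- In the lower half plane `imagUnit` becomes -I while arccos gives the absolute value of the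
argument, and the two signs cancel. On the positive axis both arguments are 0. -/
theorem qlog_slicePt {I : ℍ[ℝ]} (hI : I ∈ imagUnits) {c : ℂ} (hc : c ∈ Complex.slitPlane) :
    qlog (slicePt I c) = slicePt I (Complex.log c) := by
  have hn : ‖slicePt I c‖ = ‖c‖ := by
    have h1 : ‖slicePt I c‖ ^ 2 = ‖c‖ ^ 2 := by
      rw [pow_two, ← Quaternion.normSq_eq_norm_mul_self]
      have e : star (slicePt I c) = slicePt I (starRingEnd ℂ c) := by
        rw [← slicePt_neg]
        have hs : star I = -I := by ext <;> simp [re_of_mem hI]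
        rw [slicePt, slicePt, ← Quaternion.coe_commutes, star_add, star_mul, hs]
        simp
      have e2 := Quaternion.self_mul_star (slicePt I c)
      rw [e, ← sliceHom_apply hI, ← sliceHom_apply hI, ← map_mul, Complex.mul_conj,
        sliceHom_apply] at e2
      have e3 := congrArg QuaternionAlgebra.re e2
      rw [slicePt_re hI] at e3
      simp at e3
      rw [sliceHom_apply hI] at e3
      rw [← e3, Complex.normSq_eq_norm_sq]
    nlinarith [norm_nonneg (slicePt I c), norm_nonneg c, sq_nonneg (‖slicePt I c‖ - ‖c‖),
      abs_eq_abs.2 (sq_eq_sq_iff_eq_or_eq_neg.1 h1), abs_norm (slicePt I c), abs_norm c]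
  have hc0 : c ≠ 0 := Complex.slitPlane_ne_zero hc
  have hlog : slicePt I (Complex.log c) = ((Real.log ‖c‖ : ℝ) : ℍ[ℝ]) + c.arg • I := by
    rw [slicePt, Complex.log_re, Complex.log_im, ← Quaternion.coe_commutes,
      Quaternion.coe_mul_eq_smul]
  rw [qlog, hn, slicePt_re hI, hlog]
  congr 1
  rw [imagUnit, slicePt_im hI, norm_smul, norm_of_mem hI, mul_one, Real.norm_eq_abs, smul_smul,
    smul_smul]
  congr 1
  rcases lt_trichotomy c.im 0 with h | h | h
  · rw [Complex.arg_of_im_neg h, abs_of_neg h]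
    have := h.ne
    field_simp
  · have hre : 0 < c.re := by
      rcases hc with h' | h'
      · exact h'
      · exact absurd h h'
    have : c = (c.re : ℂ) := Complex.ext rfl (by simpa using h)
    rw [h, this, Complex.arg_ofReal_of_nonneg hre.le]
    simp
  · rw [Complex.arg_of_im_nonneg_of_ne_zero h.le hc0, abs_of_pos h]
    have := h.ne'
    field_simp

end StarExp

/-! ### Division of vectors of holomorphic functions -/

section Division

/-- The vector `V` is locally zero or a power of `x - z` times a vector with nonzero `cnorm`. -/
def NonIsotropicAt (V : ℂ → ℍ[ℂ]) (z : ℂ) : Prop :=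
  (∀ᶠ x in 𝓝 z, V x = 0) ∨ ∃ (n : ℕ) (v : ℂ → ℍ[ℂ]) (ε : ℝ), 0 < ε ∧ IsHolo (ball z ε) v ∧
    (∀ x ∈ ball z ε, V x = (((x - z) ^ n : ℂ) : ℍ[ℂ]) * v x) ∧ cnorm (v z) ≠ 0

theorem cnorm_zero : cnorm 0 = 0 := by simp [cnorm]

theorem IsHolo.cnorm {D : Set ℂ} {F : ℂ → ℍ[ℂ]} (hF : IsHolo D F) :
    DifferentiableOn ℂ (fun z => cnorm (F z)) D :=
  (((hF.re.pow 2).add (hF.imI.pow 2)).add (hF.imJ.pow 2)).add (hF.imK.pow 2)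

theorem NonIsotropicAt.exists_local_sqrt {V : ℂ → ℍ[ℂ]} {z : ℂ} (h : NonIsotropicAt V z) :
    ∃ r : ℂ → ℂ, AnalyticAt ℂ r z ∧ ∀ᶠ x in 𝓝 z, r x ^ 2 = cnorm (V x) := by
  rcases h with h | ⟨n, v, ε, hε, hv, hV, h0⟩
  · refine ⟨fun _ => 0, analyticAt_const, ?_⟩
    filter_upwards [h] with x hx
    rw [hx, cnorm_zero]
    simp
  · obtain ⟨r, hr, hr', -⟩ := StarLog.exists_local_sqrt
      (hv.cnorm.analyticOnNhd isOpen_ball z (mem_ball_self hε)) h0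
    have hp : AnalyticAt ℂ (fun x => (x - z) ^ n) z := by fun_prop
    refine ⟨fun x => (x - z) ^ n * r x, hp.mul hr, ?_⟩
    filter_upwards [hr', ball_mem_nhds z hε] with x hx hxB
    rw [hV x hxB, cnorm_coe_mul, mul_pow, hx]

/-- If `cnorm V = b² t`, where `t ≠ 0` and `V` is non-isotropic at the zeros of `b`, then `V` is
divisible by `b`. -/
theorem exists_vector_quotient {D : Set ℂ} (hD : IsOpen D) (hc : IsPreconnected D) {V : ℂ → ℍ[ℂ]}
    (hV : IsHolo D V) (hV0 : ∀ z ∈ D, (V z).re = 0) {b t : ℂ → ℂ} (hb : DifferentiableOn ℂ b D)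
    (ht : DifferentiableOn ℂ t D) (hb0 : ∃ z ∈ D, b z ≠ 0)
    (hN : ∀ z ∈ D, cnorm (V z) = b z ^ 2 * t z)
    (hz : ∀ z ∈ D, b z = 0 → t z ≠ 0 ∧ NonIsotropicAt V z) :
    ∃ W : ℂ → ℍ[ℂ], IsHolo D W ∧ (∀ z, (W z).re = 0) ∧
      (∀ z ∈ D, V z = ((b z : ℂ) : ℍ[ℂ]) * W z) ∧ ∀ z ∈ D, cnorm (W z) = t z := by
  -- at each point, `V` is a multiple of `b`
  have hloc : ∀ z ∈ D, ∃ (c : ℂ → ℂ) (v : ℂ → ℍ[ℂ]) (ε : ℝ), 0 < ε ∧ IsHolo (ball z ε) v ∧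
      AnalyticAt ℂ c z ∧ ∀ᶠ x in 𝓝 z, V x = ((b x * c x : ℂ) : ℍ[ℂ]) * v x := by
    intro z hzD
    have hba := hb.analyticOnNhd hD z hzD
    have hta := ht.analyticOnNhd hD z hzD
    by_cases h0 : b z = 0
    · obtain ⟨ht0, h | ⟨n, v, ε, hε, hv, hVv, hv0⟩⟩ := hz z hzD h0
      · refine ⟨0, V, ?_⟩
        obtain ⟨ε, hε, hε'⟩ := Metric.isOpen_iff.1 hD z hzD
        refine ⟨ε, hε, hV.mono hε', analyticAt_const, ?_⟩
        filter_upwards [h] with x hx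
        rw [hx, mul_zero]
      -- From (x - z)^{2n} `cnorm v` = b² t one gets b = ±(x - z)^n r with r² = `cnorm v`/t, so V =
      -- (x - z)^n v equals ±b r⁻¹ v.
      · obtain ⟨r, hr, hr', hr0⟩ := exists_local_sqrt (f := fun x => cnorm (v x) / t x)
          ((hv.cnorm.analyticOnNhd isOpen_ball z (mem_ball_self hε)).div hta ht0)
          (div_ne_zero hv0 ht0)
        have hev := (((hr'.and hr.eventually_analyticAt).and
          (hr.continuousAt.eventually_ne hr0)).and (hta.continuousAt.eventually_ne ht0)).and
            ((hD.eventually_mem hzD).and (isOpen_ball.eventually_mem (mem_ball_self hε)))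
        obtain ⟨δ, hδ, hB⟩ := Metric.eventually_nhds_iff_ball.1 hev
        have hp : Differentiable ℂ fun x => (x - z) ^ n := by fun_prop
        have hrd : DifferentiableOn ℂ (fun x => (x - z) ^ n * r x) (ball z δ) :=
          hp.differentiableOn.mul fun x hx =>
            (hB x hx).1.1.1.2.differentiableAt.differentiableWithinAt
        have hsq : ∀ x ∈ ball z δ, b x ^ 2 = ((x - z) ^ n * r x) ^ 2 := by
          intro x hx
          obtain ⟨⟨⟨⟨h1, -⟩, h2⟩, h3⟩, h4, h5⟩ := hB x hx
          have h6 := hN x h4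
          rw [hVv x h5, cnorm_coe_mul] at h6
          rw [mul_pow, h1]
          field_simp
          linear_combination -h6
        rcases eq_or_eq_neg_of_sq_eq isOpen_ball (convex_ball z δ).isPreconnected
          (hb.mono fun x hx => (hB x hx).2.1) hrd hsq with h | h
        · refine ⟨fun x => (r x)⁻¹, v, ε, hε, hv, hr.inv hr0, ?_⟩
          filter_upwards [ball_mem_nhds z hδ] with x hx
          rw [hVv x (hB x hx).2.2, h x hx, mul_assoc, mul_inv_cancel₀ (hB x hx).1.1.2, mul_one]
        · refine ⟨fun x => -(r x)⁻¹, v, ε, hε, hv, (hr.inv hr0).neg, ?_⟩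
          filter_upwards [ball_mem_nhds z hδ] with x hx
          rw [hVv x (hB x hx).2.2, h x hx, neg_mul_neg, mul_assoc,
            mul_inv_cancel₀ (hB x hx).1.1.2, mul_one]
    · obtain ⟨ε, hε, hε'⟩ := Metric.isOpen_iff.1 hD z hzD
      refine ⟨fun x => (b x)⁻¹, V, ε, hε, hV.mono hε', hba.inv h0, ?_⟩
      filter_upwards [hba.continuousAt.eventually_ne h0] with x hx
      rw [mul_inv_cancel₀ hx, Quaternion.coe_one, one_mul]
  have key : ∀ k : ℍ[ℂ] → ℂ, (∀ (x : ℂ) (y : ℍ[ℂ]), k ((x : ℍ[ℂ]) * y) = x * k y) →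
      (∀ (B : Set ℂ) (F : ℂ → ℍ[ℂ]), IsHolo B F → DifferentiableOn ℂ (fun z => k (F z)) B) →
      ∃ q : ℂ → ℂ, DifferentiableOn ℂ q D ∧ ∀ z ∈ D, k (V z) = b z * q z := by
    intro k hk hkd
    refine exists_quotient hD hc hb hb0 fun z hzD => ?_
    obtain ⟨c, v, ε, hε, hv, hca, hcv⟩ := hloc z hzD
    refine ⟨fun x => c x * k (v x), hca.mul ((hkd _ _ hv).analyticOnNhd isOpen_ball z
      (mem_ball_self hε)), ?_⟩
    filter_upwards [hcv] with x hx
    rw [hx, hk, mul_assoc]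
  have hsm : ∀ (x : ℂ) (y : ℍ[ℂ]), (x : ℍ[ℂ]) * y = x • y := fun x y =>
    Quaternion.coe_mul_eq_smul x y
  obtain ⟨q₁, hq₁, e₁⟩ := key (fun y => y.imI) (fun x y => by rw [hsm]; simp) fun _ _ h => h.imI
  obtain ⟨q₂, hq₂, e₂⟩ := key (fun y => y.imJ) (fun x y => by rw [hsm]; simp) fun _ _ h => h.imJ
  obtain ⟨q₃, hq₃, e₃⟩ := key (fun y => y.imK) (fun x y => by rw [hsm]; simp) fun _ _ h => h.imK
  obtain ⟨W, hW⟩ : ∃ W : ℂ → ℍ[ℂ], ∀ z, (W z).re = 0 ∧ (W z).imI = q₁ z ∧ (W z).imJ = q₂ z ∧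
      (W z).imK = q₃ z := ⟨fun z => ⟨0, q₁ z, q₂ z, q₃ z⟩, fun z => ⟨rfl, rfl, rfl, rfl⟩⟩
  have hWH : IsHolo D W :=
    ⟨(differentiableOn_const 0).congr fun z _ => (hW z).1, hq₁.congr fun z _ => (hW z).2.1,
      hq₂.congr fun z _ => (hW z).2.2.1, hq₃.congr fun z _ => (hW z).2.2.2⟩
  have hVW : ∀ z ∈ D, V z = ((b z : ℂ) : ℍ[ℂ]) * W z := by
    intro z hzD
    obtain ⟨h0, h1, h2, h3⟩ := hW z
    rw [hsm]
    ext
    · simp [h0, hV0 z hzD]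
    · simp [h1, e₁ z hzD]
    · simp [h2, e₂ z hzD]
    · simp [h3, e₃ z hzD]
  refine ⟨W, hWH, fun z => (hW z).1, hVW, ?_⟩
  rcases eqOn_zero_or_of_mul_eq_zero hD hc (hb.pow 2) (hWH.cnorm.sub ht) (fun z hzD => by
    have := hN z hzD
    rw [hVW z hzD, cnorm_coe_mul] at this
    simp only [Pi.pow_apply, Pi.sub_apply]
    linear_combination this) with h | h
  · obtain ⟨z, hzD, hz0⟩ := hb0
    exact absurd (h z hzD) (pow_ne_zero 2 hz0)
  · exact fun z hzD => sub_eq_zero.1 (h z hzD)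

end Division

/-! ### Slice preserving functions computed through their complex stems -/

section Evaluation

variable {q : ℍ[ℝ]}

theorem ev_inj (hq : q.im ≠ 0) {a b : ℂ → ℂ} : ev a q = ev b q ↔ a (coord q) = b (coord q) := by
  rw [ev, ev, ← sliceHom_apply (imagUnit_mem hq), ← sliceHom_apply (imagUnit_mem hq)]
  exact (sliceHom_injective _).eq_iff

theorem ev_mul (hq : q.im ≠ 0) (a b : ℂ → ℂ) : ev a q * ev b q = ev (fun z => a z * b z) q := by
  simp only [ev, ← sliceHom_apply (imagUnit_mem hq), map_mul]

theorem ev_inv (hq : q.im ≠ 0) (a : ℂ → ℂ) : (ev a q)⁻¹ = ev (fun z => (a z)⁻¹) q := by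
  simp only [ev, ← sliceHom_apply (imagUnit_mem hq), map_inv₀]

theorem ev_div (hq : q.im ≠ 0) (a b : ℂ → ℂ) : ev a q / ev b q = ev (fun z => a z / b z) q := by
  simp only [ev, ← sliceHom_apply (imagUnit_mem hq), map_div₀]

theorem ev_pow (hq : q.im ≠ 0) (a : ℂ → ℂ) (n : ℕ) : ev a q ^ n = ev (fun z => a z ^ n) q := by
  simp only [ev, ← sliceHom_apply (imagUnit_mem hq), map_pow]

theorem neg_one_zpow_mul_ev (hq : q.im ≠ 0) (a : ℂ → ℂ) (m : ℤ) :
    (-1) ^ m * ev a q = ev (fun z => (-1) ^ m * a z) q := by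
  simp only [ev, ← sliceHom_apply (imagUnit_mem hq), map_mul, map_zpow₀, map_neg, map_one]

theorem ev_eq_zero_iff (hq : q.im ≠ 0) (a : ℂ → ℂ) : ev a q = 0 ↔ a (coord q) = 0 := by
  rw [ev, ← sliceHom_apply (imagUnit_mem hq), map_eq_zero]

theorem mu_ev (hq : q.im ≠ 0) (a : ℂ → ℂ) : mu (ev a q) = ev (fun z => muC (a z)) q :=
  mu_slicePt (imagUnit_mem hq) _

theorem nu_ev (hq : q.im ≠ 0) (a : ℂ → ℂ) : nu (ev a q) = ev (fun z => nuC (a z)) q :=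
  nu_slicePt (imagUnit_mem hq) _

theorem forall_ev_eq_iff {U : Set ℍ[ℝ]} (hs : IsAxSymm U) (hr : RealFree U) {a b : ℂ → ℂ} :
    (∀ q ∈ U, ev a q = ev b q) ↔ ∀ z ∈ up U, a z = b z := by
  constructor
  · intro h z hz
    have := (ev_inj (hr.im_ne_zero hz.2)).1 (h _ hz.2)
    rwa [coord_slicePt_of_pos unitI_mem hz.1] at this
  · intro h q hq
    rw [ev_inj (hr.im_ne_zero hq), h _ (coord_mem_up hs hr hq)]

theorem isNegReal_slicePt_iff {I : ℍ[ℝ]} (hI : I ∈ imagUnits) (c : ℂ) :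
    IsNegReal (slicePt I c) ↔ c.re < 0 ∧ c.im = 0 := by
  constructor
  · rintro ⟨t, ht, h⟩
    have : c = (t : ℂ) := sliceHom_injective hI (by
      rw [sliceHom_apply, h, sliceHom_apply]
      simp [slicePt])
    rw [this]
    simpa using ht
  · rintro ⟨h1, h2⟩
    exact ⟨c.re, h1, by simp [slicePt, h2]⟩

end Evaluation

/-! ### Square roots, lifts through `μ` and logarithms on basic product domains -/

section BasicProductDomain

variable {Ω : Set ℍ[ℝ]} {g s G L : ℍ[ℝ] → ℍ[ℝ]} {z₀ : ℍ[ℝ]}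

theorem cnorm_eq_re_sq_add (w : ℍ[ℂ]) : cnorm w = w.re ^ 2 + cnorm w.im := by
  simp [cnorm]
  ring

theorem mem_of_zeroSet_eq {ω : VectorialClass Ω} (hz₀ : ω.zeroSet = {z₀}) : z₀ ∈ Ω := by
  have h : z₀ ∈ ω.zeroSet := by rw [hz₀]; rfl
  obtain ⟨u, hu, hzu, -⟩ := h
  exact hu.subset hzu

theorem nonIsotropicAt_stem (hΩ : IsAxSymmDomain Ω) (hr : RealFree Ω) {ω : VectorialClass Ω}
    (hg : ω.IsSR g) (hz₀ : ω.zeroSet = {z₀}) {z : ℂ} (hz : z ∈ up Ω) (hne : z ≠ coord z₀) :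
    NonIsotropicAt (fun z => (stem g z).im) z := by
  by_cases h0 : ∃ z ∈ up Ω, (stem g z).im ≠ 0
  · obtain ⟨n, v, ε, hε, -, hv, hV, hN⟩ := exists_local_minimal hΩ hr ω hg h0 hz
    refine Or.inr ⟨n, v, ε, hε, hv, hV, fun h => hne ?_⟩
    obtain ⟨I, hI, hIz⟩ := hN h
    rw [hz₀, mem_singleton_iff] at hIz
    rw [← hIz, coord_slicePt_of_pos hI hz.1]
  · push Not at h0
    exact Or.inl (Filter.mem_of_superset ((isOpen_up hΩ.isOpen).mem_nhds hz) h0)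

theorem cnorm_stem_ne_zero (hs : IsAxSymm Ω) (hr : RealFree Ω) (hg : IsSliceRegular Ω g)
    (hg0 : ∀ q ∈ Ω, g q ≠ 0) {z : ℂ} (hz : z ∈ up Ω) : cnorm (stem g z) ≠ 0 := by
  rw [Ne, ← exists_phi_eq_zero_iff]
  rintro ⟨I, hI, h⟩
  refine hg0 _ (slicePt_mem hs hI hz) ?_
  rw [eq_phi_stem_slicePt hs hr hg hI hz, h]

/-- The symmetrization has no zeros, so a root exists. At `z₀` it reduces to the square of the
scalar part, which lets the sign be chosen. -/
theorem exists_isSqrtSymm (hΩ : IsBasicProductDomain Ω) {ω : VectorialClass Ω} (hg : ω.IsSR g)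
    (hg0 : ∀ q ∈ Ω, g q ≠ 0) (hz₀ : ω.zeroSet = {z₀}) : ∃ s, IsSqrtSymm Ω g z₀ s := by
  have hr : RealFree Ω := hΩ.no_real
  have hs := hΩ.axSymm
  have hD := isOpen_up hΩ.isOpen
  have hzΩ := mem_of_zeroSet_eq hz₀
  have hw := coord_mem_up hs hr hzΩ
  have hH := isHolo_stem hs hg.1
  have hne : ∀ z ∈ up Ω, cnorm (stem g z) ≠ 0 := fun z hz => cnorm_stem_ne_zero hs hr hg.1 hg0 hz
  obtain ⟨r, hr1, hr2⟩ := exists_sqrt hD (isSimplyConnected_up hΩ) hH.cnorm fun z hz => by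
    obtain ⟨r, h1, h2, -⟩ := exists_local_sqrt (hH.cnorm.analyticOnNhd hD z hz) (hne z hz)
    exact ⟨r, h1, h2⟩
  have hN0 := cnorm_im_stem_eq_zero hΩ.toIsAxSymmDomain hr ω hg (z₀ := z₀) (by rw [hz₀]; rfl)
  have h1 : r (coord z₀) ^ 2 = (stem g (coord z₀)).re ^ 2 := by
    rw [hr2 _ hw, cnorm_eq_re_sq_add, hN0, add_zero]
  obtain ⟨σ, hσ, hσ2, hσw⟩ : ∃ σ : ℂ → ℂ, DifferentiableOn ℂ σ (up Ω) ∧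
      (∀ z ∈ up Ω, σ z ^ 2 = cnorm (stem g z)) ∧ σ (coord z₀) = (stem g (coord z₀)).re := by
    rcases sq_eq_sq_iff_eq_or_eq_neg.1 h1 with h | h
    · exact ⟨r, hr1, hr2, h⟩
    · exact ⟨fun z => -r z, hr1.neg, fun z hz => by rw [neg_sq, hr2 z hz], by simp [h]⟩
  refine ⟨ev σ, isSRReal_of_eq_ev hΩ.isOpen hs hr hσ fun _ _ => rfl, fun q hq => ?_, ?_⟩
  · rw [ev_pow (hr.im_ne_zero hq), symmetrization_apply hr hq, ev_inj (hr.im_ne_zero hq)]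
    exact hσ2 _ (coord_mem_up hs hr hq)
  · rw [scalarPart_apply, ev_inj (hr.im_ne_zero hzΩ), hσw]

theorem IsSqrtSymm.exists_stem (hs : IsAxSymm Ω) (hr : RealFree Ω) (hz : z₀ ∈ Ω)
    (h : IsSqrtSymm Ω g z₀ s) : ∃ σ : ℂ → ℂ, DifferentiableOn ℂ σ (up Ω) ∧
      (∀ q ∈ Ω, s q = ev σ q) ∧ (∀ z ∈ up Ω, σ z ^ 2 = cnorm (stem g z)) ∧
      σ (coord z₀) = (stem g (coord z₀)).re := by
  obtain ⟨σ, hσ, hsσ, -⟩ := h.srReal.exists_ev hs hr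
  refine ⟨σ, hσ, hsσ, (forall_ev_eq_iff hs hr).1 fun q hq => ?_, ?_⟩
  · rw [← ev_pow (hr.im_ne_zero hq), ← hsσ q hq, h.sq_eq q hq, symmetrization_apply hr hq]
  · have := h.value
    rwa [hsσ z₀ hz, scalarPart_apply, ev_inj (hr.im_ne_zero hz)] at this

/-- Here 1 - (g₀/σ)² = `cnorm V`/σ², a local square at each point other than `coord z₀` by
nonisotropy of V. -/
theorem exists_isMuLift (hΩ : IsBasicProductDomain Ω) {ω : VectorialClass Ω} (hg : ω.IsSR g)
    (hg0 : ∀ q ∈ Ω, g q ≠ 0) (hz₀ : ω.zeroSet = {z₀}) (h : IsSqrtSymm Ω g z₀ s) :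
    ∃ G, IsMuLift Ω (fun q => scalarPart g q / s q) z₀ G := by
  have hr : RealFree Ω := hΩ.no_real
  have hs := hΩ.axSymm
  have hD := isOpen_up hΩ.isOpen
  have hzΩ := mem_of_zeroSet_eq hz₀
  have hw := coord_mem_up hs hr hzΩ
  have hH := isHolo_stem hs hg.1
  obtain ⟨σ, hσ, hsσ, hσ2, hσw⟩ := h.exists_stem hs hr hzΩ
  have hσ0 : ∀ z ∈ up Ω, σ z ≠ 0 := fun z hz h0 => by
    refine cnorm_stem_ne_zero hs hr hg.1 hg0 hz ?_
    rw [← hσ2 z hz, h0]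
    simp
  obtain ⟨γ, hγ, hγμ, hγ0⟩ := exists_muC_lift_of_locally_sq hD (isSimplyConnected_up hΩ) hw
    (h := fun z => (stem g z).re / σ z) (hH.re.div hσ hσ0)
    (show (stem g (coord z₀)).re / σ (coord z₀) = 1 by rw [← hσw, div_self (hσ0 _ hw)])
    fun z hz hne => by
      obtain ⟨r, hr1, hr2⟩ := (nonIsotropicAt_stem hΩ.toIsAxSymmDomain hr hg hz₀ hz
        hne).exists_local_sqrt
      refine ⟨fun x => r x / σ x, hr1.div (hσ.analyticOnNhd hD z hz) (hσ0 z hz), ?_⟩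
      filter_upwards [hr2, hD.eventually_mem hz] with x hx hxD
      have h1 := hσ2 x hxD
      rw [cnorm_eq_re_sq_add] at h1
      have h2 := hσ0 x hxD
      rw [div_pow, hx]
      field_simp
      linear_combination -h1
  refine ⟨ev γ, isSRReal_of_eq_ev hΩ.isOpen hs hr hγ fun _ _ => rfl, fun q hq => ?_, ?_⟩
  · have hq' := hr.im_ne_zero hq
    rw [mu_ev hq', scalarPart_apply, hsσ q hq, ev_div hq', ev_inj hq',
      hγμ _ (coord_mem_up hs hr hq)]
  · rw [ev_eq_zero_iff (hr.im_ne_zero hzΩ), hγ0]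

theorem IsMuLift.exists_stem (hs : IsAxSymm Ω) (hr : RealFree Ω) (hz : z₀ ∈ Ω) {σ : ℂ → ℂ}
    (hsσ : ∀ q ∈ Ω, s q = ev σ q) (hσ0 : ∀ z ∈ up Ω, σ z ≠ 0)
    (h : IsMuLift Ω (fun q => scalarPart g q / s q) z₀ G) :
    ∃ γ : ℂ → ℂ, DifferentiableOn ℂ γ (up Ω) ∧ (∀ q ∈ Ω, G q = ev γ q) ∧
      (∀ z ∈ up Ω, σ z * muC (γ z) = (stem g z).re) ∧ γ (coord z₀) = 0 := by
  obtain ⟨γ, hγ, hGγ, -⟩ := h.srReal.exists_ev hs hr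
  have h1 : ∀ z ∈ up Ω, muC (γ z) = (stem g z).re / σ z :=
    (forall_ev_eq_iff hs hr).1 fun q hq => by
      have hq' := hr.im_ne_zero hq
      rw [← mu_ev hq', ← hGγ q hq, h.mu_eq q hq, scalarPart_apply, hsσ q hq, ev_div hq']
  refine ⟨γ, hγ, hGγ, fun z hz => by rw [h1 z hz, mul_div_cancel₀ _ (hσ0 z hz)], ?_⟩
  have := h.value
  rwa [hGγ z₀ hz, ev_eq_zero_iff (hr.im_ne_zero hz)] at this

theorem interior_setOf_ev_eq_zero (hΩ : IsAxSymmDomain Ω) (hr : RealFree Ω) {a : ℂ → ℂ}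
    (ha : DifferentiableOn ℂ a (up Ω)) (ha0 : ∃ z ∈ up Ω, a z ≠ 0) :
    interior {q | q ∈ Ω ∧ ev a q = 0} = ∅ := by
  rw [eq_empty_iff_forall_notMem]
  intro p hp
  have hpΩ : p ∈ Ω := (interior_subset hp).1
  have h0 := hr.im_ne_zero hpΩ
  have hI := imagUnit_mem h0
  have h1 : ∀ᶠ z in 𝓝 (coord p), slicePt (imagUnit p) z ∈ interior {q | q ∈ Ω ∧ ev a q = 0} := by
    refine (continuous_slicePt _).continuousAt.eventually_mem (isOpen_interior.mem_nhds ?_)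
    rwa [slicePt_coord h0]
  obtain ⟨z, hz, hz0⟩ := ha0
  refine hz0 (eqOn_zero_of_eventually (isOpen_up hΩ.isOpen) (isPreconnected_up hΩ hr) ha
    (coord_mem_up hΩ.axSymm hr hpΩ) ?_ z hz)
  filter_upwards [h1, (isOpen_up hΩ.isOpen).eventually_mem (coord_mem_up hΩ.axSymm hr hpΩ)]
    with x hx hxD
  have h2 := interior_subset hx
  have h3 := (ev_eq_zero_iff (hr.im_ne_zero h2.1) a).1 h2.2
  rwa [coord_slicePt_of_pos hI hxD.1] at h3

theorem isStarLog_ev_iff (hs : IsAxSymm Ω) (hr : RealFree Ω) {l b : ℂ → ℂ} {L h : ℍ[ℝ] → ℍ[ℝ]}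
    (hL : ∀ q ∈ Ω, L q = ev l q) (hh : ∀ q ∈ Ω, h q = ev b q) :
    IsStarLog Ω L h ↔ ∀ z ∈ up Ω, Complex.exp (l z) = b z := by
  have key : ∀ q ∈ Ω, HasSum (fun n : ℕ => ((n.factorial : ℝ)⁻¹) • starPow L n q)
      (ev (fun z => Complex.exp (l z)) q) := by
    intro q hq
    have hI := hr.imagUnit_mem hq
    have h1 := (hasSum_exp (l (coord q))).map (sliceHom hI) (continuous_sliceHom hI)
    rw [sliceHom_apply] at h1
    refine h1.congr_fun fun n => ?_
    have h2 : starPow L n q = phi (imagUnit q) (stem L (coord q) ^ n) := rfl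
    rw [h2, stem_eq_coe_of_eq_ev hs hr hL (coord_mem_up hs hr hq), ← Quaternion.coe_pow, phi_coe,
      Function.comp_apply, map_smul, sliceHom_apply]
  rw [← forall_ev_eq_iff hs hr]
  refine forall₂_congr fun q hq => ?_
  rw [hh q hq]
  exact ⟨fun h => (key q hq).unique h, fun h => h ▸ key q hq⟩

theorem exists_isLogZero (hΩ : IsBasicProductDomain Ω) (hz : z₀ ∈ Ω) {b : ℂ → ℂ}
    {h : ℍ[ℝ] → ℍ[ℝ]} (hb : DifferentiableOn ℂ b (up Ω)) (hb0 : ∀ z ∈ up Ω, b z ≠ 0)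
    (hh : ∀ q ∈ Ω, h q = ev b q) (hw : b (coord z₀) ∈ Complex.slitPlane) :
    ∃ L, IsLogZero Ω h z₀ L := by
  have hr : RealFree Ω := hΩ.no_real
  have hs := hΩ.axSymm
  have hwD := coord_mem_up hs hr hz
  obtain ⟨l, hl, hlb, hlw⟩ := exists_log (isOpen_up hΩ.isOpen) (isSimplyConnected_up hΩ) hb hb0 hwD
    (Complex.exp_log (hb0 _ hwD))
  refine ⟨ev l, isSRReal_of_eq_ev hΩ.isOpen hs hr hl fun _ _ => rfl,
    (isStarLog_ev_iff hs hr (fun _ _ => rfl) hh).2 hlb, ?_⟩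
  rw [hh z₀ hz, ev, ev, qlog_slicePt (hr.imagUnit_mem hz) hw, hlw]

end BasicProductDomain

/-! ### Construction of the `*`-logarithm -/

section Logarithm

variable {Ω : Set ℍ[ℝ]} {g s G L : ℍ[ℝ] → ℍ[ℝ]} {z₀ : ℍ[ℝ]} {σ γ : ℂ → ℂ}

/-- The quotient of the stem function of `g_v` by that of `ν(G) √(g^s)`. -/
theorem exists_stem_quotient (hΩ : IsAxSymmDomain Ω) (hr : RealFree Ω) {ω : VectorialClass Ω}
    (hg : ω.IsSR g) (hz₀ : ω.zeroSet = {z₀}) (hσ : DifferentiableOn ℂ σ (up Ω))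
    (hσ0 : ∀ z ∈ up Ω, σ z ≠ 0) (hσ2 : ∀ z ∈ up Ω, σ z ^ 2 = cnorm (stem g z))
    (hγ : DifferentiableOn ℂ γ (up Ω)) (hγμ : ∀ z ∈ up Ω, σ z * muC (γ z) = (stem g z).re)
    (hγ0 : γ (coord z₀) = 0) :
    ∃ W : ℂ → ℍ[ℂ], IsHolo (up Ω) W ∧ (∀ z, (W z).re = 0) ∧
      (∀ z ∈ up Ω, (stem g z).im = ((nuC (γ z) * σ z : ℂ) : ℍ[ℂ]) * W z) ∧
      ∀ z ∈ up Ω, cnorm (W z) = γ z := by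
  have hw := coord_mem_up hΩ.axSymm hr (mem_of_zeroSet_eq hz₀)
  refine exists_vector_quotient (isOpen_up hΩ.isOpen) (isPreconnected_up hΩ hr)
    (isHolo_stem hΩ.axSymm hg.1).im (fun _ _ => by simp)
    ((differentiable_nuC.comp_differentiableOn hγ).mul hσ) hγ
    ⟨coord z₀, hw, mul_ne_zero (by rw [hγ0, nuC_zero]; exact one_ne_zero)
      (hσ0 _ hw)⟩ (fun z hz => ?_) (fun z hz h0 => ?_)
  · have h1 := hσ2 z hz
    rw [cnorm_eq_re_sq_add, ← hγμ z hz] at h1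
    -- `cnorm V` = σ² - g₀² = σ²(1 - μ(γ)²) = σ² γ ν(γ)².
    have h2 : cnorm (stem g z).im = (nuC (γ z) * σ z) ^ 2 * γ z := by
      linear_combination -h1 - σ z ^ 2 * muC_sq_add (γ z)
    exact h2
  · have h1 : nuC (γ z) = 0 := (mul_eq_zero.1 h0).resolve_right (hσ0 z hz)
    have h2 : γ z ≠ 0 := fun h => by
      rw [h, nuC_zero] at h1
      exact one_ne_zero h1
    exact ⟨h2, nonIsotropicAt_stem hΩ hr hg hz₀ hz fun h => h2 (by rw [h, hγ0])⟩

theorem mem_of_mem_sphereOf (hs : IsAxSymm Ω) (hr : RealFree Ω) {p q : ℍ[ℝ]} (hq : q ∈ Ω)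
    (hp : p ∈ sphereOf q) : p ∈ Ω := by
  refine mem_of_coord_mem_up hs ?_
  rw [coord_eq_of_mem_sphereOf hp]
  exact coord_mem_up hs hr hq

theorem vecPart_eq_zero_of_stem (hs : IsAxSymm Ω) (hr : RealFree Ω) (hg : IsSliceRegular Ω g)
    {q : ℍ[ℝ]} (hq : q ∈ Ω) (h : (stem g (coord q)).im = 0) : vecPart g q = 0 := by
  rw [vecPart_apply hs hr hg hq]
  change phi _ (stem g (coord q)).im = 0
  rw [h, phi_zero]

/-- The parity condition on `m` makes `(-1) ^ m √(g^s)` avoid `(-∞, 0]` at `z₀`. -/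
theorem neg_one_zpow_mul_mem_slitPlane (hs : IsAxSymm Ω) (hr : RealFree Ω) (hz : z₀ ∈ Ω)
    (hsσ : ∀ q ∈ Ω, s q = ev σ q) (hσ0 : ∀ z ∈ up Ω, σ z ≠ 0) {m : ℤ}
    (heven : (∀ q ∈ sphereOf z₀, ¬IsNegReal (s q)) → Even m)
    (hodd : (∀ q ∈ sphereOf z₀, IsNegReal (s q)) → Odd m) :
    (-1) ^ m * σ (coord z₀) ∈ Complex.slitPlane := by
  -- A slice preserving function is negative real at all points of the sphere or at none, so exactly
  -- one parity condition applies.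
  have hneg : ∀ q ∈ sphereOf z₀,
      IsNegReal (s q) ↔ (σ (coord z₀)).re < 0 ∧ (σ (coord z₀)).im = 0 := fun q hq => by
    have hqΩ := mem_of_mem_sphereOf hs hr hz hq
    rw [hsσ q hqΩ, ev, isNegReal_slicePt_iff (hr.imagUnit_mem hqΩ), coord_eq_of_mem_sphereOf hq]
  have h0 := hσ0 _ (coord_mem_up hs hr hz)
  rw [Complex.mem_slitPlane_iff]
  by_cases h : (σ (coord z₀)).re < 0 ∧ (σ (coord z₀)).im = 0
  · rw [(hodd fun q hq => (hneg q hq).2 h).neg_one_zpow]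
    left
    simpa using h.1
  · rw [(heven fun q hq => (hneg q hq).not.2 h).neg_one_zpow, one_mul]
    by_cases him : (σ (coord z₀)).im = 0
    · left
      rcases lt_trichotomy (σ (coord z₀)).re 0 with h' | h' | h'
      · exact absurd ⟨h', him⟩ h
      · exact absurd (Complex.ext h' him) h0
      · exact h'
    · exact Or.inr him

theorem exp_int_mul_pi_mul_I (m : ℤ) : Complex.exp (m * Real.pi * Complex.I) = (-1) ^ m := by
  rw [mul_assoc, Complex.exp_int_mul, Complex.exp_pi_mul_I]

theorem exists_starLog (hΩ : IsAxSymmDomain Ω) (hr : RealFree Ω) {ω : VectorialClass Ω}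
    (hg : ω.IsSR g) (hz₀ : ω.zeroSet = {z₀}) (hσ : DifferentiableOn ℂ σ (up Ω))
    (hσ0 : ∀ z ∈ up Ω, σ z ≠ 0) (hσ2 : ∀ z ∈ up Ω, σ z ^ 2 = cnorm (stem g z))
    (hγ : DifferentiableOn ℂ γ (up Ω)) (hγμ : ∀ z ∈ up Ω, σ z * muC (γ z) = (stem g z).re)
    (hγ0 : γ (coord z₀) = 0) {m : ℤ} {l : ℂ → ℂ} (hl : DifferentiableOn ℂ l (up Ω))
    (hlσ : ∀ z ∈ up Ω, Complex.exp (l z) = (-1) ^ m * σ z) :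
    ∃ f, ω.IsSR f ∧ IsStarLog Ω f g ∧ ∀ q ∈ Ω, nu (ev γ q) ≠ 0 →
      f q = (ev l q + (m * Real.pi : ℝ) • imagUnit q)
        + (nu (ev γ q) * ev σ q)⁻¹ * vecPart g q := by
  have hs := hΩ.axSymm
  have hD := isOpen_up hΩ.isOpen
  have hc := isPreconnected_up hΩ hr
  have hw := coord_mem_up hs hr (mem_of_zeroSet_eq hz₀)
  obtain ⟨W, hW, hW0, hVW, hWN⟩ := exists_stem_quotient hΩ hr hg hz₀ hσ hσ0 hσ2 hγ hγμ hγ0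
  set b : ℂ → ℂ := fun z => nuC (γ z) * σ z with hb
  have hbd : DifferentiableOn ℂ b (up Ω) := (differentiable_nuC.comp_differentiableOn hγ).mul hσ
  have hb0 : ∃ z ∈ up Ω, b z ≠ 0 := ⟨_, hw, mul_ne_zero
    (by rw [hγ0, nuC_zero]; exact one_ne_zero) (hσ0 _ hw)⟩
  set α : ℂ → ℂ := fun z => l z + m * Real.pi * Complex.I with hα
  -- The shift by mπi contributes a second factor (-1)^m, which cancels the one in `hlσ`.
  have hαe : ∀ z ∈ up Ω, Complex.exp (α z) = σ z := fun z hz => by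
    rw [hα, Complex.exp_add, hlσ z hz, exp_int_mul_pi_mul_I, mul_right_comm, ← mul_zpow]
    simp
  let Φ : ℂ → ℍ[ℂ] := fun z => ((α z : ℂ) : ℍ[ℂ]) + W z
  have hαd : DifferentiableOn ℂ α (up Ω) := hl.add_const _
  have hΦ : IsHolo (up Ω) Φ :=
    ⟨by simpa [Φ, hW0] using hαd, by simpa [Φ] using hW.imI, by simpa [Φ] using hW.imJ,
      by simpa [Φ] using hW.imK⟩
  have hΦim : ∀ z, (Φ z).im = W z := fun z => by
    ext <;> simp [Φ, hW0]
  have hf : IsSliceRegular Ω (induced Φ) :=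
    isSliceRegular_of_eq_induced hΩ.isOpen hs hr hΦ fun _ _ => rfl
  have hst : ∀ z ∈ up Ω, stem (induced Φ) z = Φ z := fun z hz =>
    stem_eq_of_eq_induced hs hr (fun _ _ => rfl) hz
  refine ⟨induced Φ, ⟨hf, fun p hp => ?_⟩, fun q hq => ?_, fun q hq hq0 => ?_⟩
  -- Since V = bW with `b` not identically zero, W has zero germ where V has, and otherwise
  -- represents the same class.
  · have hpD := coord_mem_up hs hr hp
    rcases hg.2 p hp with h | h
    · left
      have h1 := eventually_stem_eq_zero hΩ.isOpen hs hr
        (isVectorial_vecPart hΩ.isOpen hs hr hg.1).1 hp h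
      have hV := (isHolo_stem hs (isVectorial_vecPart hΩ.isOpen hs hr hg.1).1).eqOn_zero hD hc
        hpD h1
      have hW00 := hW.eqOn_zero_of_coe_mul hD hc hbd hb0 fun z hz => by
        rw [← hVW z hz, ← stem_vecPart hs hr hg.1 hz, hV z hz]
      filter_upwards [hΩ.isOpen.eventually_mem hp] with q hq
      refine vecPart_eq_zero_of_stem hs hr hf hq ?_
      rw [hst _ (coord_mem_up hs hr hq), hΦim, hW00 _ (coord_mem_up hs hr hq)]
    · right
      refine mem_cls_of_eq_mul hr ω hp h Subset.rfl
        ⟨hΩ, hp, isVectorial_vecPart hΩ.isOpen hs hr hf⟩ Subset.rfl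
        (hbd.analyticOnNhd hD _ hpD) (fun h0 => ?_) ?_
      · obtain ⟨z, hz, hz0⟩ := hb0
        exact hz0 (eqOn_zero_of_eventually hD hc hbd hpD h0 z hz)
      · filter_upwards [hD.eventually_mem hpD] with z hz
        rw [stem_vecPart hs hr hg.1 hz, stem_vecPart hs hr hf hz, hst z hz, hΦim, hVW z hz]
  · have hqD := coord_mem_up hs hr hq
    have hI := hr.imagUnit_mem hq
    have h1 := hasSum_phi_pow hI (hW0 (coord q)) (α (coord q))
    -- The exponential formula yields σ μ(γ) + σ ν(γ) W = g₀ + V, using `cnorm W = γ`.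
    have h2 : slicePt (imagUnit q) (Complex.exp (α (coord q)) * muC (cnorm (W (coord q))))
        + slicePt (imagUnit q) (Complex.exp (α (coord q)) * nuC (cnorm (W (coord q))))
          * phi (imagUnit q) (W (coord q)) = g q := by
      rw [eq_phi_stem hs hr hg.1 hq, ← re_add_im (stem g (coord q)), phi_add, phi_coe,
        hVW _ hqD, phi_coe_mul hI, hαe _ hqD, hWN _ hqD, hγμ _ hqD, mul_comm (σ _) (nuC _)]
    rw [h2] at h1
    refine h1.congr_fun fun n => ?_
    change (n.factorial : ℝ)⁻¹ • phi (imagUnit q) (stem (induced Φ) (coord q) ^ n) = _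
    rw [hst _ hqD]
  · have hqD := coord_mem_up hs hr hq
    have hI := hr.imagUnit_mem hq
    have hq' := hr.im_ne_zero hq
    rw [nu_ev hq', Ne, ev_eq_zero_iff hq'] at hq0
    have hbq : b (coord q) ≠ 0 := mul_ne_zero hq0 (hσ0 _ hqD)
    have e1 : (m * Real.pi : ℝ) • imagUnit q
        = slicePt (imagUnit q) (m * Real.pi * Complex.I) := by
      have : (m * Real.pi * Complex.I : ℂ) = (m * Real.pi : ℝ) • Complex.I := by
        rw [Complex.real_smul]
        push_cast
        ring
      rw [this, ← sliceHom_apply hI, map_smul, sliceHom_apply]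
      congr 1
      simp [slicePt]
    have e2 : (nu (ev γ q) * ev σ q)⁻¹ * vecPart g q = phi (imagUnit q) (W (coord q)) := by
      rw [nu_ev hq', ev_mul hq', ev_inv hq', vecPart_apply hs hr hg.1 hq]
      change slicePt (imagUnit q) (b (coord q))⁻¹ * phi (imagUnit q) (stem g (coord q)).im = _
      rw [hVW _ hqD, phi_coe_mul hI, ← mul_assoc, ← sliceHom_apply hI, ← sliceHom_apply hI,
        ← map_mul, inv_mul_cancel₀ hbq, map_one, one_mul]
    rw [e1, e2, ev, ← sliceHom_apply hI, ← sliceHom_apply hI, ← map_add, sliceHom_apply]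
    change phi (imagUnit q) (((α (coord q) : ℂ) : ℍ[ℂ]) + W (coord q)) = _
    rw [phi_add, phi_coe]

end Logarithm

end StarLog

end

theorem theorem6 (Ω : Set ℍ[ℝ]) (hΩ : StarLog.IsBasicProductDomain Ω)
    (ω : StarLog.VectorialClass Ω) (g : ℍ[ℝ] → ℍ[ℝ]) (hg : ω.IsSR g)
    (hg0 : ∀ q ∈ Ω, g q ≠ 0) (z₀ : ℍ[ℝ]) (hz₀ : ω.zeroSet = {z₀}) :
    (∃ s, StarLog.IsSqrtSymm Ω g z₀ s) ∧
    ∀ s, StarLog.IsSqrtSymm Ω g z₀ s →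
      (∃ G, StarLog.IsMuLift Ω (fun q => StarLog.scalarPart g q / s q) z₀ G) ∧
      ∀ G, StarLog.IsMuLift Ω (fun q => StarLog.scalarPart g q / s q) z₀ G →
        interior {q | q ∈ Ω ∧ StarLog.nu (G q) = 0} = ∅ ∧
        (∀ q ∈ Ω, StarLog.nu (G q) = 0 →
          q ∉ StarLog.sphereOf z₀ ∧ ∀ p ∈ StarLog.sphereOf q, StarLog.vecPart g p = 0) ∧
        ∀ m : ℤ,
          ((∀ q ∈ StarLog.sphereOf z₀, ¬ StarLog.IsNegReal (s q)) → Even m) →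
          ((∀ q ∈ StarLog.sphereOf z₀, StarLog.IsNegReal (s q)) → Odd m) →
          (∃ L, StarLog.IsLogZero Ω (fun q => (-1) ^ m * s q) z₀ L) ∧
          ∀ L, StarLog.IsLogZero Ω (fun q => (-1) ^ m * s q) z₀ L →
            ∃ f, ω.IsSR f ∧ StarLog.IsStarLog Ω f g ∧
              ∀ q ∈ Ω, StarLog.nu (G q) ≠ 0 →
                f q = (L q + (m * Real.pi : ℝ) • StarLog.imagUnit q)
                  + (StarLog.nu (G q) * s q)⁻¹ * StarLog.vecPart g q := by
  open StarLog in
  have hr : RealFree Ω := hΩ.no_real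
  have hs := hΩ.axSymm
  have hzΩ := mem_of_zeroSet_eq hz₀
  have hw := coord_mem_up hs hr hzΩ
  refine ⟨exists_isSqrtSymm hΩ hg hg0 hz₀, fun s hsq =>
    ⟨exists_isMuLift hΩ hg hg0 hz₀ hsq, fun G hG => ?_⟩⟩
  obtain ⟨σ, hσ, hsσ, hσ2, -⟩ := hsq.exists_stem hs hr hzΩ
  have hσ0 : ∀ z ∈ up Ω, σ z ≠ 0 := fun z hz h0 => by
    refine cnorm_stem_ne_zero hs hr hg.1 hg0 hz ?_
    rw [← hσ2 z hz, h0]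
    simp
  obtain ⟨γ, hγ, hGγ, hγμ, hγ0⟩ := hG.exists_stem hs hr hzΩ hsσ hσ0
  have hνG : ∀ q ∈ Ω, nu (G q) = ev (fun z => nuC (γ z)) q := fun q hq => by
    rw [hGγ q hq, nu_ev (hr.im_ne_zero hq)]
  refine ⟨?_, fun q hq hq0 => ?_, fun m heven hodd => ?_⟩
  · have hset : {q | q ∈ Ω ∧ nu (G q) = 0} = {q | q ∈ Ω ∧ ev (fun z => nuC (γ z)) q = 0} := by
      ext q
      exact and_congr_right fun hq => by rw [hνG q hq]
    rw [hset]
    refine interior_setOf_ev_eq_zero hΩ.toIsAxSymmDomain hr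
      (differentiable_nuC.comp_differentiableOn hγ) ⟨_, hw, ?_⟩
    rw [hγ0, nuC_zero]
    exact one_ne_zero
  · rw [hνG q hq, ev_eq_zero_iff (hr.im_ne_zero hq)] at hq0
    refine ⟨fun hmem => ?_, fun p hp => ?_⟩
    · rw [coord_eq_of_mem_sphereOf hmem, hγ0, nuC_zero] at hq0
      exact one_ne_zero hq0
    -- The divisibility V = ν(γ)σW makes V vanish wherever ν(γ) does, hence on the whole sphere.
    · obtain ⟨W, -, -, hVW, -⟩ := exists_stem_quotient hΩ.toIsAxSymmDomain hr hg hz₀ hσ hσ0 hσ2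
        hγ hγμ hγ0
      refine vecPart_eq_zero_of_stem hs hr hg.1 (mem_of_mem_sphereOf hs hr hq hp) ?_
      rw [coord_eq_of_mem_sphereOf hp, hVW _ (coord_mem_up hs hr hq), hq0, zero_mul,
        Quaternion.coe_zero, zero_mul]
  · have hh : ∀ q ∈ Ω, (-1) ^ m * s q = ev (fun z => (-1) ^ m * σ z) q := fun q hq => by
      rw [hsσ q hq, neg_one_zpow_mul_ev (hr.im_ne_zero hq)]
    refine ⟨exists_isLogZero hΩ hzΩ (hσ.const_mul _)
      (fun z hz => mul_ne_zero (zpow_ne_zero _ (neg_ne_zero.2 one_ne_zero)) (hσ0 z hz)) hh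
      (neg_one_zpow_mul_mem_slitPlane hs hr hzΩ hsσ hσ0 heven hodd), fun L hL => ?_⟩
    obtain ⟨l, hl, hLl, -⟩ := hL.srReal.exists_ev hs hr
    obtain ⟨f, hf, hfg, hfq⟩ := exists_starLog hΩ.toIsAxSymmDomain hr hg hz₀ hσ hσ0 hσ2 hγ hγμ hγ0
      hl ((isStarLog_ev_iff hs hr hLl hh).1 hL.isLog)
    refine ⟨f, hf, hfg, fun q hq hq0 => ?_⟩
    rw [hGγ q hq] at hq0 ⊢
    rw [hfq q hq hq0, hLl q hq, hsσ q hq]
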